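/- Let $d\ge 2$, $0<r<1$, $s=d/2+r$. Let $\dot H^{-s}$ be the complex Hilbert space obtained by completing $\{f\in\mathcal S(\mathbb R^d):\|f\|<\infty\}$ for the norm $\|f\|^2=\int|\hat f(\xi)|^2|\xi|^{-2s}\,d\xi$, where $\hat f(\xi)=(2\pi)^{-d/2}\int f(x)e^{-i\xi\cdot x}\,dx$; it is identified through the Fourier transform with $L^2(|\xi|^{-2s}d\xi)$, and a finite signed measure is identified with the element of $\dot H^{-s}$ having the same Fourier transform, if there is one. Let $(\gamma_{v,w})_{v,w\in\mathbb R^d}$ be a measurable family of positive measures on $(\mathbb R^d)^2$ such that, for all $v,w$, $v'+w'=v+w$ and $|w'-v'|=|w-v|$ for $\gamma_{v,w}$-almost every $(v',w')$, and $\gamma_{Jv,Jw}=(J,J)_\#\gamma_{v,w}$ for every orientation-preserving isometry $J$ of $\mathbb R^d$ (for every isometry if $d=2$). Assume that the model is Maxwellian: there is a measure $\bar\gamma$ on $(0,\pi]$ which, for all $v\ne w$, is the image of $\gamma_{v,w}$ under the deviation angle $\theta\in[0,\pi]$ between $v-w$ and $v'-w'$, restricted to $(0,\pi]$. Assume that \[\kappa=\int_{(0,\pi]}\big[1-\cos(\theta/2)^r-\sin(\theta/2)^r\big]\,d\bar\gamma(\theta)\]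 is finite (the integrand is integrable). Let $\mathcal P_r$ be the set of probability measures $\mu$ on $\mathbb R^d$ with $\int|x|^r\,d\mu(x)<\infty$, and \[Q(\mu,\nu)=\frac12\int\Big(\int(-\delta_v-\delta_w+\delta_{v'}+\delta_{w'})\,d\gamma_{v,w}(v',w')\Big)\,d\mu(v)\,d\nu(w),\qquad \mu,\nu\in\mathcal P_r .\] Then: 1. Every difference of two finite positive measures of equal mass with finite $r$-th moment belongs to $\dot H^{-s}$, and both integrals defining $Q(\mu,\nu)$ are absolutely convergent in $\dot H^{-s}$ for all $\mu,\nu\in\mathcal P_r$. 2. The complex linear span $T$ of $\{\nu-\nu':\nu,\nu'\in\mathcal P_r\}$ is dense in $\dot H^{-s}$. 3. The restriction of $\mu\mapsto Q(\mu,\mu)$ to $\mathcal P_r$ satisfies the contractivity hypothesis with constant $\kappa$: for every $\mu\in\mathcal P_r$ there is a linear map $D_\mu:T\to\dot H^{-s}$ such that, for all $\nu,\nu'\in\mathcal P_r$, \[D_\mu(\nu-\mu)=\frac{d}{dt}\Big|_{t=0^+}Q\big((1-t)\mu+t\nu,(1-t)\mu+t\nu\big),\qquad D_\mu(\nu-\nu')=2\big(Q(\mu,\nu)-Q(\mu,\nu')\big),\]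 and \[\operatorname{Re}\langle D_\mu h,h\rangle\le-\kappa\|h\|^2\qquad\text{for all }h\in T .\] If moreover $\bar\gamma$ is finite, then $D_\mu$ extends to a bounded operator on $\dot H^{-s}$ satisfying this inequality for all $h\in\dot H^{-s}$. -/

import Mathlib

open MeasureTheory ProbabilityTheory Set
open scoped ENNReal Topology SchwartzMap

noncomputable section

namespace Boltzmann

/-- The velocity space `ℝ^d` with its Euclidean structure. -/
abbrev Vel (d : ℕ) : Type := EuclideanSpace ℝ (Fin d)

/-! ### The homogeneous Sobolev space of order `-s` -/

/-- The measure `|ξ|^(-2s) dξ` on `ℝ^d`. -/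
def sobolevWeight (d : ℕ) (s : ℝ) : Measure (Vel d) :=
  volume.withDensity fun ξ => ENNReal.ofReal (‖ξ‖ ^ (-2 * s))

/-- The homogeneous Sobolev space `Ḣ^{-s}(ℝ^d)`, each element being represented by its Fourier
transform, an element of the complex Hilbert space `L²(|ξ|^(-2s) dξ)`.  Thus the scalar product is
`∫ f̂ · conj ĝ · |ξ|^(-2s) dξ`.  By `dense_schwartzElements` below, this Hilbert space is
the completion of the Schwartz functions whose norm is finite. -/
abbrev Hdot (d : ℕ) (s : ℝ) : Type := Lp ℂ 2 (sobolevWeight d s)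

/-- Fourier transform of a function, unitary convention:
`f̂(ξ) = (2π)^(-d/2) ∫ f(x) exp(-i ξ·x) dx`. -/
def fourierFun {d : ℕ} (f : Vel d → ℂ) (ξ : Vel d) : ℂ :=
  (((2 * Real.pi) ^ (-(d : ℝ) / 2) : ℝ) : ℂ) *
    ∫ x, f x * Complex.exp (-Complex.I * (inner ℝ ξ x : ℝ))

theorem fourierFun_schwartz {d : ℕ} (f : 𝓢(Vel d, ℂ)) (ξ : Vel d) :
    fourierFun f ξ = (((2 * Real.pi) ^ (-(d : ℝ) / 2) : ℝ) : ℂ) *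
      (FourierTransform.fourier f) ((2 * Real.pi)⁻¹ • ξ) := by
  rw [SchwartzMap.fourier_coe, Real.fourier_eq', fourierFun]
  congr 2
  ext x
  rw [smul_eq_mul, mul_comm]
  congr 2
  rw [inner_smul_right, real_inner_comm]
  have : (Real.pi : ℂ) ≠ 0 := by exact_mod_cast Real.pi_ne_zero
  push_cast
  field_simp

/-- The elements of `Ḣ^{-s}` defined by the Schwartz functions whose norm
`(∫ |f̂(ξ)|² |ξ|^(-2s) dξ)^(1/2)` is finite. -/
def schwartzElements (d : ℕ) (s : ℝ) : Submodule ℂ (Hdot d s) where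
  carrier := {h | ∃ f : 𝓢(Vel d, ℂ), (h : Vel d → ℂ) =ᵐ[sobolevWeight d s] fourierFun f}
  add_mem' := by
    rintro a b ⟨f, hf⟩ ⟨g, hg⟩
    refine ⟨f + g, ?_⟩
    filter_upwards [Lp.coeFn_add a b, hf, hg] with ξ h1 h2 h3
    rw [h1, Pi.add_apply, h2, h3, fourierFun_schwartz, fourierFun_schwartz, fourierFun_schwartz,
      FourierTransform.fourier_add, add_apply, mul_add]
  zero_mem' := by
    refine ⟨0, ?_⟩
    filter_upwards [Lp.coeFn_zero ℂ 2 (sobolevWeight d s)] with ξ h1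
    rw [h1]
    simp [fourierFun]
  smul_mem' := by
    rintro c a ⟨f, hf⟩
    refine ⟨c • f, ?_⟩
    filter_upwards [Lp.coeFn_smul c a, hf] with ξ h1 h2
    rw [h1, Pi.smul_apply, h2, fourierFun_schwartz, fourierFun_schwartz,
      FourierTransform.fourier_smul, smul_apply, smul_eq_mul, smul_eq_mul]
    ring

theorem exists_fourierFun_eq {d : ℕ} (φ : Vel d → ℂ) (h1 : HasCompactSupport φ)
    (h2 : ContDiff ℝ (⊤ : ℕ∞) φ) : ∃ f : 𝓢(Vel d, ℂ), fourierFun f = φ := by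
  have hpi : (2 * Real.pi) ≠ 0 := by positivity
  let e : Vel d ≃L[ℝ] Vel d := ContinuousLinearEquiv.smulLeft (Units.mk0 (2 * Real.pi) hpi)
  let ψ : 𝓢(Vel d, ℂ) := SchwartzMap.compCLMOfContinuousLinearEquiv ℂ e (h1.toSchwartzMap h2)
  let c : ℂ := (((2 * Real.pi) ^ (-(d : ℝ) / 2) : ℝ) : ℂ)
  have hc : c ≠ 0 := by
    have : ((2 * Real.pi) ^ (-(d : ℝ) / 2) : ℝ) ≠ 0 := by positivity
    exact Complex.ofReal_ne_zero.2 this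
  refine ⟨c⁻¹ • FourierTransformInv.fourierInv ψ, funext fun ξ => ?_⟩
  rw [fourierFun_schwartz, FourierTransform.fourier_smul, FourierTransform.fourier_fourierInv_eq,
    smul_apply, smul_eq_mul, ← mul_assoc]
  change c * c⁻¹ * φ ((2 * Real.pi) • ((2 * Real.pi)⁻¹ • ξ)) = φ ξ
  rw [mul_inv_cancel₀ hc, one_mul, smul_inv_smul₀ hpi]

theorem sobolevWeight_compact_lt_top {d : ℕ} (s : ℝ) {K : Set (Vel d)} (hK : IsCompact K)
    (h0 : K ⊆ {0}ᶜ) : sobolevWeight d s K < ∞ := by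
  have hcont : ContinuousOn (fun ξ : Vel d => ‖ξ‖ ^ (-2 * s)) K := by
    refine ContinuousOn.rpow_const continuous_norm.continuousOn fun x hx => Or.inl ?_
    exact norm_ne_zero_iff.2 (h0 hx)
  obtain ⟨C, hC⟩ := hK.exists_bound_of_continuousOn hcont
  rw [sobolevWeight, withDensity_apply _ hK.measurableSet]
  refine lt_of_le_of_lt (setLIntegral_mono' hK.measurableSet
    (g := fun _ => ENNReal.ofReal C) fun x hx => ?_) ?_
  · exact ENNReal.ofReal_le_ofReal ((le_abs_self _).trans (hC x hx))
  · rw [setLIntegral_const]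
    exact ENNReal.mul_lt_top ENNReal.ofReal_lt_top hK.measure_lt_top

/-- `Ḣ^{-s}` is the completion of the space of Schwartz functions having a finite norm. -/
theorem dense_schwartzElements {d : ℕ} (hd : 0 < d) (s : ℝ) :
    Dense (schwartzElements d s : Set (Hdot d s)) := by
  have : Nonempty (Fin d) := ⟨⟨0, hd⟩⟩
  have hnull : sobolevWeight d s {0} = 0 :=
    withDensity_absolutelyContinuous _ _ (measure_singleton _)
  rw [Submodule.dense_iff_topologicalClosure_eq_top, Submodule.topologicalClosure_eq_top_iff,
    Submodule.eq_bot_iff]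
  intro g hg
  rw [Submodule.mem_orthogonal] at hg
  have hloc : LocallyIntegrableOn (g : Vel d → ℂ) {0}ᶜ (sobolevWeight d s) := by
    rw [locallyIntegrableOn_iff isOpen_compl_singleton.isLocallyClosed]
    intro K hK0 hK
    have : IsFiniteMeasure ((sobolevWeight d s).restrict K) :=
      ⟨by rw [Measure.restrict_apply_univ]; exact sobolevWeight_compact_lt_top s hK hK0⟩
    exact ((Lp.memLp g).restrict K).integrable (by norm_num)
  have key := isOpen_compl_singleton.ae_eq_zero_of_integral_contDiff_smul_eq_zero hloc (by
    intro φ hφ hφc hφ0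
    obtain ⟨f, hf⟩ := exists_fourierFun_eq (fun x => (φ x : ℂ))
      (hφc.comp_left (g := fun y : ℝ => (y : ℂ)) Complex.ofReal_zero)
      (Complex.ofRealCLM.contDiff.comp hφ)
    have hmem : MemLp (fun x => (φ x : ℂ)) 2 (sobolevWeight d s) := by
      have hc : Continuous fun x => (φ x : ℂ) := Complex.continuous_ofReal.comp hφ.continuous
      obtain ⟨C, hC⟩ := hφ.continuous.bounded_above_of_compact_support hφc
      have : IsFiniteMeasure ((sobolevWeight d s).restrict (tsupport φ)) :=
        ⟨by rw [Measure.restrict_apply_univ]; exact sobolevWeight_compact_lt_top s hφc hφ0⟩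
      have h1 : MemLp (fun x => (φ x : ℂ)) 2 ((sobolevWeight d s).restrict (tsupport φ)) :=
        MemLp.of_bound hc.aestronglyMeasurable C (Filter.Eventually.of_forall fun x => by
          simpa using hC x)
      rw [← memLp_indicator_iff_restrict (isClosed_tsupport φ).measurableSet] at h1
      convert h1 using 1
      ext x
      by_cases hx : x ∈ tsupport φ
      · rw [Set.indicator_of_mem hx]
      · rw [Set.indicator_of_notMem hx, image_eq_zero_of_notMem_tsupport hx, Complex.ofReal_zero]
    have h2 := hg (hmem.toLp _) ⟨f, by rw [hf]; exact hmem.coeFn_toLp⟩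
    rw [L2.inner_def] at h2
    rw [← h2]
    refine integral_congr_ae ?_
    filter_upwards [hmem.coeFn_toLp] with x hx
    rw [hx]
    simp [mul_comm])
  rw [Lp.eq_zero_iff_ae_eq_zero]
  have h0 : ∀ᵐ x ∂(sobolevWeight d s), x ∈ ({0}ᶜ : Set (Vel d)) := compl_mem_ae_iff.2 hnull
  filter_upwards [key, h0] with x h1 h2
  exact h1 h2

/-- Fourier transform of a measure, same convention. -/
def fourierMeas {d : ℕ} (μ : Measure (Vel d)) (ξ : Vel d) : ℂ :=
  (((2 * Real.pi) ^ (-(d : ℝ) / 2) : ℝ) : ℂ) *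
    ∫ x, Complex.exp (-Complex.I * (inner ℝ ξ x : ℝ)) ∂μ

open Classical in
/-- The signed measure `μ - ν` seen as an element of `Ḣ^{-s}` (and `0` when its Fourier transform
is not square integrable against `|ξ|^(-2s) dξ`). -/
def ofDiff {d : ℕ} (s : ℝ) (μ ν : Measure (Vel d)) : Hdot d s :=
  if h : MemLp (fun ξ => fourierMeas μ ξ - fourierMeas ν ξ) 2 (sobolevWeight d s)
  then h.toLp _ else 0

/-- The probability measures on `ℝ^d` having a polynomial moment of order `r`. -/
def probMoment (d : ℕ) (r : ℝ) : Set (Measure (Vel d)) :=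
  {μ | IsProbabilityMeasure μ ∧ Integrable (fun x => ‖x‖ ^ r) μ}

/-- The linear span, in `Ḣ^{-(d/2+r)}`, of the differences of two probability measures having an
`r`-th moment. -/
def zeroMass (d : ℕ) (r : ℝ) : Submodule ℂ (Hdot d (d / 2 + r)) :=
  Submodule.span ℂ {h | ∃ μ ∈ probMoment d r, ∃ ν ∈ probMoment d r, h = ofDiff (d / 2 + r) μ ν}

/-! ### The collision model -/

/-- A collision model: `γ (v, w)` is the positive measure of the rates of the post-collisional
velocities `(v', w')` of two particles having velocities `v` and `w`.  Momentum and energy are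
conserved, and the model is invariant by the positive isometries; in dimension `2`, where these do
not act transitively on the two possible outcomes having the same deviation angle, it is
invariant by all the isometries. -/
structure CollisionModel (d : ℕ) where
  γ : Kernel (Vel d × Vel d) (Vel d × Vel d)
  momentum : ∀ v w, ∀ᵐ q ∂(γ (v, w)), q.1 + q.2 = v + w
  energy : ∀ v w, ∀ᵐ q ∂(γ (v, w)), ‖q.2 - q.1‖ = ‖w - v‖
  isometry : ∀ J : Vel d ≃ᵃⁱ[ℝ] Vel d,
    (d = 2 ∨ 0 < LinearMap.det (J.linearIsometryEquiv.toLinearEquiv : Vel d →ₗ[ℝ] Vel d)) →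
    ∀ v w, γ (J v, J w) = (γ (v, w)).map (Prod.map J J)

namespace CollisionModel

variable {d : ℕ} (M : CollisionModel d)

/-- The image of `γ (v, w)` by the deviation angle in the collision referential, i.e. the angle
between the relative velocities `v - w` and `v' - w'`, as a measure on `(0, π]`. -/
def angularMeasure (v w : Vel d) : Measure ℝ :=
  ((M.γ (v, w)).map fun q => InnerProductGeometry.angle (v - w) (q.1 - q.2)).restrict
    (Ioc 0 Real.pi)

/-- The model is Maxwellian: its angular measure does not depend on the relative speed `|v - w|`,
and `γbar` is the common value. -/
def IsMaxwellianWith (γbar : Measure ℝ) : Prop :=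
  ∀ v w : Vel d, v ≠ w → M.angularMeasure v w = γbar

/-- `-δ_v - δ_w + δ_v' + δ_w'` as an element of `Ḣ^{-s}`, where `p = (v, w)`, `q = (v', w')`. -/
def increment (s : ℝ) (p q : Vel d × Vel d) : Hdot d s :=
  ofDiff s (Measure.dirac q.1 + Measure.dirac q.2) (Measure.dirac p.1 + Measure.dirac p.2)

/-- The collision kernel
`Q(μ, ν) = 1/2 ∫ (∫ (-δ_v - δ_w + δ_v' + δ_w') dγ_{v,w}(v', w')) dμ(v) dν(w)`, as an
integral with values in `Ḣ^{-s}`. -/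
def Q (s : ℝ) (μ ν : Measure (Vel d)) : Hdot d s :=
  (1 / 2 : ℝ) • ∫ p, (∫ q, increment s p q ∂(M.γ p)) ∂(μ.prod ν)

/-- All that enters the definition of `Q` on the probability measures having an `r`-th moment
makes sense in `Ḣ^{-(d/2+r)}`: signed measures of mass zero having an `r`-th moment are
elements of that space, and both integrals converge absolutely. -/
def QWellDefined (r : ℝ) : Prop :=
  (∀ μ ν : Measure (Vel d), IsFiniteMeasure μ → IsFiniteMeasure ν → μ univ = ν univ →
      Integrable (fun x => ‖x‖ ^ r) μ → Integrable (fun x => ‖x‖ ^ r) ν →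
      MemLp (fun ξ => fourierMeas μ ξ - fourierMeas ν ξ) 2 (sobolevWeight d (d / 2 + r))) ∧
  (∀ p, Integrable (fun q => increment (d / 2 + r) p q) (M.γ p)) ∧
  (∀ μ ∈ probMoment d r, ∀ ν ∈ probMoment d r,
      Integrable (fun p => ∫ q, increment (d / 2 + r) p q ∂(M.γ p)) (μ.prod ν))

/-- The densely defined operator `D` of `Ḣ^{-(d/2+r)}` is the derivative at `μ` of
`ρ ↦ Q(ρ, ρ)`, restricted to the probability measures having an `r`-th moment; it is
`2 Q(μ, ·)`. -/
def IsDerivAt (r : ℝ) (μ : Measure (Vel d))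
    (D : zeroMass d r →ₗ[ℂ] Hdot d (d / 2 + r)) : Prop :=
  (∀ ν ∈ probMoment d r, ∀ h : zeroMass d r, (h : Hdot d (d / 2 + r)) = ofDiff (d / 2 + r) ν μ →
    HasDerivWithinAt
      (fun t : ℝ =>
        M.Q (d / 2 + r) (ENNReal.ofReal (1 - t) • μ + ENNReal.ofReal t • ν)
          (ENNReal.ofReal (1 - t) • μ + ENNReal.ofReal t • ν))
      (D h) (Icc 0 1) 0) ∧
  (∀ ν ∈ probMoment d r, ∀ ν' ∈ probMoment d r, ∀ h : zeroMass d r,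
    (h : Hdot d (d / 2 + r)) = ofDiff (d / 2 + r) ν ν' →
      D h = (2 : ℝ) • (M.Q (d / 2 + r) μ ν - M.Q (d / 2 + r) μ ν'))

end CollisionModel

/-- The function whose integral against the angular measure is the contractivity constant. -/
def kappaDensity (r θ : ℝ) : ℝ := 1 - Real.cos (θ / 2) ^ r - Real.sin (θ / 2) ^ r

end Boltzmann

end

/-!
Everything takes place on the Fourier side, with `W = |ξ|^(-2s) dξ` and `s = d/2 + r`.

A collision of `v` and `w` with relative velocity `u = w - v` replaces `u` by a vector of the same
length.  Invariance under the isometries and the Maxwellian assumption say that the deviation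
angle `θ` follows `γbar` and that the direction of deviation is isotropic around `u`; this is
tested against plane waves in `integral_effective_phase`.  The uniform direction is produced by
projecting a Gaussian vector `g` on the orthogonal of `u` (`tilt`), which replaces the Haar measure
of the rotation group.  A reflection exchanging the lines of `u` and of the frequency `ξ` shows
that tilting `u` towards `g` or tilting `ξ` towards `g` has the same average effect on the
scalar product `ξ·u` (`integral_tilt_symm`, `integral_pairWave_symm`).  This is Bobylev's duality:
the Fourier transform of the collision increment is an average over `(θ, g)` of

`e^{-i ξ₋·v} e^{-i ξ₊·w} + e^{-i ξ₊·v} e^{-i ξ₋·w} - e^{-i ξ·v} - e^{-i ξ·w}`,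

where `ξ₊ = fwd θ ξ g` and `ξ₋ = bwd θ ξ g` have the sum `ξ` and are `ξ` tilted and
contracted by `cos (θ/2)` and `sin (θ/2)` (`inner_meanIncrement`, `dualKernel_eq`).  In particular
the increment is symmetric in `v` and `w`, so that `Q` is a symmetric bilinear map and its
derivative at `μ` is `2 Q(μ, ·)`.

Integrating against a difference of measures of Fourier transform `G`, the linearized collisions
with a particle of velocity `v` act by `G ↦ e^{-i ξ₋·v} G(ξ₊) + e^{-i ξ₊·v} G(ξ₋) - G`
(`gainLoss`).  Tilting at random preserves `W` (`lintegral_tilt`), because an isotropic measure is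
determined by the law of the norm (`ext_of_isotropic`), and contracting by `t` multiplies the norm
of `Ḣ^{-s}` by `t ^ r` (`lintegral_smul_tilt`).  By the Cauchy–Schwarz inequality the quadratic form
of the gain terms is at most `(cos (θ/2) ^ r + sin (θ/2) ^ r) ‖h‖²`, and integrating in `θ`,
then in `v`, gives the bound by `-κ ‖h‖²` (`linQ_re_le`), as well as the bound `3 γbar(ℝ) ‖h‖` of
the operator when `γbar` is finite (`norm_linQ_le`).

Absolute convergence follows from `‖δ_x - δ_y‖ ≤ C |x - y| ^ r` and its second-order analogue for
the four point masses of a collision, through the elementary inequality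
`min (cos (θ/2)) (sin (θ/2)) ^ r ≤ C (cos (θ/2) ^ r + sin (θ/2) ^ r - 1)` (`kappaDensity_bound`).
The differences of point masses span a dense subspace by injectivity of the Fourier transform of
integrable functions (`dense_zeroMass`).

The operator `2 Q(μ, ·)` is first defined on formal combinations of differences of probability
measures.  That it only depends on the element of `Ḣ^{-s}` represented by the combination follows
from the bound of the quadratic form and the density, since a densely defined linear relation with
a quadratic form bounded above is single-valued (`eq_zero_of_dissipative`).
-/


noncomputable section

namespace Boltzmann

variable {d : ℕ}

/-! ### A random direction orthogonal to a given vector -/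

/-- The component of `x` orthogonal to `u`; it is `x` when `u = 0`. -/
def perp (u x : Vel d) : Vel d := x - (inner ℝ u x / ‖u‖ ^ 2) • u

/-- The direction of the component of `g` orthogonal to `u`: a unit vector, or `0` in the
degenerate case where that component vanishes. -/
def perpDir (u g : Vel d) : Vel d := ‖perp u g‖⁻¹ • perp u g

/-- For `a = cos α` and `b = sin α`, the vector obtained by turning `u` by the angle `α` towards
the direction of `g`. -/
def tilt (a b : ℝ) (u g : Vel d) : Vel d := a • u + (b * ‖u‖) • perpDir u g

/-- The image of `x` by a rotation around `u` which gives to the component of `x` orthogonal to `u`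
the direction of `g`. -/
def turn (u x g : Vel d) : Vel d := x - perp u x + ‖perp u x‖ • perpDir u g

/-- The Gaussian probability measure `exp (-π |x|²) dx`, used as an isotropic source of
directions. -/
def gauss (d : ℕ) : Measure (Vel d) :=
  volume.withDensity fun x => ENNReal.ofReal (Real.exp (-Real.pi * ‖x‖ ^ 2))

instance : IsProbabilityMeasure (gauss d) := by
  constructor
  have h := GaussianFourier.integral_rexp_neg_mul_sq_norm (V := Vel d) Real.pi_pos
  rw [div_self Real.pi_ne_zero, Real.one_rpow] at h
  rw [gauss, withDensity_apply _ MeasurableSet.univ, Measure.restrict_univ,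
    ← ofReal_integral_eq_lintegral_ofReal, h, ENNReal.ofReal_one]
  · exact Integrable.of_integral_ne_zero (by rw [h]; exact one_ne_zero)
  · exact Filter.Eventually.of_forall fun x => (Real.exp_pos _).le

theorem measurePreserving_gauss (J : Vel d ≃ₗᵢ[ℝ] Vel d) :
    MeasurePreserving J (gauss d) (gauss d) := by
  refine ⟨J.continuous.measurable, ?_⟩
  ext s hs
  have h1 : MeasurableSet (J ⁻¹' s) := J.continuous.measurable hs
  rw [Measure.map_apply J.continuous.measurable hs, gauss, withDensity_apply _ h1,
    withDensity_apply _ hs, ← J.measurePreserving.setLIntegral_comp_preimage hs (by fun_prop)]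
  simp

theorem perp_inner (u x : Vel d) : inner ℝ u (perp u x) = 0 := by
  rw [perp, inner_sub_right, inner_smul_right, real_inner_self_eq_norm_sq]
  by_cases hu : u = 0
  · simp [hu]
  · have : ‖u‖ ^ 2 ≠ 0 := by simpa using hu
    field_simp
    ring

theorem sub_perp (u x : Vel d) : x - perp u x = (inner ℝ u x / ‖u‖ ^ 2) • u := by
  simp [perp]

theorem perp_smul_left {t : ℝ} (ht : t ≠ 0) (u x : Vel d) : perp (t • u) x = perp u x := by
  rw [perp, perp, inner_smul_left, norm_smul, smul_smul]
  by_cases hu : u = 0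
  · simp [hu]
  · have : ‖u‖ ^ 2 ≠ 0 := by simpa using hu
    congr 2
    simp only [Real.norm_eq_abs, mul_pow, sq_abs, conj_trivial]
    field_simp

theorem perpDir_smul_left {t : ℝ} (ht : t ≠ 0) (u x : Vel d) :
    perpDir (t • u) x = perpDir u x := by
  rw [perpDir, perpDir, perp_smul_left ht]

theorem perp_map (J : Vel d ≃ₗᵢ[ℝ] Vel d) (u x : Vel d) : perp (J u) (J x) = J (perp u x) := by
  simp [perp]

theorem perpDir_map (J : Vel d ≃ₗᵢ[ℝ] Vel d) (u x : Vel d) :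
    perpDir (J u) (J x) = J (perpDir u x) := by
  simp [perpDir, perp_map]

theorem tilt_map (J : Vel d ≃ₗᵢ[ℝ] Vel d) (a b : ℝ) (u x : Vel d) :
    tilt a b (J u) (J x) = J (tilt a b u x) := by
  simp [tilt, perpDir_map]

theorem inner_perpDir (u g : Vel d) : inner ℝ u (perpDir u g) = 0 := by
  rw [perpDir, inner_smul_right, perp_inner, mul_zero]

theorem norm_perpDir_le (u g : Vel d) : ‖perpDir u g‖ ≤ 1 := by
  rw [perpDir, norm_smul, norm_inv, norm_norm]
  exact inv_mul_le_one

theorem norm_perpDir {u g : Vel d} (h : perp u g ≠ 0) : ‖perpDir u g‖ = 1 := by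
  rw [perpDir, norm_smul, norm_inv, norm_norm, inv_mul_cancel₀ (norm_ne_zero_iff.2 h)]

/-- The degenerate case of `perpDir` has probability zero. -/
theorem perp_ne_zero_ae (hd : 2 ≤ d) (u : Vel d) : ∀ᵐ g ∂(gauss d), perp u g ≠ 0 := by
  have h0 : (volume : Measure (Vel d)) (Submodule.span ℝ {u} : Submodule ℝ (Vel d)) = 0 := by
    refine Measure.addHaar_submodule _ _ fun h => ?_
    have h1 := finrank_span_le_card (R := ℝ) ({u} : Set (Vel d))
    rw [h, finrank_top] at h1
    simp at h1
    omega
  have h1 : gauss d (Submodule.span ℝ {u} : Submodule ℝ (Vel d)) = 0 :=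
    withDensity_absolutelyContinuous _ _ h0
  filter_upwards [compl_mem_ae_iff.2 h1] with g hg h2
  refine hg ?_
  have h3 := sub_perp u g
  rw [h2, sub_zero] at h3
  rw [h3]
  exact Submodule.smul_mem _ _ (Submodule.mem_span_singleton_self u)

theorem norm_tilt_sq (a b : ℝ) (u g : Vel d) :
    ‖tilt a b u g‖ ^ 2 = (a ^ 2 + b ^ 2 * ‖perpDir u g‖ ^ 2) * ‖u‖ ^ 2 := by
  rw [tilt, norm_add_sq_real, inner_smul_left, inner_smul_right, inner_perpDir, norm_smul,
    norm_smul, norm_mul, norm_norm, mul_pow, mul_pow, mul_pow, Real.norm_eq_abs, Real.norm_eq_abs,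
    sq_abs, sq_abs]
  ring

theorem norm_tilt_le {a b : ℝ} (h : a ^ 2 + b ^ 2 = 1) (u g : Vel d) : ‖tilt a b u g‖ ≤ ‖u‖ := by
  refine le_of_sq_le_sq ?_ (norm_nonneg _)
  rw [norm_tilt_sq]
  have h1 : ‖perpDir u g‖ ^ 2 ≤ 1 := pow_le_one₀ (norm_nonneg _) (norm_perpDir_le u g)
  have h2 : a ^ 2 + b ^ 2 * ‖perpDir u g‖ ^ 2 ≤ 1 := by nlinarith [sq_nonneg b]
  nlinarith [sq_nonneg ‖u‖]

theorem norm_tilt {a b : ℝ} (h : a ^ 2 + b ^ 2 = 1) {u g : Vel d} (hg : perp u g ≠ 0) :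
    ‖tilt a b u g‖ = ‖u‖ := by
  rw [← sq_eq_sq₀ (norm_nonneg _) (norm_nonneg _), norm_tilt_sq, norm_perpDir hg, one_pow, mul_one,
    h, one_mul]

@[fun_prop]
theorem measurable_perp {α : Type*} [MeasurableSpace α] {f g : α → Vel d} (hf : Measurable f)
    (hg : Measurable g) : Measurable fun x => perp (f x) (g x) := by
  unfold perp; fun_prop

@[fun_prop]
theorem measurable_perpDir {α : Type*} [MeasurableSpace α] {f g : α → Vel d} (hf : Measurable f)
    (hg : Measurable g) : Measurable fun x => perpDir (f x) (g x) := by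
  unfold perpDir; fun_prop

@[fun_prop]
theorem measurable_tilt {α : Type*} [MeasurableSpace α] {a b : α → ℝ} {f g : α → Vel d}
    (ha : Measurable a) (hb : Measurable b) (hf : Measurable f)
    (hg : Measurable g) : Measurable fun x => tilt (a x) (b x) (f x) (g x) := by
  unfold tilt; fun_prop

@[fun_prop]
theorem measurable_turn {α : Type*} [MeasurableSpace α] {f g h : α → Vel d} (hf : Measurable f)
    (hg : Measurable g) (hh : Measurable h) : Measurable fun x => turn (f x) (g x) (h x) := by
  unfold turn; fun_prop

/-- A reflection exchanging the directions of `x` and `y`. -/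
theorem exists_swap (x y : Vel d) : ∃ J : Vel d ≃ₗᵢ[ℝ] Vel d, J (‖y‖ • x) = ‖x‖ • y ∧
    J (‖x‖ • y) = ‖y‖ • x ∧ ∀ z, inner ℝ z x = 0 → inner ℝ z y = 0 → J z = z := by
  have h : ‖‖y‖ • x‖ = ‖‖x‖ • y‖ := by simp [norm_smul, mul_comm]
  have h1 := Submodule.reflection_sub h
  have h2 := congrArg (ℝ ∙ (‖y‖ • x - ‖x‖ • y))ᗮ.reflection h1
  rw [Submodule.reflection_reflection] at h2
  refine ⟨(ℝ ∙ (‖y‖ • x - ‖x‖ • y))ᗮ.reflection, h1, h2.symm, fun z hx hy => ?_⟩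
  refine Submodule.reflection_mem_subspace_eq_self ?_
  rw [Submodule.mem_orthogonal_singleton_iff_inner_left, inner_sub_right, inner_smul_right,
    inner_smul_right, hx, hy]
  simp

/-- The law of the scalar product of `ξ` with a vector making a fixed angle with `u`, of length
`|u|` and otherwise uniform, is symmetric in `u` and `ξ`. -/
theorem integral_tilt_symm (F : ℝ → ℂ) (a b : ℝ) (u ξ : Vel d) :
    ∫ g, F (inner ℝ ξ (tilt a b u g)) ∂(gauss d) =
      ∫ g, F (inner ℝ u (tilt a b ξ g)) ∂(gauss d) := by
  by_cases hu : u = 0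
  · simp [hu, tilt]
  by_cases hξ : ξ = 0
  · simp [hξ, tilt]
  have hu' := norm_ne_zero_iff.2 hu
  have hξ' := norm_ne_zero_iff.2 hξ
  obtain ⟨J, hJ1, hJ2, -⟩ := exists_swap u ξ
  conv_rhs => rw [← (measurePreserving_gauss J).integral_comp J.toHomeomorph.measurableEmbedding]
  congr 1
  ext g
  have key : ‖u‖ * inner ℝ ξ (perpDir u g) = ‖ξ‖ * inner ℝ u (perpDir ξ (J g)) := by
    rw [← real_inner_smul_left, ← J.inner_map_map, hJ2, ← perpDir_map,
      ← perpDir_smul_left hξ' (J u), ← map_smul, hJ1, perpDir_smul_left hu',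
      real_inner_smul_left]
  congr 1
  rw [tilt, tilt, inner_add_right, inner_add_right, inner_smul_right, inner_smul_right,
    inner_smul_right, inner_smul_right, real_inner_comm u ξ, mul_assoc, key, mul_assoc]

/-- Turning uniformly `x` around `u`, or `y` around `u`, gives the same law to the scalar
product of `x` and `y`. -/
theorem integral_turn_symm (F : ℝ → ℂ) (u x y : Vel d) :
    ∫ g, F (inner ℝ y (turn u x g)) ∂(gauss d) =
      ∫ g, F (inner ℝ x (turn u y g)) ∂(gauss d) := by
  obtain ⟨J, hJ1, hJ2, hJ3⟩ := exists_swap (perp u x) (perp u y)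
  have hJu := hJ3 u (perp_inner u x) (perp_inner u y)
  conv_rhs => rw [← (measurePreserving_gauss J).integral_comp J.toHomeomorph.measurableEmbedding]
  congr 1
  ext g
  have key : ‖perp u x‖ * inner ℝ (perp u y) (perpDir u g) =
      ‖perp u y‖ * inner ℝ (perp u x) (perpDir u (J g)) := by
    rw [← real_inner_smul_left, ← J.inner_map_map, hJ2, ← perpDir_map, hJu,
      real_inner_smul_left]
  have h1 : ∀ x g : Vel d, inner ℝ x (perpDir u g) = inner ℝ (perp u x) (perpDir u g) := by
    intro x g
    rw [perp, inner_sub_left, inner_smul_left, inner_perpDir, mul_zero, sub_zero]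
  have h2 : inner ℝ y (x - perp u x) = inner ℝ x (y - perp u y) := by
    rw [sub_perp, sub_perp, inner_smul_right, inner_smul_right, real_inner_comm u y,
      real_inner_comm u x]
    ring
  congr 1
  rw [turn, turn, inner_add_right, inner_add_right, h2, inner_smul_right, inner_smul_right, h1 y,
    h1 x, key]

theorem inner_turn (u x g : Vel d) : inner ℝ u (turn u x g) = inner ℝ u x := by
  rw [turn, inner_add_right, inner_sub_right, perp_inner, inner_smul_right, inner_perpDir]
  simp

theorem norm_turn {u g : Vel d} (hg : perp u g ≠ 0) (x : Vel d) : ‖turn u x g‖ = ‖x‖ := by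
  have h (z : Vel d) (hz : inner ℝ u z = 0) :
      ‖x - perp u x + z‖ ^ 2 = ‖x - perp u x‖ ^ 2 + ‖z‖ ^ 2 := by
    rw [norm_add_sq_real, sub_perp, inner_smul_left, hz]
    ring
  have h1 := h (perp u x) (perp_inner u x)
  have h2 := h (‖perp u x‖ • perpDir u g) (by rw [inner_smul_right, inner_perpDir, mul_zero])
  rw [norm_smul, norm_norm, norm_perpDir hg, mul_one, ← h1, sub_add_cancel] at h2
  exact (sq_eq_sq₀ (norm_nonneg _) (norm_nonneg _)).1 h2

theorem norm_turn_le (u x g : Vel d) : ‖turn u x g‖ ≤ ‖x‖ := by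
  have h (z : Vel d) (hz : inner ℝ u z = 0) :
      ‖x - perp u x + z‖ ^ 2 = ‖x - perp u x‖ ^ 2 + ‖z‖ ^ 2 := by
    rw [norm_add_sq_real, sub_perp, inner_smul_left, hz]
    ring
  have h1 := h (perp u x) (perp_inner u x)
  have h2 := h (‖perp u x‖ • perpDir u g) (by rw [inner_smul_right, inner_perpDir, mul_zero])
  rw [norm_smul, norm_norm] at h2
  rw [sub_add_cancel] at h1
  refine le_of_sq_le_sq ?_ (norm_nonneg _)
  rw [turn, h2, h1]
  have h3 : ‖perp u x‖ * ‖perpDir u g‖ ≤ ‖perp u x‖ :=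
    mul_le_of_le_one_right (norm_nonneg _) (norm_perpDir_le u g)
  gcongr

/-- A vector and its image by `turn u` are related by an isometry fixing `u`, of positive
determinant unless the dimension is `2`: in dimension at least `3`, the determinant
may be corrected by a reflection fixing both `u` and the image. -/
theorem exists_isometry_turn (hd : 2 ≤ d) {u g : Vel d} (hg : perp u g ≠ 0) (x : Vel d) :
    ∃ J : Vel d ≃ₗᵢ[ℝ] Vel d,
      (d = 2 ∨ 0 < LinearMap.det (J.toLinearEquiv : Vel d →ₗ[ℝ] Vel d)) ∧
      J u = u ∧ J x = turn u x g := by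
  set J := (ℝ ∙ (x - turn u x g))ᗮ.reflection with hJ
  have hJx : J x = turn u x g := Submodule.reflection_sub (norm_turn hg x).symm
  have hJu : J u = u := by
    refine Submodule.reflection_mem_subspace_eq_self ?_
    rw [Submodule.mem_orthogonal_singleton_iff_inner_left, inner_sub_right, inner_turn, sub_self]
  by_cases h2 : d = 2
  · exact ⟨J, Or.inl h2, hJu, hJx⟩
  rcases lt_trichotomy (LinearMap.det (J.toLinearEquiv : Vel d →ₗ[ℝ] Vel d)) 0 with h | h | h
  · have hne : (Submodule.span ℝ {u, turn u x g})ᗮ ≠ (⊥ : Submodule ℝ (Vel d)) := by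
      intro h0
      rw [Submodule.orthogonal_eq_bot_iff] at h0
      have h1 := finrank_span_finset_le_card (R := ℝ) ({u, turn u x g} : Finset (Vel d))
      rw [Finset.coe_pair, Set.finrank, h0, finrank_top, finrank_euclideanSpace_fin] at h1
      have := Finset.card_le_two (a := u) (b := turn u x g)
      omega
    obtain ⟨a, ha, ha0⟩ := Submodule.exists_mem_ne_zero_of_ne_bot hne
    rw [Submodule.mem_orthogonal] at ha
    have h3 : LinearMap.det ((ℝ ∙ a)ᗮ.reflection.toLinearEquiv : Vel d →ₗ[ℝ] Vel d) = -1 := by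
      rw [Submodule.det_reflection, Submodule.orthogonal_orthogonal, finrank_span_singleton ha0,
        pow_one]
    have h4 : ∀ z ∈ ({u, turn u x g} : Set (Vel d)), (ℝ ∙ a)ᗮ.reflection z = z := by
      intro z hz
      refine Submodule.reflection_mem_subspace_eq_self ?_
      rw [Submodule.mem_orthogonal_singleton_iff_inner_left]
      exact ha z (Submodule.subset_span hz)
    refine ⟨J.trans (ℝ ∙ a)ᗮ.reflection, Or.inr ?_, ?_, ?_⟩
    · have : ((J.trans (ℝ ∙ a)ᗮ.reflection).toLinearEquiv : Vel d →ₗ[ℝ] Vel d) =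
          ((ℝ ∙ a)ᗮ.reflection.toLinearEquiv : Vel d →ₗ[ℝ] Vel d) ∘ₗ
            (J.toLinearEquiv : Vel d →ₗ[ℝ] Vel d) := rfl
      rw [this, LinearMap.det_comp, h3]
      linarith
    · rw [LinearIsometryEquiv.trans_apply, hJu, h4 u (by simp)]
    · rw [LinearIsometryEquiv.trans_apply, hJx, h4 _ (by simp)]
  · exact absurd h (LinearEquiv.isUnit_det' J.toLinearEquiv).ne_zero
  · exact ⟨J, Or.inr h, hJu, hJx⟩

/-! ### Isotropic measures -/

theorem charFun_map_isometry (ν : Measure (Vel d)) {J : Vel d ≃ₗᵢ[ℝ] Vel d}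
    (hJ : ν.map J = ν) (ξ : Vel d) : charFun ν (J ξ) = charFun ν ξ := by
  conv_lhs => rw [← hJ]
  rw [charFun_apply, charFun_apply,
    integral_map J.continuous.measurable.aemeasurable (by fun_prop)]
  simp only [J.inner_map_map]

/-- The characteristic function of an isotropic measure, as an integral of a function of the
norm. -/
theorem charFun_isotropic (hd : 2 ≤ d) (ν : Measure (Vel d)) [IsFiniteMeasure ν]
    (h : ∀ J : Vel d ≃ₗᵢ[ℝ] Vel d, ν.map J = ν) (ξ : Vel d) :
    charFun ν ξ = ∫ ρ, (∫ g, Complex.exp ((ρ * inner ℝ ξ (perpDir 0 g) : ℝ) * Complex.I)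
      ∂(gauss d)) ∂(ν.map norm) := by
  have hperp (g : Vel d) : perp 0 g = g := by simp [perp]
  -- Here `perpDir 0 g = g / ‖g‖` is a uniformly random unit vector.
  have h1 : charFun ν ξ = ∫ g, charFun ν (‖ξ‖ • perpDir 0 g) ∂(gauss d) := by
    have : (fun g => charFun ν (‖ξ‖ • perpDir 0 g)) =ᵐ[gauss d] fun _ => charFun ν ξ := by
      filter_upwards [perp_ne_zero_ae hd 0] with g hg
      rw [hperp] at hg
      obtain ⟨J, hJ, -, -⟩ := exists_swap ξ g
      rw [← charFun_map_isometry ν (h J) ξ]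
      congr 1
      rw [perpDir, hperp, smul_comm, ← hJ, map_smul, inv_smul_smul₀ (norm_ne_zero_iff.2 hg)]
    rw [integral_congr_ae this]
    simp
  have h2 : ∀ x : Vel d, ∫ g, Complex.exp ((‖ξ‖ * inner ℝ x (perpDir 0 g) : ℝ) * Complex.I)
      ∂(gauss d) = ∫ g, Complex.exp ((‖x‖ * inner ℝ ξ (perpDir 0 g) : ℝ) * Complex.I)
      ∂(gauss d) := by
    intro x
    obtain ⟨J, hJ1, hJ2, -⟩ := exists_swap x ξ
    conv_lhs => rw [← (measurePreserving_gauss J).integral_comp J.toHomeomorph.measurableEmbedding]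
    congr 1
    ext g
    have h3 : perpDir 0 (J g) = J (perpDir 0 g) := by rw [← perpDir_map, map_zero]
    rw [h3, ← real_inner_smul_left, ← hJ2, J.inner_map_map, real_inner_smul_left]
  have hm : ∀ ξ : Vel d, StronglyMeasurable fun p : ℝ × Vel d =>
      Complex.exp ((p.1 * inner ℝ ξ (perpDir 0 p.2) : ℝ) * Complex.I) := fun ξ =>
    Measurable.stronglyMeasurable (by fun_prop)
  rw [h1, integral_map measurable_norm.aemeasurable
    (StronglyMeasurable.integral_prod_right (hm ξ)).aestronglyMeasurable]
  simp_rw [charFun_apply, inner_smul_right]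
  rw [integral_integral_swap]
  · exact integral_congr_ae (Filter.Eventually.of_forall h2)
  · refine Integrable.of_bound (C := 1) (Measurable.aestronglyMeasurable ?_)
      (Filter.Eventually.of_forall fun p => ?_)
    · unfold Function.uncurry
      fun_prop
    · simp only [Function.uncurry, Complex.norm_exp_ofReal_mul_I, le_refl]

/-- An isotropic finite measure is determined by the law of the norm. -/
theorem ext_of_isotropic (hd : 2 ≤ d) {ν₁ ν₂ : Measure (Vel d)} [IsFiniteMeasure ν₁]
    [IsFiniteMeasure ν₂] (h₁ : ∀ J : Vel d ≃ₗᵢ[ℝ] Vel d, ν₁.map J = ν₁)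
    (h₂ : ∀ J : Vel d ≃ₗᵢ[ℝ] Vel d, ν₂.map J = ν₂) (h : ν₁.map norm = ν₂.map norm) :
    ν₁ = ν₂ := by
  refine Measure.ext_of_charFun (funext fun ξ => ?_)
  rw [charFun_isotropic hd ν₁ h₁, charFun_isotropic hd ν₂ h₂, h]

/-- Tilting a Gaussian vector towards an independent one gives a Gaussian vector. -/
theorem map_tilt_gauss (hd : 2 ≤ d) {a b : ℝ} (hab : a ^ 2 + b ^ 2 = 1) :
    ((gauss d).prod (gauss d)).map (fun p => tilt a b p.1 p.2) = gauss d := by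
  have hm : Measurable fun p : Vel d × Vel d => tilt a b p.1 p.2 := by fun_prop
  refine ext_of_isotropic hd (fun J => ?_) (fun J => (measurePreserving_gauss J).map_eq) ?_
  · have h1 := ((measurePreserving_gauss J).prod (measurePreserving_gauss J)).map_eq
    conv_rhs => rw [← h1]
    have hJ : Measurable J := J.continuous.measurable
    rw [Measure.map_map hJ hm, Measure.map_map hm (by fun_prop)]
    congr 1
    ext1 p
    exact (tilt_map J a b p.1 p.2).symm
  · have h2 : (gauss d).map norm = ((gauss d).prod (gauss d)).map (fun p => ‖p.1‖) := by
      have : (fun p : Vel d × Vel d => ‖p.1‖) = norm ∘ Prod.fst := rfl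
      rw [this, ← Measure.map_map measurable_norm measurable_fst, measurePreserving_fst.map_eq]
    rw [h2, Measure.map_map measurable_norm hm]
    refine Measure.map_congr ?_
    refine (Measure.ae_prod_iff_ae_ae ?_).2 (Filter.Eventually.of_forall fun u => ?_)
    · exact measurableSet_eq_fun (by fun_prop) (by fun_prop)
    · filter_upwards [perp_ne_zero_ae hd u] with g hg
      exact norm_tilt hab hg

/-! ### The weight `|ξ|^(-2s)` -/

instance (s : ℝ) : SFinite (sobolevWeight d s) := by
  unfold sobolevWeight; infer_instance

theorem lintegral_sobolevWeight (s : ℝ) {ψ : Vel d → ℝ≥0∞} (hψ : Measurable ψ) :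
    ∫⁻ ξ, ψ ξ ∂(sobolevWeight d s) = ∫⁻ ξ, ENNReal.ofReal (‖ξ‖ ^ (-2 * s)) * ψ ξ := by
  rw [sobolevWeight, lintegral_withDensity_eq_lintegral_mul _ (by fun_prop) hψ]
  rfl

theorem sobolevWeight_eq_withDensity_gauss (s : ℝ) :
    sobolevWeight d s = (gauss d).withDensity fun ξ =>
      ENNReal.ofReal (Real.exp (Real.pi * ‖ξ‖ ^ 2) * ‖ξ‖ ^ (-2 * s)) := by
  rw [gauss, ← withDensity_mul _ (by fun_prop) (by fun_prop), sobolevWeight]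
  congr 1
  ext1 ξ
  rw [Pi.mul_apply, ← ENNReal.ofReal_mul (Real.exp_pos _).le, ← mul_assoc, ← Real.exp_add]
  simp

/-- Tilting by a fixed angle in a uniformly random direction preserves the radial weights. -/
theorem lintegral_tilt (hd : 2 ≤ d) (s : ℝ) {a b : ℝ} (hab : a ^ 2 + b ^ 2 = 1)
    {ψ : Vel d → ℝ≥0∞} (hψ : Measurable ψ) :
    ∫⁻ p, ψ (tilt a b p.1 p.2) ∂((sobolevWeight d s).prod (gauss d)) =
      ∫⁻ ξ, ψ ξ ∂(sobolevWeight d s) := by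
  set ω : Vel d → ℝ≥0∞ := fun ξ =>
    ENNReal.ofReal (Real.exp (Real.pi * ‖ξ‖ ^ 2) * ‖ξ‖ ^ (-2 * s)) with hω
  have hωm : Measurable ω := by fun_prop
  have hm : Measurable fun p : Vel d × Vel d => tilt a b p.1 p.2 := by fun_prop
  rw [lintegral_prod _ (by fun_prop), sobolevWeight_eq_withDensity_gauss,
    lintegral_withDensity_eq_lintegral_mul _ hωm hψ,
    lintegral_withDensity_eq_lintegral_mul _ hωm
      (Measurable.lintegral_prod_right' (f := fun p : Vel d × Vel d => ψ (tilt a b p.1 p.2))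
      (by fun_prop))]
  conv_rhs => rw [← map_tilt_gauss hd hab, lintegral_map (by fun_prop) hm,
    lintegral_prod _ (by fun_prop)]
  refine lintegral_congr fun u => ?_
  rw [Pi.mul_apply, ← lintegral_const_mul _ (by fun_prop)]
  refine lintegral_congr_ae ?_
  filter_upwards [perp_ne_zero_ae hd u] with g hg
  simp only [Pi.mul_apply, hω, norm_tilt hab hg]

theorem lintegral_comp_smul_sobolevWeight (r : ℝ) {t : ℝ} (ht : 0 < t)
    {ψ : Vel d → ℝ≥0∞} (hψ : Measurable ψ) :
    ∫⁻ ξ, ψ (t • ξ) ∂(sobolevWeight d (d / 2 + r)) =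
      ENNReal.ofReal (t ^ (2 * r)) * ∫⁻ ξ, ψ ξ ∂(sobolevWeight d (d / 2 + r)) := by
  have hm : Measurable fun ξ : Vel d => t • ξ := by fun_prop
  rw [lintegral_sobolevWeight _ (by fun_prop), lintegral_sobolevWeight _ hψ]
  have h1 : ∀ ξ : Vel d, ENNReal.ofReal (‖ξ‖ ^ (-2 * ((d : ℝ) / 2 + r))) * ψ (t • ξ) =
      ENNReal.ofReal (t ^ (2 * ((d : ℝ) / 2 + r))) *
      (ENNReal.ofReal (‖t • ξ‖ ^ (-2 * ((d : ℝ) / 2 + r))) * ψ (t • ξ)) := by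
    intro ξ
    rw [← mul_assoc, ← ENNReal.ofReal_mul (by positivity), norm_smul, Real.norm_of_nonneg ht.le,
      Real.mul_rpow ht.le (norm_nonneg _), ← mul_assoc, ← Real.rpow_add ht]
    congr 3
    ring_nf
    simp
  simp_rw [h1]
  rw [lintegral_const_mul _ (by fun_prop), ← lintegral_map
    (f := fun ξ : Vel d => ENNReal.ofReal (‖ξ‖ ^ (-2 * ((d : ℝ) / 2 + r))) * ψ ξ) (by fun_prop) hm,
    Measure.map_addHaar_smul _ ht.ne', lintegral_smul_measure, smul_eq_mul, ← mul_assoc,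
    ← ENNReal.ofReal_mul (by positivity)]
  congr 2
  rw [finrank_euclideanSpace_fin, abs_of_pos (by positivity), ← Real.rpow_natCast,
    ← Real.rpow_neg ht.le, ← Real.rpow_add ht]
  congr 1
  ring

/-- The square of the norm of `min 2 |ξ|` in `L²(|ξ|^(-d-2r) dξ)`. -/
def minConst (d : ℕ) (r : ℝ) : ℝ≥0∞ :=
  ∫⁻ ξ, ENNReal.ofReal (min 2 ‖ξ‖) ^ 2 ∂(sobolevWeight d (d / 2 + r))

theorem minConst_lt_top (hd : 0 < d) {r : ℝ} (hr₀ : 0 < r) (hr₁ : r < 1) :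
    minConst d r < ∞ := by
  have : Nonempty (Fin d) := ⟨⟨0, hd⟩⟩
  have hint : Integrable (fun ξ : Vel d => ‖ξ‖ ^ (-2 * ((d : ℝ) / 2 + r)) * min 2 ‖ξ‖ ^ 2) := by
    rw [integrable_fun_norm_addHaar volume
      (f := fun y => y ^ (-2 * ((d : ℝ) / 2 + r)) * min 2 y ^ 2), finrank_euclideanSpace_fin]
    have hpow : ∀ y : ℝ, 0 < y → y ^ (d - 1) * y ^ (-2 * ((d : ℝ) / 2 + r)) = y ^ (-1 - 2 * r) := by
      intro y hy
      rw [← Real.rpow_natCast, ← Real.rpow_add hy, Nat.cast_sub hd]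
      congr 1
      push_cast
      ring
    have hmeas : ∀ t : Set ℝ, AEStronglyMeasurable (fun y : ℝ => y ^ (d - 1) •
        (y ^ (-2 * ((d : ℝ) / 2 + r)) * min 2 y ^ 2)) (volume.restrict t) := fun t =>
      Measurable.aestronglyMeasurable (by simp only [smul_eq_mul]; fun_prop)
    rw [← Ioc_union_Ioi_eq_Ioi zero_le_one]
    refine IntegrableOn.union ?_ ?_
    · have h1 : IntegrableOn (fun y : ℝ => y ^ (1 - 2 * r)) (Ioc 0 1) := by
        rw [← intervalIntegrable_iff_integrableOn_Ioc_of_le zero_le_one]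
        exact intervalIntegral.intervalIntegrable_rpow' (by linarith)
      refine Integrable.mono' h1 (hmeas _) ?_
      filter_upwards [ae_restrict_mem measurableSet_Ioc] with y hy
      have hmin : min 2 y ^ 2 ≤ y ^ 2 :=
        pow_le_pow_left₀ (le_min (by norm_num) hy.1.le) (min_le_right _ _) 2
      have := hy.1
      rw [smul_eq_mul, ← mul_assoc, hpow y hy.1, Real.norm_of_nonneg (by positivity)]
      calc y ^ (-1 - 2 * r) * min 2 y ^ 2 ≤ y ^ (-1 - 2 * r) * y ^ 2 := by gcongr
        _ = y ^ (1 - 2 * r) := by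
          rw [← Real.rpow_natCast, ← Real.rpow_add hy.1]
          congr 1
          push_cast
          ring
    · have h1 : IntegrableOn (fun y : ℝ => 4 * y ^ (-1 - 2 * r)) (Ioi 1) :=
        (integrableOn_Ioi_rpow_of_lt (by linarith) one_pos).const_mul 4
      refine Integrable.mono' h1 (hmeas _) ?_
      filter_upwards [ae_restrict_mem measurableSet_Ioi] with y hy
      have hy0 : (0 : ℝ) < y := zero_lt_one.trans hy
      have hmin : min 2 y ^ 2 ≤ 2 ^ 2 :=
        pow_le_pow_left₀ (le_min (by norm_num) hy0.le) (min_le_left _ _) 2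
      rw [smul_eq_mul, ← mul_assoc, hpow y hy0, Real.norm_of_nonneg (by positivity), mul_comm]
      gcongr
      linarith
  rw [minConst, lintegral_sobolevWeight _ (by fun_prop)]
  have h2 := hint.lintegral_lt_top
  refine lt_of_eq_of_lt (lintegral_congr fun ξ => ?_) h2
  rw [ENNReal.ofReal_mul (by positivity), ENNReal.ofReal_pow (by positivity)]

theorem lintegral_min_sq {r : ℝ} (hr : 0 < r) {t : ℝ} (ht : 0 ≤ t) :
    ∫⁻ ξ : Vel d, ENNReal.ofReal (min 2 (t * ‖ξ‖)) ^ 2 ∂(sobolevWeight d (d / 2 + r)) =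
      ENNReal.ofReal (t ^ r) ^ 2 * minConst d r := by
  rcases ht.eq_or_lt with rfl | ht
  · simp [Real.zero_rpow hr.ne']
  · have h := lintegral_comp_smul_sobolevWeight (d := d) r ht
      (ψ := fun ξ => ENNReal.ofReal (min 2 ‖ξ‖) ^ 2) (by fun_prop)
    rw [← ENNReal.ofReal_pow (by positivity), ← Real.rpow_mul_natCast ht.le]
    simp only [norm_smul, Real.norm_of_nonneg ht.le] at h
    rw [h, minConst, mul_comm r]
    norm_num

/-! ### Elementary inequalities -/

theorem norm_exp_sub_one_le (x : ℝ) : ‖1 - Complex.exp (-Complex.I * x)‖ ≤ min 2 |x| := by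
  refine le_min ?_ ?_
  · refine (norm_sub_le _ _).trans ?_
    rw [norm_one, neg_mul, mul_comm, ← neg_mul, ← Complex.ofReal_neg, Complex.norm_exp_ofReal_mul_I]
    norm_num
  · have h := Real.norm_exp_I_mul_ofReal_sub_one_le (x := -x)
    rw [norm_neg, Real.norm_eq_abs] at h
    rw [norm_sub_rev, neg_mul, ← mul_neg, ← Complex.ofReal_neg]
    exact h

/-- Since `c ^ r ≥ c ^ 2 = 1 - s ^ 2`, the quantity `s ^ r + c ^ r - 1` is at least `s ^ r - s ^ 2`, and
`s ^ 2 ≤ 1 / 2` makes `s ^ 2` a fixed fraction of `s ^ r`. -/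
theorem kappaDensity_bound_of_le {r s c : ℝ} (hr₀ : 0 < r) (hr₁ : r < 1) (hs : 0 ≤ s)
    (hsc : s ≤ c) (h : s ^ 2 + c ^ 2 = 1) :
    s ^ r ≤ (1 - (2⁻¹ : ℝ) ^ ((2 - r) / 2))⁻¹ * (s ^ r + c ^ r - 1) := by
  have h2 : (2⁻¹ : ℝ) ^ ((2 - r) / 2) < 1 :=
    Real.rpow_lt_one (by norm_num) (by norm_num) (by linarith)
  have hc0 : 0 < c := by nlinarith
  have hc1 : c ≤ 1 := by nlinarith
  have h3 : c ^ 2 ≤ c ^ r := by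
    rw [← Real.rpow_natCast]
    exact Real.rpow_le_rpow_of_exponent_ge hc0 hc1 (by push_cast; linarith)
  rw [le_inv_mul_iff₀ (by linarith)]
  have h4 : s ^ 2 ≤ (2⁻¹ : ℝ) ^ ((2 - r) / 2) * s ^ r := by
    have h5 : s ^ 2 = (s ^ 2) ^ ((2 - r) / 2) * s ^ r := by
      rcases hs.eq_or_lt with rfl | hs
      · simp [Real.zero_rpow hr₀.ne']
      · rw [← Real.rpow_natCast, ← Real.rpow_mul hs.le, ← Real.rpow_add hs]
        congr 1
        push_cast
        ring
    have h6 : s ^ 2 ≤ 2⁻¹ := by nlinarith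
    have h7 : 0 ≤ (2 - r) / 2 := by linarith
    rw [h5]
    gcongr
  nlinarith

/-- The constant comparing `min (sin (θ/2)) (cos (θ/2)) ^ r` to the contractivity density. -/
def angleConst (r : ℝ) : ℝ := (1 - (2⁻¹ : ℝ) ^ ((2 - r) / 2))⁻¹

theorem angleConst_pos {r : ℝ} (hr₁ : r < 1) : 0 < angleConst r := by
  have h2 : (2⁻¹ : ℝ) ^ ((2 - r) / 2) < 1 :=
    Real.rpow_lt_one (by norm_num) (by norm_num) (by linarith)
  exact inv_pos.2 (by linarith)

theorem kappaDensity_bound {r θ : ℝ} (hr₀ : 0 < r) (hr₁ : r < 1) (hθ : θ ∈ Icc 0 Real.pi) :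
    min (Real.sin (θ / 2)) (Real.cos (θ / 2)) ^ r ≤ angleConst r * -kappaDensity r θ := by
  have hs : 0 ≤ Real.sin (θ / 2) :=
    Real.sin_nonneg_of_nonneg_of_le_pi (by linarith [hθ.1]) (by linarith [hθ.1, hθ.2])
  have hc : 0 ≤ Real.cos (θ / 2) :=
    Real.cos_nonneg_of_neg_pi_div_two_le_of_le (by linarith [hθ.1, Real.pi_pos])
      (by linarith [hθ.2])
  have h := Real.sin_sq_add_cos_sq (θ / 2)
  rw [kappaDensity, angleConst]
  rcases le_total (Real.sin (θ / 2)) (Real.cos (θ / 2)) with h1 | h1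
  · rw [min_eq_left h1]
    convert kappaDensity_bound_of_le hr₀ hr₁ hs h1 h using 2
    ring
  · rw [min_eq_right h1]
    convert kappaDensity_bound_of_le hr₀ hr₁ hc h1 (by linarith) using 2
    ring

theorem kappaDensity_nonpos {r θ : ℝ} (hr₀ : 0 < r) (hr₁ : r < 1) (hθ : θ ∈ Icc 0 Real.pi) :
    kappaDensity r θ ≤ 0 := by
  have hs : 0 ≤ Real.sin (θ / 2) :=
    Real.sin_nonneg_of_nonneg_of_le_pi (by linarith [hθ.1]) (by linarith [hθ.1, hθ.2])
  have hc : 0 ≤ Real.cos (θ / 2) :=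
    Real.cos_nonneg_of_neg_pi_div_two_le_of_le (by linarith [hθ.1, Real.pi_pos])
      (by linarith [hθ.2])
  have h := kappaDensity_bound hr₀ hr₁ hθ
  have h1 : 0 ≤ min (Real.sin (θ / 2)) (Real.cos (θ / 2)) ^ r :=
    Real.rpow_nonneg (le_min hs hc) _
  have := angleConst_pos hr₁
  nlinarith

theorem kappaDensity_neg {r θ : ℝ} (hr₀ : 0 < r) (hr₁ : r < 1) (hθ : θ ∈ Ioo 0 Real.pi) :
    kappaDensity r θ < 0 := by
  have hs : 0 < Real.sin (θ / 2) :=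
    Real.sin_pos_of_pos_of_lt_pi (by linarith [hθ.1]) (by linarith [hθ.1, hθ.2])
  have hc : 0 < Real.cos (θ / 2) :=
    Real.cos_pos_of_mem_Ioo ⟨by linarith [hθ.1, Real.pi_pos], by linarith [hθ.2]⟩
  have h := kappaDensity_bound hr₀ hr₁ (Ioo_subset_Icc_self hθ)
  have h1 : 0 < min (Real.sin (θ / 2)) (Real.cos (θ / 2)) ^ r :=
    Real.rpow_pos_of_pos (lt_min hs hc) _
  have := angleConst_pos hr₁
  nlinarith

theorem kappaDensity_zero {r : ℝ} (hr₀ : 0 < r) : kappaDensity r 0 = 0 := by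
  simp [kappaDensity, Real.zero_rpow hr₀.ne']

theorem kappaDensity_pi {r : ℝ} (hr₀ : 0 < r) : kappaDensity r Real.pi = 0 := by
  simp [kappaDensity, Real.zero_rpow hr₀.ne']

@[fun_prop]
theorem measurable_kappaDensity (r : ℝ) : Measurable (kappaDensity r) := by
  unfold kappaDensity; fun_prop

/-! ### Plane waves and Fourier transforms of measures -/

/-- The plane wave `exp (-i ξ·x)`. -/
def wave (ξ x : Vel d) : ℂ := Complex.exp (-Complex.I * (inner ℝ ξ x : ℝ))

/-- The normalizing constant of the unitary Fourier transform. -/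
def fourierConst (d : ℕ) : ℝ := (2 * Real.pi) ^ (-(d : ℝ) / 2)

theorem fourierConst_pos : 0 < fourierConst d := by
  unfold fourierConst; positivity

theorem fourierMeas_eq (μ : Measure (Vel d)) (ξ : Vel d) :
    fourierMeas μ ξ = (fourierConst d : ℂ) * ∫ x, wave ξ x ∂μ := rfl

theorem norm_wave (ξ x : Vel d) : ‖wave ξ x‖ = 1 := by
  rw [wave, neg_mul, mul_comm, ← neg_mul, ← Complex.ofReal_neg, Complex.norm_exp_ofReal_mul_I]

theorem wave_comm (ξ x : Vel d) : wave ξ x = wave x ξ := by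
  rw [wave, wave, real_inner_comm]

theorem wave_add (ξ x y : Vel d) : wave ξ (x + y) = wave ξ x * wave ξ y := by
  rw [wave, wave, wave, ← Complex.exp_add, inner_add_right]
  push_cast
  ring_nf

@[simp]
theorem wave_zero (ξ : Vel d) : wave ξ 0 = 1 := by simp [wave]

@[fun_prop]
theorem continuous_wave {α : Type*} [TopologicalSpace α] {f g : α → Vel d} (hf : Continuous f)
    (hg : Continuous g) : Continuous fun a => wave (f a) (g a) := by
  unfold wave; fun_prop

@[fun_prop]
theorem measurable_wave {α : Type*} [MeasurableSpace α] {f g : α → Vel d} (hf : Measurable f)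
    (hg : Measurable g) : Measurable fun a => wave (f a) (g a) := by
  unfold wave; fun_prop

theorem norm_one_sub_wave_le (ξ x : Vel d) : ‖1 - wave ξ x‖ ≤ min 2 (‖x‖ * ‖ξ‖) := by
  refine (norm_exp_sub_one_le _).trans (min_le_min_left _ ?_)
  rw [mul_comm]
  exact abs_real_inner_le_norm ξ x

theorem integrable_wave (μ : Measure (Vel d)) [IsFiniteMeasure μ] (ξ : Vel d) :
    Integrable (wave ξ) μ :=
  Integrable.of_bound (by fun_prop) 1 (Filter.Eventually.of_forall fun x => (norm_wave ξ x).le)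

theorem continuous_fourierMeas (μ : Measure (Vel d)) [IsFiniteMeasure μ] :
    Continuous (fourierMeas μ) := by
  refine continuous_const.mul ?_
  refine continuous_of_dominated (F := wave) (bound := fun _ => 1) (fun ξ => by fun_prop)
    (fun ξ => Filter.Eventually.of_forall fun x => (norm_wave ξ x).le) (integrable_const 1)
    (Filter.Eventually.of_forall fun x => by fun_prop)

theorem fourierMeas_dirac_add (x y ξ : Vel d) :
    fourierMeas (Measure.dirac x + Measure.dirac y) ξ =
      fourierConst d * (wave ξ x + wave ξ y) := by
  rw [fourierMeas_eq, integral_add_measure (integrable_wave _ ξ) (integrable_wave _ ξ),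
    integral_dirac, integral_dirac]

theorem fourierMeas_dirac (x ξ : Vel d) :
    fourierMeas (Measure.dirac x) ξ = fourierConst d * wave ξ x := by
  rw [fourierMeas_eq, integral_dirac]

/-- The Cauchy–Schwarz inequality for the lower integral. -/
theorem lintegral_mul_sq_le {α : Type*} [MeasurableSpace α] (μ : Measure α) {f g : α → ℝ≥0∞}
    (hf : AEMeasurable f μ) (hg : AEMeasurable g μ) :
    (∫⁻ a, f a * g a ∂μ) ^ 2 ≤ (∫⁻ a, f a ^ 2 ∂μ) * ∫⁻ a, g a ^ 2 ∂μ := by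
  have h := ENNReal.lintegral_mul_le_Lp_mul_Lq μ Real.HolderConjugate.two_two hf hg
  have h2 : ∀ x : ℝ≥0∞, (x ^ (1 / 2 : ℝ)) ^ 2 = x := fun x => by
    rw [← ENNReal.rpow_natCast, ← ENNReal.rpow_mul]
    norm_num
  calc (∫⁻ a, f a * g a ∂μ) ^ 2
      ≤ ((∫⁻ a, f a ^ (2 : ℝ) ∂μ) ^ (1 / 2 : ℝ) * (∫⁻ a, g a ^ (2 : ℝ) ∂μ) ^ (1 / 2 : ℝ)) ^ 2 := by
        gcongr
        exact h
    _ = _ := by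
      rw [mul_pow, h2, h2]
      simp

/-- Cauchy–Schwarz with two bounds on the `L²` norms. -/
theorem lintegral_mul_le_of_sq_le {α : Type*} [MeasurableSpace α] (μ : Measure α)
    {f g : α → ℝ≥0∞} (hf : AEMeasurable f μ) (hg : AEMeasurable g μ) {A B : ℝ≥0∞}
    (hA : ∫⁻ a, f a ^ 2 ∂μ ≤ A ^ 2) (hB : ∫⁻ a, g a ^ 2 ∂μ ≤ B ^ 2) :
    ∫⁻ a, f a * g a ∂μ ≤ A * B := by
  have h := (lintegral_mul_sq_le μ hf hg).trans (mul_le_mul' hA hB)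
  rw [← mul_pow] at h
  exact (ENNReal.pow_le_pow_left_iff two_ne_zero).1 h

theorem eLpNorm_two_sq {α : Type*} [MeasurableSpace α] (μ : Measure α) (f : α → ℂ) :
    eLpNorm f 2 μ ^ 2 = ∫⁻ a, ‖f a‖ₑ ^ 2 ∂μ := by
  have := eLpNorm_nnreal_pow_eq_lintegral (μ := μ) (f := f) (p := 2) two_ne_zero
  simpa using this

theorem enorm_sq_eq_lintegral {s : ℝ} (h : Hdot d s) :
    ‖h‖ₑ ^ 2 = ∫⁻ ξ, ‖h ξ‖ₑ ^ 2 ∂(sobolevWeight d s) := by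
  rw [Lp.enorm_def, eLpNorm_two_sq]

/-- Minkowski's inequality for `x ↦ min 2 (|x| |ξ|)` in `L²(|ξ|^(-d-2r) dξ)`. -/
theorem lintegral_lintegral_min_sq_le {r : ℝ} (hr : 0 < r) (μ : Measure (Vel d))
    [SFinite μ] :
    ∫⁻ ξ, (∫⁻ x, ENNReal.ofReal (min 2 (‖x‖ * ‖ξ‖)) ∂μ) ^ 2 ∂(sobolevWeight d (d / 2 + r)) ≤
      (∫⁻ x, ENNReal.ofReal (‖x‖ ^ r) ∂μ) ^ 2 * minConst d r := by
  -- The Cauchy–Schwarz inequality with the weight `‖x‖ ^ (r / 2)` makes both factors explicit.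
  set f : Vel d → ℝ≥0∞ := fun x => ENNReal.ofReal (‖x‖ ^ (r / 2)) with hf
  set g : Vel d → Vel d → ℝ≥0∞ := fun ξ x =>
    ENNReal.ofReal (min 2 (‖x‖ * ‖ξ‖) * (‖x‖ ^ (r / 2))⁻¹) with hg
  have hfg : ∀ ξ x : Vel d, ENNReal.ofReal (min 2 (‖x‖ * ‖ξ‖)) = f x * g ξ x := by
    intro ξ x
    rw [hf, hg]
    dsimp only
    rw [← ENNReal.ofReal_mul (by positivity)]
    by_cases hx : x = 0
    · simp [hx]
    · have : ‖x‖ ^ (r / 2) ≠ 0 := (Real.rpow_pos_of_pos (norm_pos_iff.2 hx) _).ne'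
      field_simp
  have hf2 : ∀ x : Vel d, f x ^ 2 = ENNReal.ofReal (‖x‖ ^ r) := by
    intro x
    rw [hf]
    dsimp only
    rw [← ENNReal.ofReal_pow (by positivity), ← Real.rpow_mul_natCast (norm_nonneg _)]
    norm_num
  calc ∫⁻ ξ, (∫⁻ x, ENNReal.ofReal (min 2 (‖x‖ * ‖ξ‖)) ∂μ) ^ 2 ∂(sobolevWeight d (d / 2 + r))
      ≤ ∫⁻ ξ, (∫⁻ x, ENNReal.ofReal (‖x‖ ^ r) ∂μ) * (∫⁻ x, g ξ x ^ 2 ∂μ)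
          ∂(sobolevWeight d (d / 2 + r)) := by
        refine lintegral_mono fun ξ => ?_
        simp_rw [hfg, ← hf2]
        exact lintegral_mul_sq_le μ (by fun_prop) (by fun_prop)
    _ = (∫⁻ x, ENNReal.ofReal (‖x‖ ^ r) ∂μ) * ∫⁻ x, (∫⁻ ξ, g ξ x ^ 2
          ∂(sobolevWeight d (d / 2 + r))) ∂μ := by
        rw [lintegral_const_mul, lintegral_lintegral_swap]
        · exact Measurable.aemeasurable (by unfold Function.uncurry; fun_prop)
        · exact Measurable.lintegral_prod_right (by unfold Function.uncurry; fun_prop)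
    _ = (∫⁻ x, ENNReal.ofReal (‖x‖ ^ r) ∂μ) * ∫⁻ x, ENNReal.ofReal (‖x‖ ^ r) * minConst d r
          ∂μ := by
        congr 2
        ext1 x
        have h1 : ∀ ξ : Vel d, g ξ x ^ 2 = ENNReal.ofReal ((‖x‖ ^ (r / 2))⁻¹) ^ 2 *
            ENNReal.ofReal (min 2 (‖x‖ * ‖ξ‖)) ^ 2 := by
          intro ξ
          rw [hg, ← mul_pow, ← ENNReal.ofReal_mul (by positivity), mul_comm]
        simp_rw [h1]
        rw [lintegral_const_mul _ (by fun_prop), lintegral_min_sq hr (norm_nonneg x), ← mul_assoc,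
          ← mul_pow, ← ENNReal.ofReal_mul (by positivity), ← ENNReal.ofReal_pow (by positivity)]
        congr 2
        by_cases hx : x = 0
        · simp [hx, Real.zero_rpow hr.ne', Real.zero_rpow (half_pos hr).ne']
        · have h2 : 0 < ‖x‖ := norm_pos_iff.2 hx
          rw [mul_pow, inv_pow, ← Real.rpow_mul_natCast h2.le, ← Real.rpow_mul_natCast h2.le,
            ← Real.rpow_neg h2.le, ← Real.rpow_add h2]
          congr 1
          push_cast
          ring
    _ = _ := by
        rw [lintegral_mul_const _ (by fun_prop), ← mul_assoc, sq]

/-- Two finite measures of equal mass having a moment of order `r` differ by an element of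
`Ḣ^{-s}`. -/
theorem memLp_fourierMeas_sub (hd : 0 < d) {r : ℝ} (hr₀ : 0 < r) (hr₁ : r < 1)
    (μ ν : Measure (Vel d)) [IsFiniteMeasure μ] [IsFiniteMeasure ν] (h : μ univ = ν univ)
    (hμ : Integrable (fun x => ‖x‖ ^ r) μ) (hν : Integrable (fun x => ‖x‖ ^ r) ν) :
    MemLp (fun ξ => fourierMeas μ ξ - fourierMeas ν ξ) 2 (sobolevWeight d (d / 2 + r)) := by
  refine ⟨((continuous_fourierMeas μ).sub (continuous_fourierMeas ν)).aestronglyMeasurable, ?_⟩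
  have hlt : (∫⁻ x, ENNReal.ofReal (‖x‖ ^ r) ∂(μ + ν)) < ∞ := by
    rw [lintegral_add_measure]
    exact ENNReal.add_lt_top.2 ⟨hμ.lintegral_lt_top, hν.lintegral_lt_top⟩
  have h1 : ∀ ξ : Vel d, ‖fourierMeas μ ξ - fourierMeas ν ξ‖ₑ ≤ ENNReal.ofReal (fourierConst d) *
      ∫⁻ x, ENNReal.ofReal (min 2 (‖x‖ * ‖ξ‖)) ∂(μ + ν) := by
    intro ξ
    have h2 : ∀ (ρ : Measure (Vel d)) [IsFiniteMeasure ρ], ‖∫ x, (1 - wave ξ x) ∂ρ‖ₑ ≤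
        ∫⁻ x, ENNReal.ofReal (min 2 (‖x‖ * ‖ξ‖)) ∂ρ := fun ρ _ => by
      refine (enorm_integral_le_lintegral_enorm _).trans (lintegral_mono fun x => ?_)
      rw [← ofReal_norm]
      exact ENNReal.ofReal_le_ofReal (norm_one_sub_wave_le ξ x)
    have h3 : fourierMeas μ ξ - fourierMeas ν ξ = fourierConst d *
        (∫ x, (1 - wave ξ x) ∂ν - ∫ x, (1 - wave ξ x) ∂μ) := by
      rw [fourierMeas_eq, fourierMeas_eq, integral_sub (integrable_const _) (integrable_wave _ _),
        integral_sub (integrable_const _) (integrable_wave _ _), integral_const, integral_const,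
        measureReal_def, measureReal_def, h]
      ring
    rw [h3, enorm_mul, lintegral_add_measure, add_comm (lintegral μ _)]
    have h4 : ‖(fourierConst d : ℂ)‖ₑ = ENNReal.ofReal (fourierConst d) := by
      rw [← ofReal_norm, Complex.norm_of_nonneg fourierConst_pos.le]
    rw [h4]
    gcongr
    exact enorm_sub_le.trans (add_le_add (h2 ν) (h2 μ))
  have h5 : eLpNorm (fun ξ => fourierMeas μ ξ - fourierMeas ν ξ) 2
      (sobolevWeight d (d / 2 + r)) ^ 2 < ∞ := by
    rw [eLpNorm_two_sq]
    calc _ ≤ ∫⁻ ξ, ENNReal.ofReal (fourierConst d) ^ 2 *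
          (∫⁻ x, ENNReal.ofReal (min 2 (‖x‖ * ‖ξ‖)) ∂(μ + ν)) ^ 2
            ∂(sobolevWeight d (d / 2 + r)) := by
          refine lintegral_mono fun ξ => ?_
          rw [← mul_pow]
          gcongr
          exact h1 ξ
      _ ≤ ENNReal.ofReal (fourierConst d) ^ 2 *
          ((∫⁻ x, ENNReal.ofReal (‖x‖ ^ r) ∂(μ + ν)) ^ 2 * minConst d r) := by
          rw [lintegral_const_mul' _ _ (by finiteness)]
          gcongr
          exact lintegral_lintegral_min_sq_le hr₀ (μ + ν)
      _ < ∞ := by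
          have := minConst_lt_top hd hr₀ hr₁
          finiteness
  exact (ENNReal.pow_lt_top_iff.1 h5).resolve_right two_ne_zero

theorem ofDiff_coeFn {s : ℝ} {μ ν : Measure (Vel d)}
    (h : MemLp (fun ξ => fourierMeas μ ξ - fourierMeas ν ξ) 2 (sobolevWeight d s)) :
    ofDiff s μ ν =ᵐ[sobolevWeight d s] fun ξ => fourierMeas μ ξ - fourierMeas ν ξ := by
  rw [ofDiff, dif_pos h]
  exact h.coeFn_toLp

/-- The norm of `min 2 |ξ|` in `L²(|ξ|^(-d-2r) dξ)`. -/
def minNorm (d : ℕ) (r : ℝ) : ℝ := √(minConst d r).toReal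

theorem minNorm_nonneg (r : ℝ) : 0 ≤ minNorm d r := Real.sqrt_nonneg _

theorem lintegral_sq_le_of_le_min (hd : 0 < d) {r : ℝ} (hr₀ : 0 < r) (hr₁ : r < 1)
    {f : Vel d → ℂ} {K t : ℝ} (hK : 0 ≤ K) (ht : 0 ≤ t)
    (h : ∀ᵐ ξ ∂(sobolevWeight d (d / 2 + r)), ‖f ξ‖ ≤ K * min 2 (t * ‖ξ‖)) :
    ∫⁻ ξ, ‖f ξ‖ₑ ^ 2 ∂(sobolevWeight d (d / 2 + r)) ≤
      ENNReal.ofReal (K * minNorm d r * t ^ r) ^ 2 := by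
  have hlt := minConst_lt_top hd hr₀ hr₁
  calc _ ≤ ∫⁻ ξ : Vel d, ENNReal.ofReal K ^ 2 * ENNReal.ofReal (min 2 (t * ‖ξ‖)) ^ 2
        ∂(sobolevWeight d (d / 2 + r)) := by
        refine lintegral_mono_ae (h.mono fun ξ hξ => ?_)
        rw [← mul_pow, ← ENNReal.ofReal_mul hK, ← ofReal_norm]
        gcongr
    _ = _ := by
        have := minNorm_nonneg (d := d) r
        rw [lintegral_const_mul _ (by fun_prop), lintegral_min_sq hr₀ ht,
          ENNReal.ofReal_mul (by positivity), ENNReal.ofReal_mul hK, mul_pow, mul_pow,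
          ← ENNReal.ofReal_pow this, minNorm, Real.sq_sqrt ENNReal.toReal_nonneg,
          ENNReal.ofReal_toReal hlt.ne]
        ring

theorem norm_le_of_ae_le_min (hd : 0 < d) {r : ℝ} (hr₀ : 0 < r) (hr₁ : r < 1)
    {f : Hdot d (d / 2 + r)} {K t : ℝ} (hK : 0 ≤ K) (ht : 0 ≤ t)
    (h : ∀ᵐ ξ ∂(sobolevWeight d (d / 2 + r)), ‖f ξ‖ ≤ K * min 2 (t * ‖ξ‖)) :
    ‖f‖ ≤ K * minNorm d r * t ^ r := by
  have h1 := lintegral_sq_le_of_le_min hd hr₀ hr₁ hK ht h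
  rw [← enorm_sq_eq_lintegral, ENNReal.pow_le_pow_left_iff two_ne_zero, ← ofReal_norm] at h1
  have := minNorm_nonneg (d := d) r
  exact (ENNReal.ofReal_le_ofReal_iff (by positivity)).1 h1

/-! ### Integrals with values in the Sobolev space -/

section BochnerIntegral

variable {X : Type*} [MeasurableSpace X] {s : ℝ}

/-- Fubini integrability of a scalar product, under a bound of the `L²` norms. -/
theorem integrable_inner_of_lintegral_le (ρ : Measure X) [SFinite ρ] (h : Hdot d s)
    {f : X × Vel d → ℂ} (hf : Measurable f) {B : X → ℝ≥0∞} (hB : ∫⁻ x, B x ∂ρ < ∞)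
    (hfB : ∀ᵐ x ∂ρ, ∫⁻ ξ, ‖f (x, ξ)‖ₑ ^ 2 ∂(sobolevWeight d s) ≤ B x ^ 2) :
    Integrable (fun p : X × Vel d => inner ℂ (h p.2) (f p)) (ρ.prod (sobolevWeight d s)) := by
  have hh : Measurable h := (Lp.stronglyMeasurable h).measurable
  have hm : Measurable fun p : X × Vel d => inner ℂ (h p.2) (f p) := by fun_prop
  refine ⟨hm.aestronglyMeasurable, ?_⟩
  rw [hasFiniteIntegral_iff_enorm, lintegral_prod _ (by fun_prop)]
  calc _ ≤ ∫⁻ x, ‖h‖ₑ * B x ∂ρ := by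
        refine lintegral_mono_ae (hfB.mono fun x hx => ?_)
        calc _ ≤ ∫⁻ ξ, ‖h ξ‖ₑ * ‖f (x, ξ)‖ₑ ∂(sobolevWeight d s) :=
              lintegral_mono fun ξ => by
                simp only [← ofReal_norm]
                rw [← ENNReal.ofReal_mul (norm_nonneg _)]
                exact ENNReal.ofReal_le_ofReal (norm_inner_le_norm _ _)
          _ ≤ _ := lintegral_mul_le_of_sq_le _ (by fun_prop) (by fun_prop)
              (enorm_sq_eq_lintegral h).ge hx
    _ < ∞ := by
        rw [lintegral_const_mul' _ _ enorm_ne_top]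
        exact ENNReal.mul_lt_top enorm_lt_top hB

/-- The scalar products of a Bochner integral with values in `Ḣ^{-s}`, when the
Fourier transform of the integrand is given by a measurable function. -/
theorem inner_integral_eq (ρ : Measure X) [SFinite ρ] (h : Hdot d s)
    {F : X → Hdot d s} (hF : Integrable F ρ) {f : X × Vel d → ℂ} (hf : Measurable f)
    (hFf : ∀ᵐ x ∂ρ, F x =ᵐ[sobolevWeight d s] fun ξ => f (x, ξ)) :
    Integrable (fun p : X × Vel d => inner ℂ (h p.2) (f p)) (ρ.prod (sobolevWeight d s)) ∧
    inner ℂ h (∫ x, F x ∂ρ) = ∫ p : X × Vel d, inner ℂ (h p.2) (f p)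
      ∂(ρ.prod (sobolevWeight d s)) := by
  have h1 : Integrable (fun p : X × Vel d => inner ℂ (h p.2) (f p))
      (ρ.prod (sobolevWeight d s)) := by
    refine integrable_inner_of_lintegral_le ρ h hf (B := fun x => ‖F x‖ₑ) hF.2
      (hFf.mono fun x hx => ?_)
    rw [enorm_sq_eq_lintegral]
    exact (lintegral_congr_ae (hx.mono fun ξ hξ => by rw [hξ])).ge
  refine ⟨h1, ?_⟩
  rw [← integral_inner hF, integral_prod _ h1]
  refine integral_congr_ae (hFf.mono fun x hx => ?_)
  dsimp only
  rw [L2.inner_def]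
  exact integral_congr_ae (hx.mono fun ξ hξ => by dsimp only; rw [hξ])

end BochnerIntegral

/-! ### Differences of point masses -/

theorem memLp_dirac (hd : 0 < d) {r : ℝ} (hr₀ : 0 < r) (hr₁ : r < 1) (x y : Vel d) :
    MemLp (fun ξ => fourierMeas (Measure.dirac x) ξ - fourierMeas (Measure.dirac y) ξ) 2
      (sobolevWeight d (d / 2 + r)) :=
  memLp_fourierMeas_sub hd hr₀ hr₁ _ _ (by simp) (integrable_dirac (by simp))
    (integrable_dirac (by simp))

theorem memLp_increment (hd : 0 < d) {r : ℝ} (hr₀ : 0 < r) (hr₁ : r < 1) (p q : Vel d × Vel d) :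
    MemLp (fun ξ => fourierMeas (Measure.dirac q.1 + Measure.dirac q.2) ξ -
      fourierMeas (Measure.dirac p.1 + Measure.dirac p.2) ξ) 2 (sobolevWeight d (d / 2 + r)) :=
  memLp_fourierMeas_sub hd hr₀ hr₁ _ _ (by simp)
    ((integrable_dirac (by simp)).add_measure (integrable_dirac (by simp)))
    ((integrable_dirac (by simp)).add_measure (integrable_dirac (by simp)))

theorem pointDiff_coeFn (hd : 0 < d) {r : ℝ} (hr₀ : 0 < r) (hr₁ : r < 1) (x y : Vel d) :
    ofDiff (d / 2 + r) (Measure.dirac x) (Measure.dirac y) =ᵐ[sobolevWeight d (d / 2 + r)]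
      fun ξ => fourierConst d * (wave ξ x - wave ξ y) := by
  filter_upwards [ofDiff_coeFn (memLp_dirac hd hr₀ hr₁ x y)] with ξ h
  rw [h, fourierMeas_dirac, fourierMeas_dirac, mul_sub]

theorem increment_coeFn (hd : 0 < d) {r : ℝ} (hr₀ : 0 < r) (hr₁ : r < 1) (p q : Vel d × Vel d) :
    CollisionModel.increment (d / 2 + r) p q =ᵐ[sobolevWeight d (d / 2 + r)]
      fun ξ => fourierConst d * (wave ξ q.1 + wave ξ q.2 - wave ξ p.1 - wave ξ p.2) := by
  filter_upwards [ofDiff_coeFn (memLp_increment hd hr₀ hr₁ p q)] with ξ h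
  rw [CollisionModel.increment, h, fourierMeas_dirac_add, fourierMeas_dirac_add]
  ring

theorem norm_pointDiff_le (hd : 0 < d) {r : ℝ} (hr₀ : 0 < r) (hr₁ : r < 1) (x y : Vel d) :
    ‖ofDiff (d / 2 + r) (Measure.dirac x) (Measure.dirac y)‖ ≤
      fourierConst d * minNorm d r * ‖y - x‖ ^ r := by
  refine norm_le_of_ae_le_min hd hr₀ hr₁ fourierConst_pos.le (norm_nonneg _) ?_
  filter_upwards [pointDiff_coeFn hd hr₀ hr₁ x y] with ξ h
  have h1 : wave ξ x - wave ξ y = wave ξ x * (1 - wave ξ (y - x)) := by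
    rw [mul_sub, mul_one, ← wave_add, add_sub_cancel]
  rw [h, h1, norm_mul, norm_mul, norm_wave, one_mul, Complex.norm_of_nonneg fourierConst_pos.le]
  gcongr
  · exact fourierConst_pos.le
  · exact norm_one_sub_wave_le ξ (y - x)

/-- The map `x ↦ δ_x - δ_0`. -/
def pointDiff (r : ℝ) (x : Vel d) : Hdot d (d / 2 + r) :=
  ofDiff (d / 2 + r) (Measure.dirac x) (Measure.dirac 0)

theorem continuous_pointDiff (hd : 0 < d) {r : ℝ} (hr₀ : 0 < r) (hr₁ : r < 1) :
    Continuous (pointDiff r : Vel d → Hdot d (d / 2 + r)) := by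
  rw [continuous_iff_continuousAt]
  intro x
  have h1 : ∀ y : Vel d, pointDiff r y - pointDiff r x =
      ofDiff (d / 2 + r) (Measure.dirac y) (Measure.dirac x) := by
    intro y
    ext1
    filter_upwards [pointDiff_coeFn hd hr₀ hr₁ y x, pointDiff_coeFn hd hr₀ hr₁ y 0,
      pointDiff_coeFn hd hr₀ hr₁ x 0, Lp.coeFn_sub (pointDiff r y) (pointDiff r x)]
      with ξ h1 h2 h3 h4
    rw [h4, Pi.sub_apply, pointDiff, pointDiff, h1, h2, h3]
    ring
  rw [ContinuousAt, tendsto_iff_norm_sub_tendsto_zero]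
  have h2 : Continuous fun y : Vel d => fourierConst d * minNorm d r * ‖x - y‖ ^ r :=
    continuous_const.mul ((by fun_prop : Continuous fun y : Vel d => ‖x - y‖).rpow_const
      fun _ => Or.inr hr₀.le)
  have h3 := h2.tendsto x
  simp only [sub_self, norm_zero, Real.zero_rpow hr₀.ne', mul_zero] at h3
  refine squeeze_zero (fun _ => norm_nonneg _) (fun y => ?_) h3
  rw [h1]
  exact norm_pointDiff_le hd hr₀ hr₁ y x

theorem increment_eq (hd : 0 < d) {r : ℝ} (hr₀ : 0 < r) (hr₁ : r < 1) (p q : Vel d × Vel d) :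
    CollisionModel.increment (d / 2 + r) p q =
      pointDiff r q.1 + pointDiff r q.2 - pointDiff r p.1 - pointDiff r p.2 := by
  ext1
  filter_upwards [increment_coeFn hd hr₀ hr₁ p q, pointDiff_coeFn hd hr₀ hr₁ q.1 0,
    pointDiff_coeFn hd hr₀ hr₁ q.2 0, pointDiff_coeFn hd hr₀ hr₁ p.1 0,
    pointDiff_coeFn hd hr₀ hr₁ p.2 0, Lp.coeFn_add (pointDiff r q.1) (pointDiff r q.2),
    Lp.coeFn_sub (pointDiff r q.1 + pointDiff r q.2) (pointDiff r p.1),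
    Lp.coeFn_sub (pointDiff r q.1 + pointDiff r q.2 - pointDiff r p.1) (pointDiff r p.2)]
    with ξ h1 h2 h3 h4 h5 h6 h7 h8
  rw [h8, Pi.sub_apply, h7, Pi.sub_apply, h6, Pi.add_apply, h1]
  simp only [pointDiff, h2, h3, h4, h5]
  ring

theorem continuous_increment (hd : 0 < d) {r : ℝ} (hr₀ : 0 < r) (hr₁ : r < 1) :
    Continuous fun z : (Vel d × Vel d) × (Vel d × Vel d) =>
      CollisionModel.increment (d / 2 + r) z.1 z.2 := by
  have h := continuous_pointDiff hd hr₀ hr₁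
  simp_rw [increment_eq hd hr₀ hr₁]
  fun_prop

/-! ### Estimates of a collision -/

/-- The factored form `(1 - e_x)(1 - e_y)` of `1 + e_{x+y} - e_x - e_y`, where `e_x = wave ξ x`. -/
def pairWave (ξ x y : Vel d) : ℂ := (1 - wave ξ x) * (1 - wave ξ y)

@[fun_prop]
theorem measurable_pairWave {α : Type*} [MeasurableSpace α] {f g h : α → Vel d}
    (hf : Measurable f) (hg : Measurable g) (hh : Measurable h) :
    Measurable fun a => pairWave (f a) (g a) (h a) := by
  unfold pairWave; fun_prop

/-- The factor of the shorter vector is estimated by its length, the other one by `2`. -/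
theorem norm_pairWave_le (ξ : Vel d) {x y : Vel d} {t a b : ℝ} (hx : ‖x‖ ≤ t * a)
    (hy : ‖y‖ ≤ t * b) : ‖pairWave ξ x y‖ ≤ 2 * min 2 (t * min a b * ‖ξ‖) := by
  have h1 := norm_one_sub_wave_le ξ x
  have h2 := norm_one_sub_wave_le ξ y
  rw [pairWave, norm_mul]
  rcases le_total a b with h | h
  · rw [min_eq_left h, mul_comm 2]
    refine mul_le_mul (h1.trans ?_) (h2.trans (min_le_left _ _)) (norm_nonneg _) ?_
    · gcongr
    · exact le_min (by norm_num) (mul_nonneg ((norm_nonneg x).trans hx) (norm_nonneg _))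
  · rw [min_eq_right h]
    refine mul_le_mul (h1.trans (min_le_left _ _)) (h2.trans ?_) (norm_nonneg _) (by norm_num)
    gcongr

theorem increment_coeFn_pairWave (hd : 0 < d) {r : ℝ} (hr₀ : 0 < r) (hr₁ : r < 1)
    {p q : Vel d × Vel d} (h : q.1 + q.2 = p.1 + p.2) :
    CollisionModel.increment (d / 2 + r) p q =ᵐ[sobolevWeight d (d / 2 + r)]
      fun ξ => -(fourierConst d * wave ξ p.1 * pairWave ξ (q.2 - p.1) (q.1 - p.1)) := by
  filter_upwards [increment_coeFn hd hr₀ hr₁ p q] with ξ h1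
  have e1 : p.2 = p.1 + (q.2 - p.1 + (q.1 - p.1)) := by
    have : p.2 = q.1 + q.2 - p.1 := by rw [h]; abel
    rw [this]; abel
  have e2 : wave ξ q.1 = wave ξ p.1 * wave ξ (q.1 - p.1) := by
    rw [← wave_add, add_sub_cancel]
  have e3 : wave ξ q.2 = wave ξ p.1 * wave ξ (q.2 - p.1) := by
    rw [← wave_add, add_sub_cancel]
  have e4 : wave ξ p.2 = wave ξ p.1 * (wave ξ (q.2 - p.1) * wave ξ (q.1 - p.1)) := by
    rw [← wave_add, ← wave_add, ← e1]
  rw [h1, pairWave, e2, e3, e4]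
  ring

/-- The constant in the estimate of the elementary collisions. -/
def collisionConst (d : ℕ) (r : ℝ) : ℝ := 2 * fourierConst d * minNorm d r * angleConst r

theorem collisionConst_nonneg {r : ℝ} (hr₁ : r < 1) : 0 ≤ collisionConst d r := by
  have := fourierConst_pos (d := d)
  have := minNorm_nonneg (d := d) r
  have := angleConst_pos hr₁
  unfold collisionConst
  positivity

theorem half_angle_nonneg {θ : ℝ} (hθ : θ ∈ Icc 0 Real.pi) :
    0 ≤ Real.sin (θ / 2) ∧ 0 ≤ Real.cos (θ / 2) :=
  ⟨Real.sin_nonneg_of_nonneg_of_le_pi (by linarith [hθ.1]) (by linarith [hθ.1, hθ.2]),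
    Real.cos_nonneg_of_neg_pi_div_two_le_of_le (by linarith [hθ.1, Real.pi_pos])
      (by linarith [hθ.2])⟩

/-- The `L²` estimate common to the two ways of writing a collision. -/
theorem lintegral_collision_le (hd : 0 < d) {r : ℝ} (hr₀ : 0 < r) (hr₁ : r < 1) {f : Vel d → ℂ}
    {t θ : ℝ} (ht : 0 ≤ t) (hθ : θ ∈ Icc 0 Real.pi)
    (hf : ∀ᵐ ξ ∂(sobolevWeight d (d / 2 + r)), ‖f ξ‖ ≤ 2 * fourierConst d *
      min 2 (t * min (Real.cos (θ / 2)) (Real.sin (θ / 2)) * ‖ξ‖)) :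
    ∫⁻ ξ, ‖f ξ‖ₑ ^ 2 ∂(sobolevWeight d (d / 2 + r)) ≤
      ENNReal.ofReal (collisionConst d r * t ^ r * -kappaDensity r θ) ^ 2 := by
  obtain ⟨hs, hc⟩ := half_angle_nonneg hθ
  have h0 := fourierConst_pos (d := d)
  have h1 := lintegral_sq_le_of_le_min hd hr₀ hr₁ (by positivity) (by positivity) hf
  refine h1.trans (pow_le_pow_left' (ENNReal.ofReal_le_ofReal ?_) 2)
  have h2 := kappaDensity_bound hr₀ hr₁ hθ
  rw [min_comm, Real.mul_rpow ht (le_min hs hc), collisionConst]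
  have := minNorm_nonneg (d := d) r
  have h3 : 0 ≤ t ^ r := by positivity
  calc _ = 2 * fourierConst d * minNorm d r * t ^ r *
        min (Real.sin (θ / 2)) (Real.cos (θ / 2)) ^ r := by ring
    _ ≤ 2 * fourierConst d * minNorm d r * t ^ r * (angleConst r * -kappaDensity r θ) := by gcongr
    _ = _ := by ring

/-- The deviation angle between the relative velocities of `p = (v, w)` and `q = (v', w')`. -/
def devAngle (p q : Vel d × Vel d) : ℝ := InnerProductGeometry.angle (p.1 - p.2) (q.1 - q.2)

theorem devAngle_mem (p q : Vel d × Vel d) : devAngle p q ∈ Icc 0 Real.pi :=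
  ⟨InnerProductGeometry.angle_nonneg _ _, InnerProductGeometry.angle_le_pi _ _⟩

@[fun_prop]
theorem measurable_devAngle (p : Vel d × Vel d) : Measurable (devAngle p) := by
  unfold devAngle InnerProductGeometry.angle
  exact Real.measurable_arccos.comp (by fun_prop)

theorem inner_eq_cos_devAngle {p q : Vel d × Vel d} (he : ‖q.2 - q.1‖ = ‖p.2 - p.1‖) :
    inner ℝ (p.2 - p.1) (q.2 - q.1) = Real.cos (devAngle p q) * ‖p.2 - p.1‖ ^ 2 := by
  have h := InnerProductGeometry.cos_angle_mul_norm_mul_norm (p.1 - p.2) (q.1 - q.2)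
  rw [norm_sub_rev q.1, he, norm_sub_rev p.1, ← sq, ← neg_sub p.2, ← neg_sub q.2,
    inner_neg_neg] at h
  rw [← h, devAngle, neg_sub, neg_sub]

theorem sub_eq_half {p q : Vel d × Vel d} (h : q.1 + q.2 = p.1 + p.2) :
    q.2 - p.1 = (1 / 2 : ℝ) • (p.2 - p.1 + (q.2 - q.1)) ∧
      q.1 - p.1 = (1 / 2 : ℝ) • (p.2 - p.1 - (q.2 - q.1)) := by
  have e : p.2 = q.1 + q.2 - p.1 := by rw [h]; abel
  constructor
  · rw [e]; module
  · rw [e]; module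

theorem norm_sub_eq {p q : Vel d × Vel d} (h : q.1 + q.2 = p.1 + p.2)
    (he : ‖q.2 - q.1‖ = ‖p.2 - p.1‖) :
    ‖q.2 - p.1‖ = ‖p.2 - p.1‖ * Real.cos (devAngle p q / 2) ∧
      ‖q.1 - p.1‖ = ‖p.2 - p.1‖ * Real.sin (devAngle p q / 2) := by
  obtain ⟨hs, hc⟩ := half_angle_nonneg (devAngle_mem p q)
  have h1 : Real.cos (devAngle p q) = 2 * Real.cos (devAngle p q / 2) ^ 2 - 1 := by
    rw [← Real.cos_two_mul]; ring_nf
  have h2 := Real.sin_sq_add_cos_sq (devAngle p q / 2)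
  have h3 := inner_eq_cos_devAngle he
  rw [(sub_eq_half h).1, (sub_eq_half h).2]
  constructor
  · rw [← sq_eq_sq₀ (norm_nonneg _) (by positivity), norm_smul, mul_pow, norm_add_sq_real, h3, he,
      h1]
    norm_num
    ring
  · rw [← sq_eq_sq₀ (norm_nonneg _) (by positivity), norm_smul, mul_pow, norm_sub_sq_real, h3, he,
      h1]
    norm_num
    linear_combination (-‖p.2 - p.1‖ ^ 2) * h2

theorem norm_increment_le_of_norm_le (hd : 0 < d) {r : ℝ} (hr₀ : 0 < r) (hr₁ : r < 1)
    {p q : Vel d × Vel d} {θ : ℝ} (hθ : θ ∈ Icc 0 Real.pi) (h : q.1 + q.2 = p.1 + p.2)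
    (h2 : ‖q.2 - p.1‖ ≤ ‖p.2 - p.1‖ * Real.cos (θ / 2))
    (h1 : ‖q.1 - p.1‖ ≤ ‖p.2 - p.1‖ * Real.sin (θ / 2)) :
    ‖CollisionModel.increment (d / 2 + r) p q‖ ≤
      collisionConst d r * ‖p.2 - p.1‖ ^ r * -kappaDensity r θ := by
  have h3 := lintegral_collision_le hd hr₀ hr₁
    (f := CollisionModel.increment (d / 2 + r) p q) (norm_nonneg (p.2 - p.1)) hθ (by
      filter_upwards [increment_coeFn_pairWave hd hr₀ hr₁ h] with ξ hξ
      rw [hξ, norm_neg, norm_mul, norm_mul, norm_wave, mul_one,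
        Complex.norm_of_nonneg fourierConst_pos.le, mul_comm 2, mul_assoc]
      gcongr
      · exact fourierConst_pos.le
      · exact norm_pairWave_le ξ h2 h1)
  rw [← enorm_sq_eq_lintegral, ENNReal.pow_le_pow_left_iff two_ne_zero, ← ofReal_norm] at h3
  have h4 := kappaDensity_nonpos hr₀ hr₁ hθ
  have h5 := collisionConst_nonneg (d := d) hr₁
  refine (ENNReal.ofReal_le_ofReal_iff (mul_nonneg ?_ (by linarith))).1 h3
  positivity

theorem norm_increment_le (hd : 0 < d) {r : ℝ} (hr₀ : 0 < r) (hr₁ : r < 1)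
    {p q : Vel d × Vel d} (h : q.1 + q.2 = p.1 + p.2) (he : ‖q.2 - q.1‖ = ‖p.2 - p.1‖) :
    ‖CollisionModel.increment (d / 2 + r) p q‖ ≤
      collisionConst d r * ‖p.2 - p.1‖ ^ r * -kappaDensity r (devAngle p q) :=
  norm_increment_le_of_norm_le hd hr₀ hr₁ (devAngle_mem p q) h (norm_sub_eq h he).1.le
    (norm_sub_eq h he).2.le

/-! ### Random collisions with a given deviation angle -/

/-- Half the sum of `u` and of the vector obtained by turning `u` by the angle `θ` towards `g`. -/
def fwd (θ : ℝ) (u g : Vel d) : Vel d :=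
  (1 / 2 : ℝ) • (u + tilt (Real.cos θ) (Real.sin θ) u g)

/-- Half the difference of `u` and of the vector obtained by turning `u` by the angle `θ`
towards `g`. -/
def bwd (θ : ℝ) (u g : Vel d) : Vel d :=
  (1 / 2 : ℝ) • (u - tilt (Real.cos θ) (Real.sin θ) u g)

theorem fwd_add_bwd (θ : ℝ) (u g : Vel d) : fwd θ u g + bwd θ u g = u := by
  unfold fwd bwd; module

theorem fwd_eq (θ : ℝ) (u g : Vel d) :
    fwd θ u g = Real.cos (θ / 2) • tilt (Real.cos (θ / 2)) (Real.sin (θ / 2)) u g := by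
  have h1 : Real.cos θ = 2 * Real.cos (θ / 2) ^ 2 - 1 := by rw [← Real.cos_two_mul]; ring_nf
  have h2 : Real.sin θ = 2 * Real.sin (θ / 2) * Real.cos (θ / 2) := by
    rw [← Real.sin_two_mul]; ring_nf
  rw [fwd, tilt, tilt, h1, h2]
  module

theorem bwd_eq (θ : ℝ) (u g : Vel d) :
    bwd θ u g = Real.sin (θ / 2) • tilt (Real.sin (θ / 2)) (-Real.cos (θ / 2)) u g := by
  have h1 : Real.cos θ = 1 - 2 * Real.sin (θ / 2) ^ 2 := by
    rw [show θ = 2 * (θ / 2) by ring, Real.cos_two_mul, Real.cos_sq']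
    ring_nf
  have h2 : Real.sin θ = 2 * Real.sin (θ / 2) * Real.cos (θ / 2) := by
    rw [← Real.sin_two_mul]; ring_nf
  rw [bwd, tilt, tilt, h1, h2]
  module

theorem norm_fwd_le {θ : ℝ} (hθ : θ ∈ Icc 0 Real.pi) (u g : Vel d) :
    ‖fwd θ u g‖ ≤ ‖u‖ * Real.cos (θ / 2) := by
  rw [fwd_eq, norm_smul, Real.norm_of_nonneg (half_angle_nonneg hθ).2, mul_comm]
  exact mul_le_mul_of_nonneg_right (norm_tilt_le (Real.cos_sq_add_sin_sq _) u g)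
    (half_angle_nonneg hθ).2

theorem norm_bwd_le {θ : ℝ} (hθ : θ ∈ Icc 0 Real.pi) (u g : Vel d) :
    ‖bwd θ u g‖ ≤ ‖u‖ * Real.sin (θ / 2) := by
  rw [bwd_eq, norm_smul, Real.norm_of_nonneg (half_angle_nonneg hθ).1, mul_comm]
  refine mul_le_mul_of_nonneg_right (norm_tilt_le ?_ u g) (half_angle_nonneg hθ).1
  rw [neg_sq, Real.sin_sq_add_cos_sq]

@[fun_prop]
theorem measurable_fwd {α : Type*} [MeasurableSpace α] {t : α → ℝ} {f g : α → Vel d}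
    (ht : Measurable t) (hf : Measurable f) (hg : Measurable g) :
    Measurable fun a => fwd (t a) (f a) (g a) := by
  unfold fwd; fun_prop

@[fun_prop]
theorem measurable_bwd {α : Type*} [MeasurableSpace α] {t : α → ℝ} {f g : α → Vel d}
    (ht : Measurable t) (hf : Measurable f) (hg : Measurable g) :
    Measurable fun a => bwd (t a) (f a) (g a) := by
  unfold bwd; fun_prop

/-- The velocities `(v', w')` after a collision of two particles having the velocities
`p = (v, w)`, where `z` consists of the deviation angle and of a direction. -/
def collide (p : Vel d × Vel d) (z : ℝ × Vel d) : Vel d × Vel d :=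
  (p.1 + bwd z.1 (p.2 - p.1) z.2, p.1 + fwd z.1 (p.2 - p.1) z.2)

theorem collide_add (p : Vel d × Vel d) (z : ℝ × Vel d) :
    (collide p z).1 + (collide p z).2 = p.1 + p.2 := by
  have h := fwd_add_bwd z.1 (p.2 - p.1) z.2
  calc _ = p.1 + p.1 + (fwd z.1 (p.2 - p.1) z.2 + bwd z.1 (p.2 - p.1) z.2) := by
        simp only [collide]; abel
    _ = _ := by rw [h]; abel

theorem measurable_collide : Measurable fun a : (Vel d × Vel d) × (ℝ × Vel d) =>
    collide a.1 a.2 := by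
  unfold collide; fun_prop

/-- The angular measure without the two trivial collisions, of angles `0` and `π`, together
with an isotropic choice of the direction. -/
def outcome (d : ℕ) (γbar : Measure ℝ) : Measure (ℝ × Vel d) :=
  (γbar.restrict (Ioo 0 Real.pi)).prod (gauss d)

theorem integrable_kappaDensity {r : ℝ} {γbar : Measure ℝ}
    (hκ : IntegrableOn (kappaDensity r) (Ioc 0 Real.pi) γbar) :
    Integrable (fun θ => -kappaDensity r θ) (γbar.restrict (Ioo 0 Real.pi)) :=
  (hκ.mono_set Ioo_subset_Ioc_self).neg

/-- No finiteness of `γbar` is assumed: integrability of the contractivity density, which does not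
vanish inside `(0, π)`, makes it `σ`-finite there. -/
theorem sigmaFinite_restrict {r : ℝ} (hr₀ : 0 < r) (hr₁ : r < 1) {γbar : Measure ℝ}
    (hκ : IntegrableOn (kappaDensity r) (Ioc 0 Real.pi) γbar) :
    SigmaFinite (γbar.restrict (Ioo 0 Real.pi)) := by
  set γ₀ := γbar.restrict (Ioo 0 Real.pi) with hγ₀
  set f : ℝ → ℝ≥0∞ := fun θ => ENNReal.ofReal (-kappaDensity r θ) with hf
  have hfm : Measurable f := by fun_prop
  have hf0 : ∀ᵐ θ ∂γ₀, f θ ≠ 0 := by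
    filter_upwards [ae_restrict_mem measurableSet_Ioo] with θ hθ
    have := kappaDensity_neg hr₀ hr₁ hθ
    simp only [hf, ne_eq, ENNReal.ofReal_eq_zero, not_le]
    linarith
  have hfin : IsFiniteMeasure (γ₀.withDensity f) :=
    isFiniteMeasure_withDensity (integrable_kappaDensity hκ).lintegral_lt_top.ne
  rw [← withDensity_inv_same hfm hf0 (by simp [hf])]
  refine SigmaFinite.withDensity_of_ne_top ?_
  have hac := withDensity_absolutelyContinuous γ₀ f
  filter_upwards [hac.ae_le hf0] with θ h
  simpa using h

theorem ae_outcome {γbar : Measure ℝ} [SFinite (γbar.restrict (Ioo 0 Real.pi))] :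
    ∀ᵐ z ∂(outcome d γbar), z.1 ∈ Icc 0 Real.pi := by
  refine (Measure.ae_prod_iff_ae_ae ?_).2 ?_
  · exact measurableSet_Icc.preimage measurable_fst
  · filter_upwards [ae_restrict_mem measurableSet_Ioo] with θ hθ
    exact Filter.Eventually.of_forall fun _ => Ioo_subset_Icc_self hθ

theorem integrable_outcome {γbar : Measure ℝ} [SFinite (γbar.restrict (Ioo 0 Real.pi))]
    {f : ℝ → ℝ} (hf : Integrable f (γbar.restrict (Ioo 0 Real.pi))) :
    Integrable (fun z : ℝ × Vel d => f z.1) (outcome d γbar) :=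
  hf.comp_fst _

theorem norm_increment_collide_le (hd : 0 < d) {r : ℝ} (hr₀ : 0 < r) (hr₁ : r < 1)
    (p : Vel d × Vel d) {z : ℝ × Vel d} (hz : z.1 ∈ Icc 0 Real.pi) :
    ‖CollisionModel.increment (d / 2 + r) p (collide p z)‖ ≤
      collisionConst d r * ‖p.2 - p.1‖ ^ r * -kappaDensity r z.1 := by
  refine norm_increment_le_of_norm_le hd hr₀ hr₁ hz (collide_add p z) ?_ ?_
  · rw [collide, add_sub_cancel_left]
    exact norm_fwd_le hz _ _
  · rw [collide, add_sub_cancel_left]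
    exact norm_bwd_le hz _ _

theorem integrable_increment_collide (hd : 0 < d) {r : ℝ} (hr₀ : 0 < r) (hr₁ : r < 1)
    {γbar : Measure ℝ} (hκ : IntegrableOn (kappaDensity r) (Ioc 0 Real.pi) γbar)
    (p : Vel d × Vel d) :
    Integrable (fun z => CollisionModel.increment (d / 2 + r) p (collide p z))
      (outcome d γbar) := by
  have := sigmaFinite_restrict hr₀ hr₁ hκ
  refine Integrable.mono' ((integrable_outcome (integrable_kappaDensity hκ)).const_mul
    (collisionConst d r * ‖p.2 - p.1‖ ^ r)) ?_ ?_
  · have h1 : StronglyMeasurable fun q => CollisionModel.increment (d / 2 + r) p q :=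
      ((continuous_increment hd hr₀ hr₁).comp (Continuous.prodMk_right p)).stronglyMeasurable
    exact (h1.comp_measurable
      (measurable_collide.comp measurable_prodMk_left)).aestronglyMeasurable
  · filter_upwards [ae_outcome] with z hz
    exact norm_increment_collide_le hd hr₀ hr₁ p hz

/-! ### Conservation laws and the angular measure of a model -/

/-- The value of `pairWave` as a function of two scalar products. -/
def phase (a b : ℝ) : ℂ :=
  (1 - Complex.exp (-Complex.I * ((a + b) / 2 : ℝ))) *
    (1 - Complex.exp (-Complex.I * ((a - b) / 2 : ℝ)))

@[fun_prop]
theorem measurable_phase {α : Type*} [MeasurableSpace α] {f g : α → ℝ}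
    (hf : Measurable f) (hg : Measurable g) : Measurable fun a => phase (f a) (g a) := by
  unfold phase; fun_prop

theorem pairWave_half (ξ u y : Vel d) :
    pairWave ξ ((1 / 2 : ℝ) • (u + y)) ((1 / 2 : ℝ) • (u - y)) =
      phase (inner ℝ ξ u) (inner ℝ ξ y) := by
  rw [pairWave, wave, wave, phase, inner_smul_right, inner_smul_right, inner_add_right,
    inner_sub_right]
  ring_nf

/-- The duality between velocities and frequencies: tilting the relative velocity `u` in an
isotropic direction or tilting the frequency `ξ` gives the same average phase. -/
theorem integral_pairWave_symm (θ : ℝ) (u ξ : Vel d) :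
    ∫ g, pairWave ξ (fwd θ u g) (bwd θ u g) ∂(gauss d) =
      ∫ g, pairWave u (fwd θ ξ g) (bwd θ ξ g) ∂(gauss d) := by
  simp_rw [fwd, bwd, pairWave_half]
  rw [integral_tilt_symm (phase (inner ℝ ξ u)), real_inner_comm u ξ]

theorem min_two_le {r x : ℝ} (hr₀ : 0 < r) (hr₁ : r < 1) (hx : 0 ≤ x) : min 2 x ≤ 2 * x ^ r := by
  rcases le_total x 1 with h | h
  · have h1 : x ≤ x ^ r := Real.self_le_rpow_of_le_one hx h hr₁.le
    exact (min_le_right _ _).trans (by linarith)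
  · have h1 : 1 ≤ x ^ r := Real.one_le_rpow h hr₀.le
    exact (min_le_left _ _).trans (by linarith)

theorem norm_pairWave_le_kappaDensity {r : ℝ} (hr₀ : 0 < r) (hr₁ : r < 1) {θ t : ℝ}
    (hθ : θ ∈ Icc 0 Real.pi) (ht : 0 ≤ t) (ξ : Vel d) {x y : Vel d}
    (hx : ‖x‖ ≤ t * Real.cos (θ / 2)) (hy : ‖y‖ ≤ t * Real.sin (θ / 2)) :
    ‖pairWave ξ x y‖ ≤ 4 * (t * ‖ξ‖) ^ r * angleConst r * -kappaDensity r θ := by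
  obtain ⟨hs, hc⟩ := half_angle_nonneg hθ
  have h1 := norm_pairWave_le ξ hx hy
  set m := min (Real.cos (θ / 2)) (Real.sin (θ / 2)) with hm
  have hm0 : 0 ≤ m := le_min hc hs
  have h2 := min_two_le hr₀ hr₁ (x := t * m * ‖ξ‖) (by positivity)
  have h3 : m ^ r ≤ angleConst r * -kappaDensity r θ := by
    rw [hm, min_comm]
    exact kappaDensity_bound hr₀ hr₁ hθ
  calc _ ≤ 2 * (2 * (t * m * ‖ξ‖) ^ r) := by linarith
    _ = 4 * (t * ‖ξ‖) ^ r * m ^ r := by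
      rw [mul_right_comm, Real.mul_rpow (by positivity) hm0]
      ring
    _ ≤ 4 * (t * ‖ξ‖) ^ r * (angleConst r * -kappaDensity r θ) := by gcongr
    _ = _ := by ring

theorem norm_phase_le {r : ℝ} (hr₀ : 0 < r) (hr₁ : r < 1) {p q : Vel d × Vel d}
    (h : q.1 + q.2 = p.1 + p.2) (he : ‖q.2 - q.1‖ = ‖p.2 - p.1‖) (ξ : Vel d) :
    ‖phase (inner ℝ ξ (p.2 - p.1)) (inner ℝ ξ (q.2 - q.1))‖ ≤
      4 * (‖p.2 - p.1‖ * ‖ξ‖) ^ r * angleConst r * -kappaDensity r (devAngle p q) := by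
  rw [← pairWave_half, ← (sub_eq_half h).1, ← (sub_eq_half h).2]
  exact norm_pairWave_le_kappaDensity hr₀ hr₁ (devAngle_mem p q) (norm_nonneg _) ξ
    (norm_sub_eq h he).1.le (norm_sub_eq h he).2.le

theorem kappaDensity_eq_zero {r θ : ℝ} (hr₀ : 0 < r) (hθ : θ ∈ Icc 0 Real.pi)
    (h : θ ∉ Ioo 0 Real.pi) : kappaDensity r θ = 0 := by
  rcases hθ.1.eq_or_lt with h0 | h0
  · rw [← h0, kappaDensity_zero hr₀]
  rcases hθ.2.eq_or_lt with h1 | h1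
  · rw [h1, kappaDensity_pi hr₀]
  · exact absurd ⟨h0, h1⟩ h

/-- Turning the outgoing relative velocity around the incoming one only depends on the
deviation angle. -/
theorem turn_eq_tilt {p q : Vel d × Vel d} (hp : p.1 ≠ p.2) (he : ‖q.2 - q.1‖ = ‖p.2 - p.1‖)
    (g : Vel d) :
    turn (p.2 - p.1) (q.2 - q.1) g =
      tilt (Real.cos (devAngle p q)) (Real.sin (devAngle p q)) (p.2 - p.1) g := by
  have hu : ‖p.2 - p.1‖ ^ 2 ≠ 0 := by
    have : p.2 - p.1 ≠ 0 := sub_ne_zero.2 hp.symm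
    simpa using this
  set u := p.2 - p.1 with hu'
  set y := q.2 - q.1 with hy'
  have h1 : y - perp u y = Real.cos (devAngle p q) • u := by
    rw [sub_perp, inner_eq_cos_devAngle he, mul_div_assoc, div_self hu, mul_one]
  have hsin : 0 ≤ Real.sin (devAngle p q) :=
    Real.sin_nonneg_of_nonneg_of_le_pi (devAngle_mem p q).1 (devAngle_mem p q).2
  have h2 : ‖perp u y‖ = Real.sin (devAngle p q) * ‖u‖ := by
    rw [← sq_eq_sq₀ (norm_nonneg _) (by positivity)]
    have h3 : perp u y = y - Real.cos (devAngle p q) • u := by rw [← h1]; abel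
    rw [h3, norm_sub_sq_real, inner_smul_right, real_inner_comm u y, inner_eq_cos_devAngle he, he,
      norm_smul, mul_pow, mul_pow, Real.sin_sq, Real.norm_eq_abs, sq_abs]
    ring
  rw [turn, tilt, h1, h2]

namespace CollisionModel

variable (M : CollisionModel d)

theorem ae_conserve (p : Vel d × Vel d) :
    ∀ᵐ q ∂(M.γ p), q.1 + q.2 = p.1 + p.2 ∧ ‖q.2 - q.1‖ = ‖p.2 - p.1‖ :=
  (M.momentum p.1 p.2).and (M.energy p.1 p.2)

/-- The collisions whose deviation angle is neither `0` nor `π`; the others change nothing. -/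
def effective (p : Vel d × Vel d) : Measure (Vel d × Vel d) :=
  (M.γ p).restrict (devAngle p ⁻¹' Ioo 0 Real.pi)

variable {M}

theorem map_effective {γbar : Measure ℝ} (hM : M.IsMaxwellianWith γbar) {p : Vel d × Vel d}
    (hp : p.1 ≠ p.2) :
    (M.effective p).map (devAngle p) = γbar.restrict (Ioo 0 Real.pi) := by
  rw [effective, ← Measure.restrict_map (measurable_devAngle p) measurableSet_Ioo,
    ← hM p.1 p.2 hp, angularMeasure, Measure.restrict_restrict_of_subset Ioo_subset_Ioc_self]
  rfl

theorem sigmaFinite_effective {r : ℝ} (hr₀ : 0 < r) (hr₁ : r < 1) {γbar : Measure ℝ}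
    (hM : M.IsMaxwellianWith γbar) (hκ : IntegrableOn (kappaDensity r) (Ioc 0 Real.pi) γbar)
    {p : Vel d × Vel d} (hp : p.1 ≠ p.2) : SigmaFinite (M.effective p) := by
  have h := sigmaFinite_restrict hr₀ hr₁ hκ
  rw [← map_effective hM hp] at h
  exact SigmaFinite.of_map _ (measurable_devAngle p).aemeasurable h

theorem integrable_effective_kappaDensity {r : ℝ} {γbar : Measure ℝ}
    (hM : M.IsMaxwellianWith γbar) (hκ : IntegrableOn (kappaDensity r) (Ioc 0 Real.pi) γbar)
    {p : Vel d × Vel d} (hp : p.1 ≠ p.2) :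
    Integrable (fun q => -kappaDensity r (devAngle p q)) (M.effective p) := by
  have h := integrable_kappaDensity hκ
  rw [← map_effective hM hp] at h
  exact h.comp_measurable (measurable_devAngle p)

theorem ae_effective (M : CollisionModel d) (p : Vel d × Vel d) :
    ∀ᵐ q ∂(M.effective p), q.1 + q.2 = p.1 + p.2 ∧ ‖q.2 - q.1‖ = ‖p.2 - p.1‖ :=
  ae_restrict_of_ae (M.ae_conserve p)

/-- Two equal velocities, or a deviation angle `0` or `π`, leave the pair of velocities unchanged
up to order. -/
theorem increment_eq_zero (hd : 0 < d) {r : ℝ} (hr₀ : 0 < r) (hr₁ : r < 1) (p : Vel d × Vel d) :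
    ∀ᵐ q ∂(M.γ p), (p.1 = p.2 ∨ q ∉ devAngle p ⁻¹' Ioo 0 Real.pi) →
      increment (d / 2 + r) p q = 0 := by
  filter_upwards [M.ae_conserve p] with q hq h
  refine norm_le_zero_iff.1 ((norm_increment_le hd hr₀ hr₁ hq.1 hq.2).trans ?_)
  rcases h with h | h
  · simp [h, Real.zero_rpow hr₀.ne']
  · rw [kappaDensity_eq_zero hr₀ (devAngle_mem p q) h]
    simp

theorem aestronglyMeasurable_increment (hd : 0 < d) {r : ℝ} (hr₀ : 0 < r) (hr₁ : r < 1)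
    (p : Vel d × Vel d) (ρ : Measure (Vel d × Vel d)) :
    AEStronglyMeasurable (fun q => increment (d / 2 + r) p q) ρ :=
  ((continuous_increment hd hr₀ hr₁).comp (Continuous.prodMk_right p)).aestronglyMeasurable

theorem integrable_effective_increment (hd : 0 < d) {r : ℝ} (hr₀ : 0 < r) (hr₁ : r < 1)
    {γbar : Measure ℝ} (hM : M.IsMaxwellianWith γbar)
    (hκ : IntegrableOn (kappaDensity r) (Ioc 0 Real.pi) γbar) {p : Vel d × Vel d}
    (hp : p.1 ≠ p.2) : Integrable (fun q => increment (d / 2 + r) p q) (M.effective p) := by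
  refine Integrable.mono' ((integrable_effective_kappaDensity hM hκ hp).const_mul
    (collisionConst d r * ‖p.2 - p.1‖ ^ r)) (aestronglyMeasurable_increment hd hr₀ hr₁ p _) ?_
  filter_upwards [M.ae_effective p] with q hq
  exact norm_increment_le hd hr₀ hr₁ hq.1 hq.2

theorem integrable_increment (hd : 0 < d) {r : ℝ} (hr₀ : 0 < r) (hr₁ : r < 1)
    {γbar : Measure ℝ} (hM : M.IsMaxwellianWith γbar)
    (hκ : IntegrableOn (kappaDensity r) (Ioc 0 Real.pi) γbar) (p : Vel d × Vel d) :
    Integrable (fun q => increment (d / 2 + r) p q) (M.γ p) := by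
  have h0 := increment_eq_zero (M := M) hd hr₀ hr₁ p
  by_cases hp : p.1 = p.2
  · refine (integrable_zero _ (Hdot d (d / 2 + r)) (M.γ p)).congr ?_
    filter_upwards [h0] with q hq
    exact (hq (Or.inl hp)).symm
  · refine IntegrableOn.integrable_of_ae_notMem_eq_zero
      (integrable_effective_increment hd hr₀ hr₁ hM hκ hp) ?_
    filter_upwards [h0] with q hq hq'
    exact hq (Or.inr hq')

/-- A trigonometric integral against the collision measure is not changed when the frequency
is turned around the relative velocity, by invariance under isometries. -/
theorem integral_phase_turn (hd : 2 ≤ d) (p : Vel d × Vel d) (ξ : Vel d) {g : Vel d}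
    (hg : perp (p.2 - p.1) g ≠ 0) :
    ∫ q, phase (inner ℝ ξ (p.2 - p.1)) (inner ℝ ξ (q.2 - q.1)) ∂(M.γ p) =
      ∫ q, phase (inner ℝ ξ (p.2 - p.1)) (inner ℝ (q.2 - q.1) (turn (p.2 - p.1) ξ g)) ∂(M.γ p) := by
  obtain ⟨J₀, hdet, hJu, hJξ⟩ := exists_isometry_turn hd hg ξ
  let J : Vel d ≃ᵃⁱ[ℝ] Vel d := AffineIsometryEquiv.mk' (fun x => J₀ (x - p.1) + p.1) J₀ p.1
    (fun x => by simp)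
  have hJ : ∀ x, J x = J₀ (x - p.1) + p.1 := fun x => rfl
  have h := M.isometry J (by simpa [J] using hdet) p.1 p.2
  have hv : J p.1 = p.1 := by rw [hJ]; simp
  have hw : J p.2 = p.2 := by rw [hJ, hJu]; abel
  rw [hv, hw] at h
  have hm : Measurable J := J.continuous.measurable
  conv_rhs => rw [show M.γ p = _ from h]
  rw [integral_map (by fun_prop) (Measurable.aestronglyMeasurable (by fun_prop))]
  congr 1
  ext1 q
  have h1 : J q.2 - J q.1 = J₀ (q.2 - q.1) := by
    rw [hJ, hJ, add_sub_add_right_eq_sub, ← map_sub, sub_sub_sub_cancel_right]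
  rw [Prod.map_fst, Prod.map_snd, h1, ← hJξ, J₀.inner_map_map, real_inner_comm ξ]

/-- The law of the outgoing velocities, tested against trigonometric functions: the deviation
angle follows the angular measure and the direction is isotropic. -/
theorem integral_effective_phase (hd : 2 ≤ d) {r : ℝ} (hr₀ : 0 < r) (hr₁ : r < 1)
    {γbar : Measure ℝ} (hM : M.IsMaxwellianWith γbar)
    (hκ : IntegrableOn (kappaDensity r) (Ioc 0 Real.pi) γbar) {p : Vel d × Vel d}
    (hp : p.1 ≠ p.2) (ξ : Vel d) :
    ∫ q, phase (inner ℝ ξ (p.2 - p.1)) (inner ℝ ξ (q.2 - q.1)) ∂(M.effective p) =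
      ∫ θ, ∫ g, phase (inner ℝ ξ (p.2 - p.1))
        (inner ℝ ξ (tilt (Real.cos θ) (Real.sin θ) (p.2 - p.1) g))
        ∂(gauss d) ∂(γbar.restrict (Ioo 0 Real.pi)) := by
  have := sigmaFinite_effective hr₀ hr₁ hM hκ hp
  set a := inner ℝ ξ (p.2 - p.1) with ha
  have hbound : ∀ᵐ q ∂(M.γ p), ∀ η : Vel d, ‖η‖ ≤ ‖ξ‖ → inner ℝ η (p.2 - p.1) = a →
      ‖phase a (inner ℝ (q.2 - q.1) η)‖ ≤
        4 * (‖p.2 - p.1‖ * ‖ξ‖) ^ r * angleConst r * -kappaDensity r (devAngle p q) := by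
    filter_upwards [M.ae_conserve p] with q hq η hη1 hη2
    have h1 := norm_phase_le hr₀ hr₁ hq.1 hq.2 η
    rw [hη2, real_inner_comm] at h1
    refine h1.trans ?_
    have h2 := kappaDensity_nonpos hr₀ hr₁ (devAngle_mem p q)
    have h3 := angleConst_pos hr₁
    have h4 : 0 ≤ -kappaDensity r (devAngle p q) := by linarith
    gcongr
  have hset : ∀ η : Vel d, ‖η‖ ≤ ‖ξ‖ → inner ℝ η (p.2 - p.1) = a →
      ∫ q, phase a (inner ℝ (q.2 - q.1) η) ∂(M.effective p) =
        ∫ q, phase a (inner ℝ (q.2 - q.1) η) ∂(M.γ p) := by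
    intro η hη1 hη2
    refine setIntegral_eq_integral_of_ae_compl_eq_zero ?_
    filter_upwards [hbound] with q hq hq'
    have h1 := hq η hη1 hη2
    rw [kappaDensity_eq_zero hr₀ (devAngle_mem p q) hq'] at h1
    exact norm_le_zero_iff.1 (h1.trans (by simp))
  have hturn : ∀ g : Vel d, inner ℝ (turn (p.2 - p.1) ξ g) (p.2 - p.1) = a := fun g => by
    rw [real_inner_comm, inner_turn, real_inner_comm]
  calc ∫ q, phase a (inner ℝ ξ (q.2 - q.1)) ∂(M.effective p)
      = ∫ g, ∫ q, phase a (inner ℝ (q.2 - q.1) (turn (p.2 - p.1) ξ g)) ∂(M.effective p)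
          ∂(gauss d) := by
        have h1 : (fun g => ∫ q, phase a (inner ℝ (q.2 - q.1) (turn (p.2 - p.1) ξ g))
            ∂(M.effective p)) =ᵐ[gauss d] fun _ =>
            ∫ q, phase a (inner ℝ ξ (q.2 - q.1)) ∂(M.effective p) := by
          filter_upwards [perp_ne_zero_ae hd (p.2 - p.1)] with g hg
          rw [hset _ (norm_turn_le _ _ _) (hturn g), ← integral_phase_turn hd p ξ hg]
          have h2 := hset ξ le_rfl rfl
          simp_rw [real_inner_comm ξ] at h2 ⊢
          exact h2.symm
        rw [integral_congr_ae h1]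
        simp
    _ = ∫ q, ∫ g, phase a (inner ℝ (q.2 - q.1) (turn (p.2 - p.1) ξ g)) ∂(gauss d)
          ∂(M.effective p) := by
        refine integral_integral_swap ?_
        refine Integrable.mono' (((integrable_effective_kappaDensity hM hκ hp).const_mul
          (4 * (‖p.2 - p.1‖ * ‖ξ‖) ^ r * angleConst r)).comp_snd (gauss d)) ?_ ?_
        · exact Measurable.aestronglyMeasurable (by unfold Function.uncurry; fun_prop)
        · have h1 : ∀ᵐ z ∂((gauss d).prod (M.effective p)),
              ∀ η : Vel d, ‖η‖ ≤ ‖ξ‖ → inner ℝ η (p.2 - p.1) = a →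
                ‖phase a (inner ℝ (z.2.2 - z.2.1) η)‖ ≤
                4 * (‖p.2 - p.1‖ * ‖ξ‖) ^ r * angleConst r * -kappaDensity r (devAngle p z.2) :=
            Measure.quasiMeasurePreserving_snd.ae (ae_restrict_of_ae hbound)
          filter_upwards [h1] with z hz
          exact hz _ (norm_turn_le _ _ _) (hturn z.1)
    _ = ∫ q, ∫ g, phase a (inner ℝ ξ (tilt (Real.cos (devAngle p q)) (Real.sin (devAngle p q))
          (p.2 - p.1) g)) ∂(gauss d) ∂(M.effective p) := by
        refine integral_congr_ae ?_
        filter_upwards [M.ae_effective p] with q hq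
        rw [integral_turn_symm (phase a)]
        simp_rw [turn_eq_tilt hp hq.2]
    _ = _ := by
        rw [← map_effective hM hp, integral_map (measurable_devAngle p).aemeasurable]
        refine StronglyMeasurable.aestronglyMeasurable (StronglyMeasurable.integral_prod_right
          (f := fun (θ : ℝ) g => phase a (inner ℝ ξ (tilt (Real.cos θ) (Real.sin θ)
            (p.2 - p.1) g))) (Measurable.stronglyMeasurable ?_))
        unfold Function.uncurry
        fun_prop

end CollisionModel

/-! ### The average effect of the collisions of two particles -/

/-- Up to the normalization, the Fourier transform at the frequency `x.2` of the effect of a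
collision of two particles having the velocities `p`, written in the dual way: the frequency is
tilted, instead of the relative velocity. -/
def dualKernel (p : Vel d × Vel d) (x : (ℝ × Vel d) × Vel d) : ℂ :=
  -(fourierConst d * wave x.2 p.1 *
    pairWave (p.2 - p.1) (fwd x.1.1 x.2 x.1.2) (bwd x.1.1 x.2 x.1.2))

@[fun_prop]
theorem measurable_dualKernel {α : Type*} [MeasurableSpace α] {f : α → Vel d × Vel d}
    {g : α → (ℝ × Vel d) × Vel d} (hf : Measurable f) (hg : Measurable g) :
    Measurable fun a => dualKernel (f a) (g a) := by
  unfold dualKernel; fun_prop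

theorem dualKernel_eq (p : Vel d × Vel d) (x : (ℝ × Vel d) × Vel d) :
    dualKernel p x = -(fourierConst d * (wave x.2 p.1 + wave x.2 p.2 -
      wave (bwd x.1.1 x.2 x.1.2) p.1 * wave (fwd x.1.1 x.2 x.1.2) p.2 -
      wave (fwd x.1.1 x.2 x.1.2) p.1 * wave (bwd x.1.1 x.2 x.1.2) p.2)) := by
  set a := fwd x.1.1 x.2 x.1.2 with ha
  set b := bwd x.1.1 x.2 x.1.2 with hb
  have hab : x.2 = a + b := (fwd_add_bwd _ _ _).symm
  have h : ∀ c : Vel d, wave c p.2 = wave c p.1 * wave c (p.2 - p.1) := fun c => by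
    rw [← wave_add, add_sub_cancel]
  have h' : ∀ c : Vel d, wave x.2 c = wave a c * wave b c := fun c => by
    rw [wave_comm, wave_comm a, wave_comm b, ← wave_add, ← hab]
  rw [dualKernel, ← ha, ← hb, pairWave, h a, h b, h' p.1, h' p.2, h a, h b, wave_comm _ a,
    wave_comm _ b]
  ring

/-- The symmetry in the two particles, hidden in the definition of the model. -/
theorem dualKernel_swap (p : Vel d × Vel d) (x : (ℝ × Vel d) × Vel d) :
    dualKernel p.swap x = dualKernel p x := by
  rw [dualKernel_eq, dualKernel_eq, Prod.fst_swap, Prod.snd_swap]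
  ring

theorem lintegral_dualKernel_le (hd : 0 < d) {r : ℝ} (hr₀ : 0 < r) (hr₁ : r < 1)
    (p : Vel d × Vel d) {z : ℝ × Vel d} (hz : z.1 ∈ Icc 0 Real.pi) :
    ∫⁻ ξ, ‖dualKernel p (z, ξ)‖ₑ ^ 2 ∂(sobolevWeight d (d / 2 + r)) ≤
      ENNReal.ofReal (collisionConst d r * ‖p.2 - p.1‖ ^ r * -kappaDensity r z.1) ^ 2 := by
  refine lintegral_collision_le hd hr₀ hr₁ (norm_nonneg _) hz
    (Filter.Eventually.of_forall fun ξ => ?_)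
  rw [dualKernel, norm_neg, norm_mul, norm_mul, norm_wave, mul_one,
    Complex.norm_of_nonneg fourierConst_pos.le, mul_comm 2, mul_assoc]
  have h : ‖pairWave (p.2 - p.1) (fwd z.1 ξ z.2) (bwd z.1 ξ z.2)‖ ≤
      2 * min 2 (‖p.2 - p.1‖ * min (Real.cos (z.1 / 2)) (Real.sin (z.1 / 2)) * ‖ξ‖) := by
    convert norm_pairWave_le (p.2 - p.1) (norm_fwd_le hz ξ z.2) (norm_bwd_le hz ξ z.2) using 3
    ring
  exact mul_le_mul_of_nonneg_left h fourierConst_pos.le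

theorem integral_inner_factor {X : Type*} [MeasurableSpace X] {s : ℝ} (ρ : Measure X) [SFinite ρ]
    (h : Hdot d s) (v : Vel d) (k : X → Vel d → ℂ)
    (hint : Integrable (fun x : X × Vel d => inner ℂ (h x.2)
      (-(fourierConst d * wave x.2 v * k x.1 x.2))) (ρ.prod (sobolevWeight d s))) :
    ∫ x : X × Vel d, inner ℂ (h x.2) (-(fourierConst d * wave x.2 v * k x.1 x.2))
      ∂(ρ.prod (sobolevWeight d s)) =
    ∫ ξ, inner ℂ (h ξ) (-(fourierConst d * wave ξ v * ∫ x, k x ξ ∂ρ)) ∂(sobolevWeight d s) := by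
  rw [integral_prod_symm _ hint]
  congr 1
  ext1 ξ
  rw [RCLike.inner_apply, ← neg_mul, mul_right_comm, ← integral_const_mul]
  congr 1
  ext1 x
  rw [RCLike.inner_apply]
  ring

namespace CollisionModel

variable {M : CollisionModel d}

/-- The average effect of the collisions of two particles having the velocities `p`. -/
def meanIncrement (M : CollisionModel d) (r : ℝ) (p : Vel d × Vel d) : Hdot d (d / 2 + r) :=
  ∫ q, increment (d / 2 + r) p q ∂(M.γ p)

/-- Scalar products with the average increment, for two distinct velocities, from the
direct collisions and from the dual ones. -/
theorem inner_meanIncrement_aux (hd : 2 ≤ d) {r : ℝ} (hr₀ : 0 < r) (hr₁ : r < 1)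
    {γbar : Measure ℝ} (hM : M.IsMaxwellianWith γbar)
    (hκ : IntegrableOn (kappaDensity r) (Ioc 0 Real.pi) γbar) {p : Vel d × Vel d}
    (hp : p.1 ≠ p.2) (h : Hdot d (d / 2 + r))
    (hint : Integrable (fun x => inner ℂ (h x.2) (dualKernel p x))
      ((outcome d γbar).prod (sobolevWeight d (d / 2 + r)))) :
    inner ℂ h (M.meanIncrement r p) =
        inner ℂ h (∫ z, increment (d / 2 + r) p (collide p z) ∂(outcome d γbar)) ∧
      inner ℂ h (M.meanIncrement r p) = ∫ x, inner ℂ (h x.2) (dualKernel p x)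
        ∂((outcome d γbar).prod (sobolevWeight d (d / 2 + r))) := by
  have hd' : 0 < d := by omega
  have := sigmaFinite_effective hr₀ hr₁ hM hκ hp
  have hsf := sigmaFinite_restrict hr₀ hr₁ hκ
  have : SFinite (outcome d γbar) := by unfold outcome; infer_instance
  have h1 : M.meanIncrement r p = ∫ q, increment (d / 2 + r) p q ∂(M.effective p) := by
    refine (setIntegral_eq_integral_of_ae_compl_eq_zero ?_).symm
    filter_upwards [increment_eq_zero (M := M) hd' hr₀ hr₁ p] with q hq hq'
    exact hq (Or.inr hq')
  have hphase : ∀ ξ : Vel d,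
      ∫ q, pairWave ξ (q.2 - p.1) (q.1 - p.1) ∂(M.effective p) =
      ∫ q, phase (inner ℝ ξ (p.2 - p.1)) (inner ℝ ξ (q.2 - q.1)) ∂(M.effective p) := by
    intro ξ
    refine integral_congr_ae ?_
    filter_upwards [M.ae_effective p] with q hq
    rw [(sub_eq_half hq.1).1, (sub_eq_half hq.1).2, pairWave_half]
  have hfub : ∀ ξ u : Vel d, ∀ F : ℝ × Vel d → ℂ, Measurable F →
      (∀ z : ℝ × Vel d, z.1 ∈ Icc 0 Real.pi →
        ‖F z‖ ≤ 4 * (‖u‖ * ‖ξ‖) ^ r * angleConst r * -kappaDensity r z.1) →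
      ∫ z, F z ∂(outcome d γbar) =
        ∫ θ, ∫ g, F (θ, g) ∂(gauss d) ∂(γbar.restrict (Ioo 0 Real.pi)) := by
    intro ξ u F hF hb
    refine integral_prod _ (Integrable.mono' ((integrable_outcome
      (integrable_kappaDensity hκ)).const_mul (4 * (‖u‖ * ‖ξ‖) ^ r * angleConst r))
      hF.aestronglyMeasurable ?_)
    filter_upwards [ae_outcome] with z hz
    exact hb z hz
  have hK2 : ∀ ξ : Vel d, ∫ z, pairWave ξ ((collide p z).2 - p.1) ((collide p z).1 - p.1)
      ∂(outcome d γbar) = ∫ q, pairWave ξ (q.2 - p.1) (q.1 - p.1) ∂(M.effective p) := by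
    intro ξ
    rw [hphase, integral_effective_phase hd hr₀ hr₁ hM hκ hp]
    simp only [collide, add_sub_cancel_left]
    rw [hfub ξ (p.2 - p.1) _ (by fun_prop) fun z hz =>
      norm_pairWave_le_kappaDensity hr₀ hr₁ hz (norm_nonneg _) ξ (norm_fwd_le hz _ _)
        (norm_bwd_le hz _ _)]
    simp_rw [fwd, bwd, pairWave_half]
  have hK3 : ∀ ξ : Vel d, ∫ z, pairWave (p.2 - p.1) (fwd z.1 ξ z.2) (bwd z.1 ξ z.2)
      ∂(outcome d γbar) = ∫ q, pairWave ξ (q.2 - p.1) (q.1 - p.1) ∂(M.effective p) := by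
    intro ξ
    rw [hphase, integral_effective_phase hd hr₀ hr₁ hM hκ hp,
      hfub (p.2 - p.1) ξ _ (by fun_prop) fun z hz =>
      norm_pairWave_le_kappaDensity hr₀ hr₁ hz (norm_nonneg _) _ (norm_fwd_le hz _ _)
        (norm_bwd_le hz _ _)]
    simp_rw [← integral_pairWave_symm, fwd, bwd, pairWave_half]
  obtain ⟨i1, e1⟩ := inner_integral_eq (M.effective p) h
    (integrable_effective_increment hd' hr₀ hr₁ hM hκ hp)
    (f := fun x => -(fourierConst d * wave x.2 p.1 * pairWave x.2 (x.1.2 - p.1) (x.1.1 - p.1)))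
    (by fun_prop) (by
      filter_upwards [M.ae_effective p] with q hq
      exact increment_coeFn_pairWave hd' hr₀ hr₁ hq.1)
  obtain ⟨i2, e2⟩ := inner_integral_eq (outcome d γbar) h
    (integrable_increment_collide hd' hr₀ hr₁ hκ p)
    (f := fun x => -(fourierConst d * wave x.2 p.1 *
      pairWave x.2 ((collide p x.1).2 - p.1) ((collide p x.1).1 - p.1)))
    (by
      have hc : Measurable fun x : (ℝ × Vel d) × Vel d => collide p x.1 :=
        measurable_collide.comp (measurable_const.prodMk measurable_fst)
      fun_prop)
    (Filter.Eventually.of_forall fun z =>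
      increment_coeFn_pairWave hd' hr₀ hr₁ (collide_add p z))
  rw [integral_inner_factor (M.effective p) h p.1
    (fun q ξ => pairWave ξ (q.2 - p.1) (q.1 - p.1)) i1] at e1
  rw [integral_inner_factor (outcome d γbar) h p.1
    (fun z ξ => pairWave ξ ((collide p z).2 - p.1) ((collide p z).1 - p.1)) i2] at e2
  have e3 := integral_inner_factor (outcome d γbar) h p.1
    (fun z ξ => pairWave (p.2 - p.1) (fwd z.1 ξ z.2) (bwd z.1 ξ z.2)) hint
  simp_rw [hK2] at e2
  simp_rw [hK3] at e3
  rw [h1]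
  exact ⟨e1.trans e2.symm, e1.trans e3.symm⟩

theorem integrable_inner_dualKernel (hd : 2 ≤ d) {r : ℝ} (hr₀ : 0 < r) (hr₁ : r < 1)
    {γbar : Measure ℝ} (hκ : IntegrableOn (kappaDensity r) (Ioc 0 Real.pi) γbar)
    (p : Vel d × Vel d) (h : Hdot d (d / 2 + r)) :
    Integrable (fun x => inner ℂ (h x.2) (dualKernel p x))
      ((outcome d γbar).prod (sobolevWeight d (d / 2 + r))) := by
  have hsf := sigmaFinite_restrict hr₀ hr₁ hκ
  have : SFinite (outcome d γbar) := by unfold outcome; infer_instance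
  refine integrable_inner_of_lintegral_le (outcome d γbar) h (by fun_prop)
    (B := fun z => ENNReal.ofReal (collisionConst d r * ‖p.2 - p.1‖ ^ r * -kappaDensity r z.1))
    ?_ ?_
  · exact ((integrable_outcome (integrable_kappaDensity hκ)).const_mul _).lintegral_lt_top
  · filter_upwards [ae_outcome] with z hz
    exact lintegral_dualKernel_le (by omega) hr₀ hr₁ p hz

theorem inner_meanIncrement (hd : 2 ≤ d) {r : ℝ} (hr₀ : 0 < r) (hr₁ : r < 1)
    {γbar : Measure ℝ} (hM : M.IsMaxwellianWith γbar)
    (hκ : IntegrableOn (kappaDensity r) (Ioc 0 Real.pi) γbar) (p : Vel d × Vel d)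
    (h : Hdot d (d / 2 + r)) :
    inner ℂ h (M.meanIncrement r p) = ∫ x, inner ℂ (h x.2) (dualKernel p x)
      ∂((outcome d γbar).prod (sobolevWeight d (d / 2 + r))) := by
  by_cases hp : p.1 = p.2
  · have h1 : M.meanIncrement r p = 0 := by
      refine integral_eq_zero_of_ae ?_
      filter_upwards [increment_eq_zero (M := M) (by omega) hr₀ hr₁ p] with q hq
      exact hq (Or.inl hp)
    rw [h1, inner_zero_right]
    symm
    refine integral_eq_zero_of_ae (Filter.Eventually.of_forall fun x => ?_)
    simp [dualKernel, pairWave, hp, wave_comm 0]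
  · exact (inner_meanIncrement_aux hd hr₀ hr₁ hM hκ hp h
      (integrable_inner_dualKernel hd hr₀ hr₁ hκ p h)).2

/-- The collisions may be replaced by those of random isotropic direction; this form is visibly
measurable in `p`. -/
theorem meanIncrement_eq (hd : 2 ≤ d) {r : ℝ} (hr₀ : 0 < r) (hr₁ : r < 1)
    {γbar : Measure ℝ} (hM : M.IsMaxwellianWith γbar)
    (hκ : IntegrableOn (kappaDensity r) (Ioc 0 Real.pi) γbar) (p : Vel d × Vel d) :
    M.meanIncrement r p = ∫ z, increment (d / 2 + r) p (collide p z) ∂(outcome d γbar) := by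
  by_cases hp : p.1 = p.2
  · have hsf := sigmaFinite_restrict hr₀ hr₁ hκ
    have h1 : M.meanIncrement r p = 0 := by
      refine integral_eq_zero_of_ae ?_
      filter_upwards [increment_eq_zero (M := M) (by omega) hr₀ hr₁ p] with q hq
      exact hq (Or.inl hp)
    rw [h1]
    symm
    refine integral_eq_zero_of_ae ?_
    filter_upwards [ae_outcome] with z hz
    have h2 := norm_increment_collide_le (by omega) hr₀ hr₁ p hz
    rw [hp, sub_self, norm_zero, Real.zero_rpow hr₀.ne', mul_zero, zero_mul] at h2
    exact norm_le_zero_iff.1 h2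
  · exact ext_inner_left ℂ fun h => (inner_meanIncrement_aux hd hr₀ hr₁ hM hκ hp h
      (integrable_inner_dualKernel hd hr₀ hr₁ hκ p h)).1

theorem meanIncrement_swap (hd : 2 ≤ d) {r : ℝ} (hr₀ : 0 < r) (hr₁ : r < 1)
    {γbar : Measure ℝ} (hM : M.IsMaxwellianWith γbar)
    (hκ : IntegrableOn (kappaDensity r) (Ioc 0 Real.pi) γbar) (p : Vel d × Vel d) :
    M.meanIncrement r p.swap = M.meanIncrement r p := by
  refine ext_inner_left ℂ fun h => ?_
  rw [inner_meanIncrement hd hr₀ hr₁ hM hκ, inner_meanIncrement hd hr₀ hr₁ hM hκ]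
  simp_rw [dualKernel_swap]

theorem stronglyMeasurable_meanIncrement (hd : 2 ≤ d) {r : ℝ} (hr₀ : 0 < r) (hr₁ : r < 1)
    {γbar : Measure ℝ} (hM : M.IsMaxwellianWith γbar)
    (hκ : IntegrableOn (kappaDensity r) (Ioc 0 Real.pi) γbar) :
    StronglyMeasurable (M.meanIncrement r) := by
  have hsf := sigmaFinite_restrict hr₀ hr₁ hκ
  have : SFinite (outcome d γbar) := by unfold outcome; infer_instance
  have h1 : M.meanIncrement r =
      fun p => ∫ z, increment (d / 2 + r) p (collide p z) ∂(outcome d γbar) :=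
    funext (meanIncrement_eq hd hr₀ hr₁ hM hκ)
  rw [h1]
  have h2 := (continuous_increment (d := d) (by omega) hr₀ hr₁).stronglyMeasurable
  have hm : Measurable fun a : (Vel d × Vel d) × (ℝ × Vel d) => (a.1, collide a.1 a.2) :=
    measurable_fst.prodMk measurable_collide
  have h3 := h2.comp_measurable hm
  exact StronglyMeasurable.integral_prod_right' h3

theorem norm_meanIncrement_le (hd : 2 ≤ d) {r : ℝ} (hr₀ : 0 < r) (hr₁ : r < 1)
    {γbar : Measure ℝ} (hM : M.IsMaxwellianWith γbar)
    (hκ : IntegrableOn (kappaDensity r) (Ioc 0 Real.pi) γbar) (p : Vel d × Vel d) :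
    ‖M.meanIncrement r p‖ ≤ (collisionConst d r *
      ∫ z, -kappaDensity r z.1 ∂(outcome d γbar)) * ‖p.2 - p.1‖ ^ r := by
  have hsf := sigmaFinite_restrict hr₀ hr₁ hκ
  rw [meanIncrement_eq hd hr₀ hr₁ hM hκ, mul_right_comm, ← integral_const_mul]
  refine norm_integral_le_of_norm_le ((integrable_outcome
    (integrable_kappaDensity hκ)).const_mul _) ?_
  filter_upwards [ae_outcome] with z hz
  exact norm_increment_collide_le (by omega) hr₀ hr₁ p hz

theorem norm_sub_rpow_le {r : ℝ} (hr₀ : 0 < r) (hr₁ : r < 1) (v w : Vel d) :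
    ‖w - v‖ ^ r ≤ ‖v‖ ^ r + ‖w‖ ^ r := by
  calc _ ≤ (‖v‖ + ‖w‖) ^ r :=
        Real.rpow_le_rpow (norm_nonneg _) ((norm_sub_le w v).trans (add_comm _ _).le) hr₀.le
    _ ≤ _ := Real.rpow_add_le_add_rpow (norm_nonneg _) (norm_nonneg _) hr₀.le hr₁.le

theorem integrable_norm_sub_rpow {r : ℝ} (hr₀ : 0 < r) (hr₁ : r < 1) (v : Vel d)
    {ν : Measure (Vel d)} (hν : ν ∈ probMoment d r) : Integrable (fun w => ‖w - v‖ ^ r) ν := by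
  have := hν.1
  refine Integrable.mono' ((integrable_const (‖v‖ ^ r)).add hν.2)
    (Measurable.aestronglyMeasurable (by fun_prop)) (Filter.Eventually.of_forall fun w => ?_)
  rw [Real.norm_of_nonneg (by positivity)]
  exact norm_sub_rpow_le hr₀ hr₁ v w

theorem integrable_meanIncrement (hd : 2 ≤ d) {r : ℝ} (hr₀ : 0 < r) (hr₁ : r < 1)
    {γbar : Measure ℝ} (hM : M.IsMaxwellianWith γbar)
    (hκ : IntegrableOn (kappaDensity r) (Ioc 0 Real.pi) γbar) {μ ν : Measure (Vel d)}
    (hμ : μ ∈ probMoment d r) (hν : ν ∈ probMoment d r) :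
    Integrable (M.meanIncrement r) (μ.prod ν) := by
  have := hμ.1
  have := hν.1
  have h1 : Integrable (fun p : Vel d × Vel d => ‖p.1‖ ^ r + ‖p.2‖ ^ r) (μ.prod ν) :=
    (hμ.2.comp_fst ν).add (hν.2.comp_snd μ)
  refine Integrable.mono' (h1.const_mul (collisionConst d r *
      ∫ z, -kappaDensity r z.1 ∂(outcome d γbar)))
    (stronglyMeasurable_meanIncrement hd hr₀ hr₁ hM hκ).aestronglyMeasurable
    (Filter.Eventually.of_forall fun p => ?_)
  refine (norm_meanIncrement_le hd hr₀ hr₁ hM hκ p).trans ?_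
  have hsf := sigmaFinite_restrict hr₀ hr₁ hκ
  refine mul_le_mul_of_nonneg_left (norm_sub_rpow_le hr₀ hr₁ p.1 p.2)
    (mul_nonneg (collisionConst_nonneg hr₁) (integral_nonneg_of_ae ?_))
  filter_upwards [ae_outcome] with z hz
  exact neg_nonneg.2 (kappaDensity_nonpos hr₀ hr₁ hz)

theorem integrable_meanIncrement_right (hd : 2 ≤ d) {r : ℝ} (hr₀ : 0 < r) (hr₁ : r < 1)
    {γbar : Measure ℝ} (hM : M.IsMaxwellianWith γbar)
    (hκ : IntegrableOn (kappaDensity r) (Ioc 0 Real.pi) γbar) (v : Vel d) {ν : Measure (Vel d)}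
    (hν : ν ∈ probMoment d r) : Integrable (fun w => M.meanIncrement r (v, w)) ν := by
  refine Integrable.mono' ((integrable_norm_sub_rpow hr₀ hr₁ v hν).const_mul
    (collisionConst d r * ∫ z, -kappaDensity r z.1 ∂(outcome d γbar)))
    ((stronglyMeasurable_meanIncrement hd hr₀ hr₁ hM hκ).comp_measurable
      measurable_prodMk_left).aestronglyMeasurable
    (Filter.Eventually.of_forall fun w => norm_meanIncrement_le hd hr₀ hr₁ hM hκ (v, w))

theorem qWellDefined (hd : 2 ≤ d) {r : ℝ} (hr₀ : 0 < r) (hr₁ : r < 1)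
    {γbar : Measure ℝ} (hM : M.IsMaxwellianWith γbar)
    (hκ : IntegrableOn (kappaDensity r) (Ioc 0 Real.pi) γbar) : M.QWellDefined r :=
  ⟨fun μ ν _ _ h hμ hν => memLp_fourierMeas_sub (by omega) hr₀ hr₁ μ ν h hμ hν,
    integrable_increment (by omega) hr₀ hr₁ hM hκ,
    fun _ hμ _ hν => integrable_meanIncrement hd hr₀ hr₁ hM hκ hμ hν⟩

end CollisionModel

/-! ### Density of the measures of mass zero -/

theorem charFun_withDensity {W : Measure (Vel d)} {f : Vel d → ℝ} (hf : Measurable f)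
    (x : Vel d) :
    charFun (W.withDensity fun ξ => ENNReal.ofReal (f ξ)) x =
      ∫ ξ, ((max (f ξ) 0 : ℝ) : ℂ) * Complex.exp ((inner ℝ ξ x : ℝ) * Complex.I) ∂W := by
  rw [charFun_apply, integral_withDensity_eq_integral_toReal_smul (by fun_prop) (by simp)]
  simp only [ENNReal.toReal_ofReal', Complex.real_smul]

/-- An integrable real function is determined by its Fourier transform. -/
theorem ae_eq_zero_of_integral_exp_real {W : Measure (Vel d)} [SFinite W] {f : Vel d → ℝ}
    (hf : Measurable f) (hfi : Integrable f W)
    (h : ∀ x : Vel d, ∫ ξ, (f ξ : ℂ) * Complex.exp ((inner ℝ ξ x : ℝ) * Complex.I) ∂W = 0) :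
    f =ᵐ[W] 0 := by
  have hfin : ∀ g : Vel d → ℝ, Integrable g W → ∫⁻ ξ, ENNReal.ofReal (g ξ) ∂W ≠ ∞ := fun g hg =>
    hg.lintegral_lt_top.ne
  have h1 : IsFiniteMeasure (W.withDensity fun ξ => ENNReal.ofReal (f ξ)) :=
    isFiniteMeasure_withDensity (hfin f hfi)
  have h2 : IsFiniteMeasure (W.withDensity fun ξ => ENNReal.ofReal (-f ξ)) :=
    isFiniteMeasure_withDensity (hfin _ hfi.neg)
  have hi : ∀ g : Vel d → ℝ, Integrable g W → ∀ x : Vel d, Integrable (fun ξ =>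
      ((max (g ξ) 0 : ℝ) : ℂ) * Complex.exp ((inner ℝ ξ x : ℝ) * Complex.I)) W := by
    intro g hg x
    refine Integrable.mul_bdd (c := 1) hg.pos_part.ofReal (by fun_prop)
      (Filter.Eventually.of_forall fun ξ => ?_)
    rw [Complex.norm_exp_ofReal_mul_I]
  have h3 : (W.withDensity fun ξ => ENNReal.ofReal (f ξ)) =
      W.withDensity fun ξ => ENNReal.ofReal (-f ξ) := by
    refine Measure.ext_of_charFun (funext fun x => ?_)
    rw [charFun_withDensity hf, charFun_withDensity (f := fun ξ => -f ξ) hf.neg, ← sub_eq_zero,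
      ← integral_sub (hi f hfi x) (hi (fun ξ => -f ξ) hfi.neg x), ← h x]
    congr 1
    ext1 ξ
    rw [← sub_mul, ← Complex.ofReal_sub]
    congr 2
    rcases le_total (f ξ) 0 with h4 | h4
    · rw [max_eq_right h4, max_eq_left (by linarith)]; ring
    · rw [max_eq_left h4, max_eq_right (by linarith)]; ring
  rw [withDensity_eq_iff (by fun_prop) (by fun_prop) (hfin f hfi)] at h3
  filter_upwards [h3] with ξ h4
  rcases le_total (f ξ) 0 with h5 | h5
  · rw [ENNReal.ofReal_of_nonpos h5] at h4
    have := ENNReal.ofReal_eq_zero.1 h4.symm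
    simp only [Pi.zero_apply]
    linarith
  · rw [ENNReal.ofReal_of_nonpos (by linarith : -f ξ ≤ 0)] at h4
    have := ENNReal.ofReal_eq_zero.1 h4
    simp only [Pi.zero_apply]
    linarith

/-- An integrable function is determined by its Fourier transform. -/
theorem ae_eq_zero_of_integral_exp {W : Measure (Vel d)} [SFinite W] {f : Vel d → ℂ}
    (hf : Measurable f) (hfi : Integrable f W)
    (h : ∀ x : Vel d, ∫ ξ, f ξ * Complex.exp ((inner ℝ ξ x : ℝ) * Complex.I) ∂W = 0) :
    f =ᵐ[W] 0 := by
  have hb : ∀ x : Vel d, ∀ g : Vel d → ℂ, Integrable g W →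
      Integrable (fun ξ => g ξ * Complex.exp ((inner ℝ ξ x : ℝ) * Complex.I)) W := by
    intro x g hg
    refine Integrable.mul_bdd (c := 1) hg (by fun_prop) (Filter.Eventually.of_forall fun ξ => ?_)
    rw [Complex.norm_exp_ofReal_mul_I]
  have hc : ∀ x : Vel d, ∫ ξ, (starRingEnd ℂ) (f ξ) *
      Complex.exp ((inner ℝ ξ x : ℝ) * Complex.I) ∂W = 0 := by
    intro x
    have h1 := congrArg (starRingEnd ℂ) (h (-x))
    rw [← integral_conj, map_zero] at h1
    rw [← h1]
    congr 1
    ext1 ξ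
    rw [map_mul, ← Complex.exp_conj, map_mul, Complex.conj_ofReal, Complex.conj_I,
      inner_neg_right]
    push_cast
    ring_nf
  have hfc : Integrable (fun ξ => (starRingEnd ℂ) (f ξ)) W :=
    (LinearIsometryEquiv.integrable_comp_iff Complex.conjLIE).2 hfi
  have hre : (fun ξ => (f ξ).re) =ᵐ[W] 0 := by
    refine ae_eq_zero_of_integral_exp_real (by fun_prop) hfi.re fun x => ?_
    have h1 : ∀ ξ : Vel d, ((f ξ).re : ℂ) * Complex.exp ((inner ℝ ξ x : ℝ) * Complex.I) =
        2⁻¹ * (f ξ * Complex.exp ((inner ℝ ξ x : ℝ) * Complex.I) +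
          (starRingEnd ℂ) (f ξ) * Complex.exp ((inner ℝ ξ x : ℝ) * Complex.I)) := by
      intro ξ
      rw [Complex.re_eq_add_conj]
      ring
    simp_rw [h1]
    rw [integral_const_mul, integral_add (hb x _ hfi) (hb x _ hfc), h, hc]
    simp
  have him : (fun ξ => (f ξ).im) =ᵐ[W] 0 := by
    refine ae_eq_zero_of_integral_exp_real (by fun_prop) hfi.im fun x => ?_
    have h1 : ∀ ξ : Vel d, ((f ξ).im : ℂ) * Complex.exp ((inner ℝ ξ x : ℝ) * Complex.I) =
        (2 * Complex.I)⁻¹ * (f ξ * Complex.exp ((inner ℝ ξ x : ℝ) * Complex.I) -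
          (starRingEnd ℂ) (f ξ) * Complex.exp ((inner ℝ ξ x : ℝ) * Complex.I)) := by
      intro ξ
      rw [Complex.im_eq_sub_conj]
      ring
    simp_rw [h1]
    rw [integral_const_mul, integral_sub (hb x _ hfi) (hb x _ hfc), h, hc]
    simp
  filter_upwards [hre, him] with ξ h1 h2
  exact Complex.ext h1 h2

theorem dirac_mem_probMoment {r : ℝ} (x : Vel d) : Measure.dirac x ∈ probMoment d r :=
  ⟨inferInstance, integrable_dirac (by simp)⟩

/-- The differences of two point masses already span a dense subspace: the product of an
orthogonal element with `1 - e^{i ξ·a}` is integrable and its Fourier transform vanishes. -/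
theorem dense_zeroMass (hd : 0 < d) {r : ℝ} (hr₀ : 0 < r) (hr₁ : r < 1) :
    Dense (zeroMass d r : Set (Hdot d (d / 2 + r))) := by
  have : Nonempty (Fin d) := ⟨⟨0, hd⟩⟩
  have hnull : sobolevWeight d (d / 2 + r) {0} = 0 :=
    withDensity_absolutelyContinuous _ _ (measure_singleton _)
  rw [Submodule.dense_iff_topologicalClosure_eq_top, Submodule.topologicalClosure_eq_top_iff,
    Submodule.eq_bot_iff]
  intro g hg
  rw [Submodule.mem_orthogonal] at hg
  have hgm : Measurable g := (Lp.stronglyMeasurable g).measurable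
  have hinner : ∀ (x y : Vel d), (fun ξ => inner ℂ (ofDiff (d / 2 + r) (Measure.dirac x)
      (Measure.dirac y) ξ) (g ξ)) =ᵐ[sobolevWeight d (d / 2 + r)]
        fun ξ => (fourierConst d : ℂ) * (g ξ * (starRingEnd ℂ) (wave ξ x - wave ξ y)) := by
    intro x y
    filter_upwards [pointDiff_coeFn hd hr₀ hr₁ x y] with ξ h1
    rw [h1, RCLike.inner_apply, map_mul, Complex.conj_ofReal]
    ring
  have hc0 : (fourierConst d : ℂ) ≠ 0 := Complex.ofReal_ne_zero.2 fourierConst_pos.ne'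
  have key : ∀ a : Vel d, (fun ξ => g ξ * (starRingEnd ℂ) (wave ξ a - 1))
      =ᵐ[sobolevWeight d (d / 2 + r)] 0 := by
    intro a
    refine ae_eq_zero_of_integral_exp ?_ ?_ fun x => ?_
    · have : Measurable (starRingEnd ℂ) := Complex.continuous_conj.measurable
      fun_prop
    · have h1 := (L2.integrable_inner (𝕜 := ℂ)
        (ofDiff (d / 2 + r) (Measure.dirac a) (Measure.dirac 0)) g).congr (hinner a 0)
      simp only [wave_zero] at h1
      exact (integrable_const_mul_iff (IsUnit.mk0 _ hc0) _).1 h1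
    · have h1 := hg (ofDiff (d / 2 + r) (Measure.dirac (x + a)) (Measure.dirac x))
        (Submodule.subset_span ⟨_, dirac_mem_probMoment _, _, dirac_mem_probMoment _, rfl⟩)
      rw [L2.inner_def, integral_congr_ae (hinner _ _), integral_const_mul] at h1
      rw [← (mul_eq_zero.1 h1).resolve_left hc0]
      congr 1
      ext1 ξ
      have h2 : Complex.exp ((inner ℝ ξ x : ℝ) * Complex.I) = (starRingEnd ℂ) (wave ξ x) := by
        rw [wave, ← Complex.exp_conj, map_mul, map_neg, Complex.conj_I, Complex.conj_ofReal]
        ring_nf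
      rw [h2, mul_assoc, ← map_mul, wave_add]
      ring_nf
  rw [Lp.eq_zero_iff_ae_eq_zero]
  have h0 : ∀ᵐ x ∂(sobolevWeight d (d / 2 + r)), x ∈ ({0}ᶜ : Set (Vel d)) :=
    compl_mem_ae_iff.2 hnull
  have hall := ae_all_iff.2 fun n => key (TopologicalSpace.denseSeq (Vel d) n)
  filter_upwards [hall, h0] with ξ h1 h2
  by_contra h3
  have h4 : ∀ a, wave ξ a = 1 := by
    have h5 : ∀ n, wave ξ (TopologicalSpace.denseSeq (Vel d) n) = 1 := by
      intro n
      have h6 := (mul_eq_zero.1 (h1 n)).resolve_left h3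
      exact sub_eq_zero.1 ((map_eq_zero _).1 h6)
    have h7 : (fun a => wave ξ a) = fun _ => 1 :=
      (TopologicalSpace.denseRange_denseSeq (Vel d)).equalizer (by fun_prop) (by fun_prop)
        (funext h5)
    exact congrFun h7
  -- At this point the plane wave of frequency `ξ` takes the value `-1`.
  have h8 := h4 ((Real.pi / ‖ξ‖ ^ 2) • ξ)
  have h9 : ‖ξ‖ ^ 2 ≠ 0 := by simpa using h2
  rw [wave, inner_smul_right, real_inner_self_eq_norm_sq, div_mul_cancel₀ _ h9, neg_mul,
    Complex.exp_neg, mul_comm, Complex.exp_pi_mul_I] at h8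
  norm_num at h8

/-! ### Dissipative operators given on a spanning family -/

/-- A densely defined linear relation `{(L c, D c)}` whose quadratic form is bounded above is
single-valued: if `L c = 0`, adding multiples of `c` to `c'` changes `⟨D c', L c'⟩` linearly
without changing `L c'`, so that `D c` is orthogonal to the range of `L`. -/
theorem eq_zero_of_dissipative {V H : Type*} [AddCommGroup V] [Module ℂ V]
    [NormedAddCommGroup H] [InnerProductSpace ℂ H] (L D : V →ₗ[ℂ] H) (κ : ℝ)
    (hdense : Dense (LinearMap.range L : Set H))
    (h : ∀ c, (inner ℂ (D c) (L c)).re ≤ -κ * ‖L c‖ ^ 2) {c : V} (hc : L c = 0) : D c = 0 := by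
  have h1 : ∀ c', (inner ℂ (D c) (L c')).re = 0 := by
    intro c'
    have h2 : ∀ t : ℝ, t * (inner ℂ (D c) (L c')).re ≤
        -κ * ‖L c'‖ ^ 2 - (inner ℂ (D c') (L c')).re := by
      intro t
      have h3 := h (c' + (t : ℂ) • c)
      rw [map_add, map_add, map_smul, map_smul, hc, smul_zero, add_zero, inner_add_left,
        inner_smul_left, Complex.add_re, Complex.conj_ofReal, Complex.re_ofReal_mul] at h3
      linarith
    by_contra h4
    have h5 := h2 ((-κ * ‖L c'‖ ^ 2 - (inner ℂ (D c') (L c')).re + 1) /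
      (inner ℂ (D c) (L c')).re)
    rw [div_mul_cancel₀ _ h4] at h5
    linarith
  have h6 : ∀ x : H, (inner ℂ (D c) x).re = 0 := by
    intro x
    refine hdense.induction (P := fun x => (inner ℂ (D c) x).re = 0) ?_ ?_ x
    · rintro _ ⟨c', rfl⟩
      exact h1 c'
    · exact isClosed_eq (by fun_prop) continuous_const
  have h7 := h6 (D c)
  rw [inner_self_eq_norm_sq_to_K] at h7
  have h8 : ‖D c‖ ^ 2 = 0 := by
    rw [← h7]
    norm_cast
  simpa using h8

/-! ### The linearized operator at a fixed deviation angle -/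

theorem lintegral_tilt_swap (hd : 2 ≤ d) (s : ℝ) {a b : ℝ} (hab : a ^ 2 + b ^ 2 = 1)
    {ψ : Vel d → ℝ≥0∞} (hψ : Measurable ψ) :
    ∫⁻ p, ψ (tilt a b p.2 p.1) ∂((gauss d).prod (sobolevWeight d s)) =
      ∫⁻ ξ, ψ ξ ∂(sobolevWeight d s) := by
  rw [← lintegral_tilt hd s hab hψ, ← lintegral_prod_swap]
  rfl

/-- Contracting by `t` after a random tilt multiplies the norm of `Ḣ^{-s}` by `t ^ r`. -/
theorem lintegral_smul_tilt (hd : 2 ≤ d) {r t : ℝ} (ht : 0 < t) {a b : ℝ}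
    (hab : a ^ 2 + b ^ 2 = 1) {h h' : Hdot d (d / 2 + r)} {G : Vel d → ℂ} (hG : Measurable G)
    (hhG : h =ᵐ[sobolevWeight d (d / 2 + r)] G) :
    ∫⁻ p, ‖h' p.2‖ₑ * ‖G (t • tilt a b p.2 p.1)‖ₑ
        ∂((gauss d).prod (sobolevWeight d (d / 2 + r))) ≤
      ‖h'‖ₑ * (ENNReal.ofReal (t ^ r) * ‖h‖ₑ) := by
  have hh' : Measurable h' := (Lp.stronglyMeasurable h').measurable
  refine lintegral_mul_le_of_sq_le _ (by fun_prop) (by fun_prop) (le_of_eq ?_) (le_of_eq ?_)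
  · rw [enorm_sq_eq_lintegral, lintegral_prod _ (by fun_prop)]
    simp
  · rw [lintegral_tilt_swap hd _ hab (ψ := fun ξ => ‖G (t • ξ)‖ₑ ^ 2) (by fun_prop),
      lintegral_comp_smul_sobolevWeight r ht (ψ := fun ξ => ‖G ξ‖ₑ ^ 2) (by fun_prop), mul_pow,
      enorm_sq_eq_lintegral, ← ENNReal.ofReal_pow (by positivity), ← Real.rpow_mul_natCast ht.le,
      mul_comm r]
    congr 1
    exact lintegral_congr_ae (hhG.mono fun ξ hξ => by dsimp only; rw [hξ])

theorem lintegral_fwd_le (hd : 2 ≤ d) {r θ : ℝ} (hθ : θ ∈ Ioo 0 Real.pi)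
    {h h' : Hdot d (d / 2 + r)} {G : Vel d → ℂ} (hG : Measurable G)
    (hhG : h =ᵐ[sobolevWeight d (d / 2 + r)] G) :
    ∫⁻ p, ‖h' p.2‖ₑ * ‖G (fwd θ p.2 p.1)‖ₑ ∂((gauss d).prod (sobolevWeight d (d / 2 + r))) ≤
      ‖h'‖ₑ * (ENNReal.ofReal (Real.cos (θ / 2) ^ r) * ‖h‖ₑ) := by
  simp_rw [fwd_eq]
  exact lintegral_smul_tilt hd (Real.cos_pos_of_mem_Ioo
    ⟨by linarith [hθ.1, Real.pi_pos], by linarith [hθ.2]⟩) (Real.cos_sq_add_sin_sq _) hG hhG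

theorem lintegral_bwd_le (hd : 2 ≤ d) {r θ : ℝ} (hθ : θ ∈ Ioo 0 Real.pi)
    {h h' : Hdot d (d / 2 + r)} {G : Vel d → ℂ} (hG : Measurable G)
    (hhG : h =ᵐ[sobolevWeight d (d / 2 + r)] G) :
    ∫⁻ p, ‖h' p.2‖ₑ * ‖G (bwd θ p.2 p.1)‖ₑ ∂((gauss d).prod (sobolevWeight d (d / 2 + r))) ≤
      ‖h'‖ₑ * (ENNReal.ofReal (Real.sin (θ / 2) ^ r) * ‖h‖ₑ) := by
  simp_rw [bwd_eq]
  refine lintegral_smul_tilt hd (Real.sin_pos_of_pos_of_lt_pi (by linarith [hθ.1])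
    (by linarith [hθ.1, hθ.2])) ?_ hG hhG
  rw [neg_sq, Real.sin_sq_add_cos_sq]

theorem lintegral_self_le {r : ℝ} {h h' : Hdot d (d / 2 + r)} {G : Vel d → ℂ} (hG : Measurable G)
    (hhG : h =ᵐ[sobolevWeight d (d / 2 + r)] G) :
    ∫⁻ p, ‖h' p.2‖ₑ * ‖G p.2‖ₑ ∂((gauss d).prod (sobolevWeight d (d / 2 + r))) ≤
      ‖h'‖ₑ * ‖h‖ₑ := by
  have hh' : Measurable h' := (Lp.stronglyMeasurable h').measurable
  refine lintegral_mul_le_of_sq_le _ (by fun_prop) (by fun_prop) (le_of_eq ?_) (le_of_eq ?_)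
  · rw [enorm_sq_eq_lintegral, lintegral_prod _ (by fun_prop)]
    simp
  · rw [enorm_sq_eq_lintegral, lintegral_prod _ (by fun_prop)]
    simp only [lintegral_const, measure_univ, mul_one]
    exact lintegral_congr_ae (hhG.mono fun ξ hξ => by dsimp only; rw [hξ])

/-- The Fourier transform of the image of `G` by the linearized collisions of the outcome `z`
against a particle of velocity `v`: a gain from each of the two outgoing particles, and a loss. -/
def gainLoss (v : Vel d) (G : Vel d → ℂ) (x : (ℝ × Vel d) × Vel d) : ℂ :=
  wave (bwd x.1.1 x.2 x.1.2) v * G (fwd x.1.1 x.2 x.1.2) +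
    wave (fwd x.1.1 x.2 x.1.2) v * G (bwd x.1.1 x.2 x.1.2) - G x.2

theorem measurable_gainLoss (v : Vel d) {G : Vel d → ℂ} (hG : Measurable G) :
    Measurable (gainLoss v G) := by
  unfold gainLoss; fun_prop

theorem enorm_wave (ξ x : Vel d) : ‖wave ξ x‖ₑ = 1 := by
  rw [← ofReal_norm, norm_wave, ENNReal.ofReal_one]

theorem enorm_inner_gainLoss_le (v : Vel d) (G : Vel d → ℂ) (x : (ℝ × Vel d) × Vel d) (a : ℂ) :
    ‖inner ℂ a (gainLoss v G x)‖ₑ ≤ ‖a‖ₑ * ‖G (fwd x.1.1 x.2 x.1.2)‖ₑ +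
      ‖a‖ₑ * ‖G (bwd x.1.1 x.2 x.1.2)‖ₑ + ‖a‖ₑ * ‖G x.2‖ₑ := by
  have h1 : ‖inner ℂ a (gainLoss v G x)‖ₑ = ‖a‖ₑ * ‖gainLoss v G x‖ₑ := by
    rw [RCLike.inner_apply, enorm_mul, RCLike.enorm_conj, mul_comm]
  rw [h1, ← mul_add, ← mul_add]
  gcongr
  rw [gainLoss]
  refine enorm_sub_le.trans (add_le_add_left ((enorm_add_le _ _).trans ?_) _)
  rw [enorm_mul, enorm_mul, enorm_wave, enorm_wave, one_mul, one_mul]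

theorem lintegral_gainLoss_le (hd : 2 ≤ d) {r θ : ℝ} (hr₀ : 0 < r) (hθ : θ ∈ Ioo 0 Real.pi)
    {h h' : Hdot d (d / 2 + r)} {G : Vel d → ℂ} (hG : Measurable G)
    (hhG : h =ᵐ[sobolevWeight d (d / 2 + r)] G) (v : Vel d) :
    ∫⁻ p, ‖inner ℂ (h' p.2) (gainLoss v G ((θ, p.1), p.2))‖ₑ
      ∂((gauss d).prod (sobolevWeight d (d / 2 + r))) ≤ 3 * (‖h'‖ₑ * ‖h‖ₑ) := by
  have hh' : Measurable h' := (Lp.stronglyMeasurable h').measurable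
  obtain ⟨hs, hc⟩ := half_angle_nonneg (Ioo_subset_Icc_self hθ)
  have h1 : ∀ t : ℝ, 0 ≤ t → t ≤ 1 →
      ‖h'‖ₑ * (ENNReal.ofReal (t ^ r) * ‖h‖ₑ) ≤ ‖h'‖ₑ * ‖h‖ₑ := by
    intro t ht ht1
    gcongr
    refine mul_le_of_le_one_left' ?_
    rw [← ENNReal.ofReal_one]
    exact ENNReal.ofReal_le_ofReal (Real.rpow_le_one ht ht1 hr₀.le)
  calc _ ≤ ∫⁻ p, (‖h' p.2‖ₑ * ‖G (fwd θ p.2 p.1)‖ₑ + ‖h' p.2‖ₑ * ‖G (bwd θ p.2 p.1)‖ₑ +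
        ‖h' p.2‖ₑ * ‖G p.2‖ₑ) ∂((gauss d).prod (sobolevWeight d (d / 2 + r))) :=
        lintegral_mono fun p => enorm_inner_gainLoss_le v G ((θ, p.1), p.2) (h' p.2)
    _ ≤ ‖h'‖ₑ * ‖h‖ₑ + ‖h'‖ₑ * ‖h‖ₑ + ‖h'‖ₑ * ‖h‖ₑ := by
        rw [lintegral_add_left (by fun_prop), lintegral_add_left (by fun_prop)]
        exact add_le_add (add_le_add
          ((lintegral_fwd_le hd hθ hG hhG).trans (h1 _ hc (Real.cos_le_one _)))
          ((lintegral_bwd_le hd hθ hG hhG).trans (h1 _ hs (Real.sin_le_one _))))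
          (lintegral_self_le hG hhG)
    _ = _ := by ring

/-- The quadratic form of the linearized operator at a fixed deviation angle: the gain terms
are bounded by the contractions `cos (θ/2) ^ r` and `sin (θ/2) ^ r`, the loss is exactly
`-‖h‖²`. -/
theorem integral_gainLoss_re_le (hd : 2 ≤ d) {r θ : ℝ} (hr₀ : 0 < r) (hθ : θ ∈ Ioo 0 Real.pi)
    {h : Hdot d (d / 2 + r)} {G : Vel d → ℂ} (hG : Measurable G)
    (hhG : h =ᵐ[sobolevWeight d (d / 2 + r)] G) (v : Vel d) :
    ∫ p, (inner ℂ (h p.2) (gainLoss v G ((θ, p.1), p.2))).re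
      ∂((gauss d).prod (sobolevWeight d (d / 2 + r))) ≤ -kappaDensity r θ * ‖h‖ ^ 2 := by
  have hh : Measurable h := (Lp.stronglyMeasurable h).measurable
  have hgl := measurable_gainLoss v hG
  set ρ := (gauss d).prod (sobolevWeight d (d / 2 + r)) with hρ
  obtain ⟨hs, hc⟩ := half_angle_nonneg (Ioo_subset_Icc_self hθ)
  have hint : ∀ F : Vel d × Vel d → ℂ, Measurable F → ∀ C : ℝ, 0 ≤ C →
      ∫⁻ p, ‖h p.2‖ₑ * ‖F p‖ₑ ∂ρ ≤ ‖h‖ₑ * (ENNReal.ofReal C * ‖h‖ₑ) →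
      Integrable (fun p => ‖h p.2‖ * ‖F p‖) ρ ∧ ∫ p, ‖h p.2‖ * ‖F p‖ ∂ρ ≤ C * ‖h‖ ^ 2 := by
    intro F hF C hC hle
    have e1 : ∀ p, ENNReal.ofReal (‖h p.2‖ * ‖F p‖) = ‖h p.2‖ₑ * ‖F p‖ₑ := fun p => by
      rw [ENNReal.ofReal_mul (norm_nonneg _), ofReal_norm, ofReal_norm]
    have e2 : ‖h‖ₑ * (ENNReal.ofReal C * ‖h‖ₑ) = ENNReal.ofReal (C * ‖h‖ ^ 2) := by
      rw [ENNReal.ofReal_mul hC, ENNReal.ofReal_pow (norm_nonneg _), ofReal_norm]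
      ring
    constructor
    · refine ⟨Measurable.aestronglyMeasurable (by fun_prop), ?_⟩
      rw [hasFiniteIntegral_iff_ofReal (Filter.Eventually.of_forall fun p => by positivity)]
      simp_rw [e1]
      exact hle.trans_lt (e2 ▸ ENNReal.ofReal_lt_top)
    · rw [integral_eq_lintegral_of_nonneg_ae (Filter.Eventually.of_forall fun p => by positivity)
        (Measurable.aestronglyMeasurable (by fun_prop))]
      simp_rw [e1]
      exact ENNReal.toReal_le_of_le_ofReal (by positivity) (hle.trans_eq e2)
  obtain ⟨i1, l1⟩ := hint (fun p => G (fwd θ p.2 p.1)) (by fun_prop) _ (by positivity)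
    (lintegral_fwd_le hd hθ hG hhG)
  obtain ⟨i2, l2⟩ := hint (fun p => G (bwd θ p.2 p.1)) (by fun_prop) _ (by positivity)
    (lintegral_bwd_le hd hθ hG hhG)
  have hhG' : ∀ᵐ p ∂ρ, h p.2 = G p.2 := Measure.quasiMeasurePreserving_snd.ae hhG
  have i3 : Integrable (fun p : Vel d × Vel d => ‖h p.2‖ ^ 2) ρ := by
    have h1 := (hint (fun p => h p.2) (by fun_prop) 1 zero_le_one
      ((lintegral_self_le hh (Filter.EventuallyEq.refl _ _)).trans (by simp))).1
    simpa only [sq] using h1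
  have l3 : ∫ p, ‖h p.2‖ ^ 2 ∂ρ = ‖h‖ ^ 2 := by
    rw [integral_eq_lintegral_of_nonneg_ae (Filter.Eventually.of_forall fun p => by positivity)
        (Measurable.aestronglyMeasurable (by fun_prop)), lintegral_prod _ (by fun_prop)]
    simp only [lintegral_const, measure_univ, mul_one, ENNReal.ofReal_pow (norm_nonneg _),
      ofReal_norm]
    rw [← enorm_sq_eq_lintegral, ← ofReal_norm, ← ENNReal.ofReal_pow (norm_nonneg _),
      ENNReal.toReal_ofReal (by positivity)]
  have hle : ∀ᵐ p ∂ρ, (inner ℂ (h p.2) (gainLoss v G ((θ, p.1), p.2))).re ≤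
      ‖h p.2‖ * ‖G (fwd θ p.2 p.1)‖ + ‖h p.2‖ * ‖G (bwd θ p.2 p.1)‖ - ‖h p.2‖ ^ 2 := by
    filter_upwards [hhG'] with p hp
    have e3 : (inner ℂ (h p.2) (G p.2)).re = ‖h p.2‖ ^ 2 := by
      rw [← hp, inner_self_eq_norm_sq_to_K]
      norm_cast
    have e4 : ∀ w b : ℂ, ‖w‖ = 1 → (inner ℂ (h p.2) (w * b)).re ≤ ‖h p.2‖ * ‖b‖ := by
      intro w b hw
      refine (Complex.re_le_norm _).trans ((norm_inner_le_norm _ _).trans ?_)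
      rw [norm_mul, hw, one_mul]
    rw [gainLoss, inner_sub_right, inner_add_right, Complex.sub_re, Complex.add_re, e3]
    have := e4 _ (G (fwd θ p.2 p.1)) (norm_wave (bwd θ p.2 p.1) v)
    have := e4 _ (G (bwd θ p.2 p.1)) (norm_wave (fwd θ p.2 p.1) v)
    linarith
  have hi : Integrable (fun p : Vel d × Vel d =>
      (inner ℂ (h p.2) (gainLoss v G ((θ, p.1), p.2))).re) ρ := by
    have hm : Measurable fun p : Vel d × Vel d =>
        inner ℂ (h p.2) (gainLoss v G ((θ, p.1), p.2)) := by fun_prop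
    refine Integrable.re (𝕜 := ℂ) ⟨hm.aestronglyMeasurable, ?_⟩
    rw [hasFiniteIntegral_iff_enorm]
    exact (lintegral_gainLoss_le hd hr₀ hθ hG hhG v).trans_lt (by finiteness)
  have i12 : Integrable (fun p : Vel d × Vel d =>
      ‖h p.2‖ * ‖G (fwd θ p.2 p.1)‖ + ‖h p.2‖ * ‖G (bwd θ p.2 p.1)‖) ρ := i1.add i2
  calc _ ≤ ∫ p, (‖h p.2‖ * ‖G (fwd θ p.2 p.1)‖ + ‖h p.2‖ * ‖G (bwd θ p.2 p.1)‖ - ‖h p.2‖ ^ 2)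
        ∂ρ := integral_mono_ae hi (i12.sub i3) hle
    _ = ∫ p, ‖h p.2‖ * ‖G (fwd θ p.2 p.1)‖ ∂ρ + ∫ p, ‖h p.2‖ * ‖G (bwd θ p.2 p.1)‖ ∂ρ -
        ‖h‖ ^ 2 := by
        rw [integral_sub i12 i3, l3, ← integral_add i1 i2]
    _ ≤ _ := by
        rw [kappaDensity]
        linarith

/-! ### Integration over the outcomes -/

variable {r : ℝ} {γbar : Measure ℝ}

theorem integral_kappaDensity (hr₀ : 0 < r) :
    ∫ θ in Ioo 0 Real.pi, kappaDensity r θ ∂γbar =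
      ∫ θ in Ioc 0 Real.pi, kappaDensity r θ ∂γbar := by
  symm
  refine setIntegral_eq_of_subset_of_forall_sdiff_eq_zero measurableSet_Ioc Ioo_subset_Ioc_self ?_
  intro θ hθ
  exact kappaDensity_eq_zero hr₀ (Ioc_subset_Icc_self hθ.1) hθ.2

theorem measurePreserving_outcome (s : ℝ) [SFinite (γbar.restrict (Ioo 0 Real.pi))] :
    MeasurePreserving (fun x : ℝ × (Vel d × Vel d) => ((x.1, x.2.1), x.2.2))
      ((γbar.restrict (Ioo 0 Real.pi)).prod ((gauss d).prod (sobolevWeight d s)))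
      ((outcome d γbar).prod (sobolevWeight d s)) :=
  (measurePreserving_prodAssoc (γbar.restrict (Ioo 0 Real.pi)) (gauss d)
    (sobolevWeight d s)).symm

theorem measurableEmbedding_assoc :
    MeasurableEmbedding (fun x : ℝ × (Vel d × Vel d) => ((x.1, x.2.1), x.2.2)) :=
  (MeasurableEquiv.prodAssoc (α := ℝ) (β := Vel d) (γ := Vel d)).symm.measurableEmbedding

theorem integral_outcome_gainLoss_re_le (hd : 2 ≤ d) (hr₀ : 0 < r) (hr₁ : r < 1)
    (hκ : IntegrableOn (kappaDensity r) (Ioc 0 Real.pi) γbar)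
    {h : Hdot d (d / 2 + r)} {G : Vel d → ℂ} (hG : Measurable G)
    (hhG : h =ᵐ[sobolevWeight d (d / 2 + r)] G) (v : Vel d)
    (hint : Integrable (fun x => inner ℂ (h x.2) (gainLoss v G x))
      ((outcome d γbar).prod (sobolevWeight d (d / 2 + r)))) :
    ∫ x, (inner ℂ (h x.2) (gainLoss v G x)).re
      ∂((outcome d γbar).prod (sobolevWeight d (d / 2 + r))) ≤
      -(∫ θ in Ioc 0 Real.pi, kappaDensity r θ ∂γbar) * ‖h‖ ^ 2 := by
  have hsf := sigmaFinite_restrict hr₀ hr₁ hκ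
  have hmp := measurePreserving_outcome (d := d) (γbar := γbar) (d / 2 + r)
  have hre : Integrable (fun x => (inner ℂ (h x.2) (gainLoss v G x)).re)
    ((outcome d γbar).prod (sobolevWeight d (d / 2 + r))) := hint.re
  have hre' : Integrable (fun x : ℝ × (Vel d × Vel d) =>
      (inner ℂ (h x.2.2) (gainLoss v G ((x.1, x.2.1), x.2.2))).re)
      ((γbar.restrict (Ioo 0 Real.pi)).prod ((gauss d).prod (sobolevWeight d (d / 2 + r)))) :=
    (hmp.integrable_comp_emb measurableEmbedding_assoc).2 hre
  rw [← hmp.integral_comp measurableEmbedding_assoc, integral_prod _ hre',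
    ← integral_kappaDensity hr₀, ← integral_neg, ← integral_mul_const]
  refine integral_mono_ae hre'.integral_prod_left
    ((integrable_kappaDensity hκ).mul_const _) ?_
  filter_upwards [ae_restrict_mem measurableSet_Ioo] with θ hθ
  exact integral_gainLoss_re_le hd hr₀ hθ hG hhG v

theorem enorm_integral_outcome_gainLoss_le (hd : 2 ≤ d) (hr₀ : 0 < r) (hr₁ : r < 1)
    (hκ : IntegrableOn (kappaDensity r) (Ioc 0 Real.pi) γbar)
    {h h' : Hdot d (d / 2 + r)} {G : Vel d → ℂ} (hG : Measurable G)
    (hhG : h =ᵐ[sobolevWeight d (d / 2 + r)] G) (v : Vel d) :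
    ‖∫ x, inner ℂ (h' x.2) (gainLoss v G x)
      ∂((outcome d γbar).prod (sobolevWeight d (d / 2 + r)))‖ₑ ≤
      γbar univ * (3 * (‖h'‖ₑ * ‖h‖ₑ)) := by
  have hsf := sigmaFinite_restrict hr₀ hr₁ hκ
  have hh' : Measurable h' := (Lp.stronglyMeasurable h').measurable
  have hgl := measurable_gainLoss v hG
  have hm : Measurable fun x : (ℝ × Vel d) × Vel d => ‖inner ℂ (h' x.2) (gainLoss v G x)‖ₑ := by
    fun_prop
  refine (enorm_integral_le_lintegral_enorm _).trans ?_
  rw [← (measurePreserving_outcome (d := d) (γbar := γbar) (d / 2 + r)).lintegral_comp hm,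
    lintegral_prod _ (by fun_prop)]
  calc _ ≤ ∫⁻ _, 3 * (‖h'‖ₑ * ‖h‖ₑ) ∂(γbar.restrict (Ioo 0 Real.pi)) := by
        refine lintegral_mono_ae ?_
        filter_upwards [ae_restrict_mem measurableSet_Ioo] with θ hθ
        exact lintegral_gainLoss_le hd hr₀ hθ hG hhG v
    _ ≤ _ := by
        rw [lintegral_const, mul_comm]
        gcongr
        exact Measure.restrict_le_self

/-! ### Complex combinations of differences of probability measures -/

/-- The pairs of probability measures having a moment of order `r`. -/
abbrev MeasPair (d : ℕ) (r : ℝ) : Type :=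
  {x : Measure (Vel d) × Measure (Vel d) // x.1 ∈ probMoment d r ∧ x.2 ∈ probMoment d r}

/-- The element of `Ḣ^{-s}` defined by a formal combination of differences of probability
measures. -/
def combine (d : ℕ) (r : ℝ) : (MeasPair d r →₀ ℂ) →ₗ[ℂ] Hdot d (d / 2 + r) :=
  Finsupp.linearCombination ℂ fun x => ofDiff (d / 2 + r) x.1.1 x.1.2

/-- The Fourier transform, defined everywhere, of a formal combination. -/
def combineFourier (d : ℕ) (r : ℝ) : (MeasPair d r →₀ ℂ) →ₗ[ℂ] (Vel d → ℂ) :=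
  Finsupp.linearCombination ℂ fun x ξ => fourierMeas x.1.1 ξ - fourierMeas x.1.2 ξ

theorem range_combine : LinearMap.range (combine d r) = zeroMass d r := by
  rw [combine, Finsupp.range_linearCombination, zeroMass]
  congr 1
  ext h
  constructor
  · rintro ⟨x, rfl⟩
    exact ⟨x.1.1, x.2.1, x.1.2, x.2.2, rfl⟩
  · rintro ⟨μ, hμ, ν, hν, rfl⟩
    exact ⟨⟨(μ, ν), hμ, hν⟩, rfl⟩

theorem memLp_probMoment (hd : 0 < d) (hr₀ : 0 < r) (hr₁ : r < 1) {μ ν : Measure (Vel d)}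
    (hμ : μ ∈ probMoment d r) (hν : ν ∈ probMoment d r) :
    MemLp (fun ξ => fourierMeas μ ξ - fourierMeas ν ξ) 2 (sobolevWeight d (d / 2 + r)) := by
  have := hμ.1
  have := hν.1
  exact memLp_fourierMeas_sub hd hr₀ hr₁ μ ν (by simp) hμ.2 hν.2

theorem combine_coeFn (hd : 0 < d) (hr₀ : 0 < r) (hr₁ : r < 1) (c : MeasPair d r →₀ ℂ) :
    combine d r c =ᵐ[sobolevWeight d (d / 2 + r)] combineFourier d r c := by
  induction c using Finsupp.induction_linear with
  | zero =>
    rw [map_zero, map_zero]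
    exact Lp.coeFn_zero _ _ _
  | add c c' h h' =>
    rw [map_add, map_add]
    exact (Lp.coeFn_add _ _).trans (h.add h')
  | single x a =>
    rw [combine, combineFourier, Finsupp.linearCombination_single,
      Finsupp.linearCombination_single]
    exact (Lp.coeFn_smul _ _).trans
      ((ofDiff_coeFn (memLp_probMoment hd hr₀ hr₁ x.2.1 x.2.2)).const_smul a)

theorem measurable_combineFourier (c : MeasPair d r →₀ ℂ) :
    Measurable (combineFourier d r c) := by
  induction c using Finsupp.induction_linear with
  | zero =>
    rw [map_zero]
    exact measurable_const
  | add c c' h h' =>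
    rw [map_add]
    exact h.add h'
  | single x a =>
    rw [combineFourier, Finsupp.linearCombination_single]
    have := x.2.1.1
    have := x.2.2.1
    exact (((continuous_fourierMeas x.1.1).sub
      (continuous_fourierMeas x.1.2)).measurable).const_smul a

/-! ### The linearized collision operator -/

namespace CollisionModel

variable {M : CollisionModel d}

/-- The collisions of a particle of velocity `v` with a formal combination. -/
def linAt (M : CollisionModel d) (r : ℝ) (v : Vel d) :
    (MeasPair d r →₀ ℂ) →ₗ[ℂ] Hdot d (d / 2 + r) :=
  Finsupp.linearCombination ℂ fun x =>
    ∫ w, M.meanIncrement r (v, w) ∂x.1.1 - ∫ w, M.meanIncrement r (v, w) ∂x.1.2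

/-- The operator `2 Q(μ, ·)` on the formal combinations. -/
def linQ (M : CollisionModel d) (r : ℝ) (μ : Measure (Vel d)) :
    (MeasPair d r →₀ ℂ) →ₗ[ℂ] Hdot d (d / 2 + r) :=
  Finsupp.linearCombination ℂ fun x =>
    (2 : ℝ) • (M.Q (d / 2 + r) μ x.1.1 - M.Q (d / 2 + r) μ x.1.2)

theorem two_smul_Q (μ ν : Measure (Vel d)) :
    (2 : ℝ) • M.Q (d / 2 + r) μ ν = ∫ p, M.meanIncrement r p ∂(μ.prod ν) := by
  rw [Q, smul_smul]
  norm_num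
  rfl

theorem integral_dualKernel (v : Vel d) (ν : Measure (Vel d)) [IsProbabilityMeasure ν]
    (x : (ℝ × Vel d) × Vel d) :
    ∫ w, dualKernel (v, w) x ∂ν = gainLoss v (fourierMeas ν) x - fourierConst d * wave x.2 v := by
  simp_rw [dualKernel_eq]
  have h := fun ξ => integrable_wave ν ξ
  rw [integral_neg, integral_const_mul, integral_sub, integral_sub, integral_add, integral_const,
    integral_const_mul, integral_const_mul, gainLoss, fourierMeas_eq, fourierMeas_eq,
    fourierMeas_eq]
  · simp only [probReal_univ, one_smul]
    ring
  · exact integrable_const _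
  · exact h _
  · exact (integrable_const _).add (h _)
  · exact (h _).const_mul _
  · exact ((integrable_const _).add (h _)).sub ((h _).const_mul _)
  · exact (h _).const_mul _

/-- Scalar products with the collisions of a particle of velocity `v` with a probability
measure. -/
theorem inner_integral_meanIncrement (hd : 2 ≤ d) (hr₀ : 0 < r) (hr₁ : r < 1)
    (hM : M.IsMaxwellianWith γbar) (hκ : IntegrableOn (kappaDensity r) (Ioc 0 Real.pi) γbar)
    (v : Vel d) {ν : Measure (Vel d)} (hν : ν ∈ probMoment d r) (h : Hdot d (d / 2 + r)) :
    Integrable (fun x => inner ℂ (h x.2)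
        (gainLoss v (fourierMeas ν) x - fourierConst d * wave x.2 v))
      ((outcome d γbar).prod (sobolevWeight d (d / 2 + r))) ∧
    inner ℂ h (∫ w, M.meanIncrement r (v, w) ∂ν) =
      ∫ x, inner ℂ (h x.2) (gainLoss v (fourierMeas ν) x - fourierConst d * wave x.2 v)
        ∂((outcome d γbar).prod (sobolevWeight d (d / 2 + r))) := by
  have hsf := sigmaFinite_restrict hr₀ hr₁ hκ
  have : SFinite (outcome d γbar) := by unfold outcome; infer_instance
  have := hν.1
  have hint1 : Integrable (fun p : (Vel d × (ℝ × Vel d)) × Vel d =>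
      inner ℂ (h p.2) (dualKernel (v, p.1.1) (p.1.2, p.2)))
      ((ν.prod (outcome d γbar)).prod (sobolevWeight d (d / 2 + r))) := by
    refine integrable_inner_of_lintegral_le (ν.prod (outcome d γbar)) h
      (f := fun p => dualKernel (v, p.1.1) (p.1.2, p.2)) (by fun_prop)
      (B := fun y => ENNReal.ofReal
        (collisionConst d r * ‖y.1 - v‖ ^ r * -kappaDensity r y.2.1)) ?_ ?_
    · exact (Integrable.mul_prod ((integrable_norm_sub_rpow hr₀ hr₁ v hν).const_mul _)
        (integrable_outcome (integrable_kappaDensity hκ))).lintegral_lt_top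
    · have h1 : ∀ᵐ y ∂(ν.prod (outcome d γbar)), y.2.1 ∈ Icc 0 Real.pi :=
        Measure.quasiMeasurePreserving_snd.ae ae_outcome
      filter_upwards [h1] with y hy
      exact lintegral_dualKernel_le (by omega) hr₀ hr₁ (v, y.1) hy
  have hint2 : Integrable (fun p : Vel d × ((ℝ × Vel d) × Vel d) =>
      inner ℂ (h p.2.2) (dualKernel (v, p.1) p.2))
      (ν.prod ((outcome d γbar).prod (sobolevWeight d (d / 2 + r)))) :=
    ((measurePreserving_prodAssoc ν (outcome d γbar)
      (sobolevWeight d (d / 2 + r))).symm.integrable_comp_emb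
        MeasurableEquiv.prodAssoc.symm.measurableEmbedding).2 hint1
  have hw : ∀ x : (ℝ × Vel d) × Vel d, ∫ w, inner ℂ (h x.2) (dualKernel (v, w) x) ∂ν =
      inner ℂ (h x.2) (gainLoss v (fourierMeas ν) x - fourierConst d * wave x.2 v) := by
    intro x
    simp_rw [RCLike.inner_apply]
    rw [integral_mul_const, integral_dualKernel]
  constructor
  · exact hint2.integral_prod_right.congr (Filter.Eventually.of_forall hw)
  · rw [← integral_inner (integrable_meanIncrement_right hd hr₀ hr₁ hM hκ v hν)]
    simp_rw [inner_meanIncrement hd hr₀ hr₁ hM hκ]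
    rw [integral_integral_swap hint2]
    exact integral_congr_ae (Filter.Eventually.of_forall hw)

theorem gainLoss_add (v : Vel d) (G G' : Vel d → ℂ) (x : (ℝ × Vel d) × Vel d) :
    gainLoss v (G + G') x = gainLoss v G x + gainLoss v G' x := by
  simp only [gainLoss, Pi.add_apply]
  ring

/-- Scalar products with the linearized operator, on the Fourier side: the loss of the particle
of velocity `v` cancels between two probability measures. -/
theorem inner_linAt (hd : 2 ≤ d) (hr₀ : 0 < r) (hr₁ : r < 1)
    (hM : M.IsMaxwellianWith γbar) (hκ : IntegrableOn (kappaDensity r) (Ioc 0 Real.pi) γbar)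
    (v : Vel d) (h : Hdot d (d / 2 + r)) (c : MeasPair d r →₀ ℂ) :
    Integrable (fun x => inner ℂ (h x.2) (gainLoss v (combineFourier d r c) x))
      ((outcome d γbar).prod (sobolevWeight d (d / 2 + r))) ∧
    inner ℂ h (M.linAt r v c) =
      ∫ x, inner ℂ (h x.2) (gainLoss v (combineFourier d r c) x)
        ∂((outcome d γbar).prod (sobolevWeight d (d / 2 + r))) := by
  induction c using Finsupp.induction_linear with
  | zero => simp [gainLoss]
  | add c c' h1 h2 =>
    simp_rw [map_add, gainLoss_add, inner_add_right]
    refine ⟨h1.1.add h2.1, ?_⟩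
    rw [integral_add h1.1 h2.1, h1.2, h2.2]
  | single y a =>
    obtain ⟨i1, e1⟩ := inner_integral_meanIncrement hd hr₀ hr₁ hM hκ v y.2.1 h
    obtain ⟨i2, e2⟩ := inner_integral_meanIncrement hd hr₀ hr₁ hM hκ v y.2.2 h
    have h1 : ∀ x, inner ℂ (h x.2) (gainLoss v (combineFourier d r (Finsupp.single y a)) x) =
        a * (inner ℂ (h x.2) (gainLoss v (fourierMeas y.1.1) x - fourierConst d * wave x.2 v) -
          inner ℂ (h x.2)
            (gainLoss v (fourierMeas y.1.2) x - fourierConst d * wave x.2 v)) := by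
      intro x
      rw [← inner_sub_right, ← inner_smul_right, combineFourier, Finsupp.linearCombination_single]
      congr 1
      simp only [gainLoss, Pi.smul_apply, smul_eq_mul]
      ring
    simp_rw [h1]
    refine ⟨(i1.sub i2).const_mul a, ?_⟩
    rw [integral_const_mul, integral_sub i1 i2, ← e1, ← e2, linAt,
      Finsupp.linearCombination_single, inner_smul_right, inner_sub_right]

theorem linAt_re_le (hd : 2 ≤ d) (hr₀ : 0 < r) (hr₁ : r < 1)
    (hM : M.IsMaxwellianWith γbar) (hκ : IntegrableOn (kappaDensity r) (Ioc 0 Real.pi) γbar)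
    (v : Vel d) (c : MeasPair d r →₀ ℂ) :
    (inner ℂ (combine d r c) (M.linAt r v c)).re ≤
      -(∫ θ in Ioc 0 Real.pi, kappaDensity r θ ∂γbar) * ‖combine d r c‖ ^ 2 := by
  obtain ⟨hi, he⟩ := inner_linAt hd hr₀ hr₁ hM hκ v (combine d r c) c
  rw [he]
  have h1 := integral_re (𝕜 := ℂ) hi
  simp only [RCLike.re_to_complex] at h1
  rw [← h1]
  exact integral_outcome_gainLoss_re_le hd hr₀ hr₁ hκ (measurable_combineFourier c)
    (combine_coeFn (by omega) hr₀ hr₁ c) v hi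

theorem norm_linAt_le (hd : 2 ≤ d) (hr₀ : 0 < r) (hr₁ : r < 1)
    (hM : M.IsMaxwellianWith γbar) (hκ : IntegrableOn (kappaDensity r) (Ioc 0 Real.pi) γbar)
    [IsFiniteMeasure γbar] (v : Vel d) (c : MeasPair d r →₀ ℂ) :
    ‖M.linAt r v c‖ ≤ 3 * γbar.real univ * ‖combine d r c‖ := by
  set y := M.linAt r v c with hy
  have h1 := enorm_integral_outcome_gainLoss_le hd hr₀ hr₁ hκ (h' := y)
    (measurable_combineFourier c) (combine_coeFn (by omega) hr₀ hr₁ c) v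
  rw [← (inner_linAt hd hr₀ hr₁ hM hκ v y c).2, ← hy] at h1
  have h2 : ‖inner ℂ y y‖ ≤ γbar.real univ * (3 * (‖y‖ * ‖combine d r c‖)) := by
    have h3 := ENNReal.toReal_mono (by finiteness) h1
    simpa [ENNReal.toReal_mul, measureReal_def] using h3
  rw [inner_self_eq_norm_sq_to_K, norm_pow, RCLike.norm_ofReal, abs_norm] at h2
  rcases (norm_nonneg y).eq_or_lt with h0 | h0
  · rw [← h0]
    positivity
  · refine le_of_mul_le_mul_left ?_ h0
    linarith

theorem integral_linAt (hd : 2 ≤ d) (hr₀ : 0 < r) (hr₁ : r < 1)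
    (hM : M.IsMaxwellianWith γbar) (hκ : IntegrableOn (kappaDensity r) (Ioc 0 Real.pi) γbar)
    {μ : Measure (Vel d)} (hμ : μ ∈ probMoment d r) (c : MeasPair d r →₀ ℂ) :
    Integrable (fun v => M.linAt r v c) μ ∧ M.linQ r μ c = ∫ v, M.linAt r v c ∂μ := by
  induction c using Finsupp.induction_linear with
  | zero => simp
  | add c c' h1 h2 =>
    simp_rw [map_add]
    exact ⟨h1.1.add h2.1, by rw [integral_add h1.1 h2.1, h1.2, h2.2]⟩
  | single y a =>
    have := hμ.1
    have := y.2.1.1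
    have := y.2.2.1
    have i1 := integrable_meanIncrement hd hr₀ hr₁ hM hκ hμ y.2.1
    have i2 := integrable_meanIncrement hd hr₀ hr₁ hM hκ hμ y.2.2
    simp_rw [linAt, linQ, Finsupp.linearCombination_single]
    refine ⟨(i1.integral_prod_left.sub i2.integral_prod_left).smul a, ?_⟩
    rw [integral_smul, integral_sub i1.integral_prod_left i2.integral_prod_left, smul_sub (2 : ℝ),
      two_smul_Q, two_smul_Q, integral_prod _ i1, integral_prod _ i2]

theorem linQ_re_le (hd : 2 ≤ d) (hr₀ : 0 < r) (hr₁ : r < 1)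
    (hM : M.IsMaxwellianWith γbar) (hκ : IntegrableOn (kappaDensity r) (Ioc 0 Real.pi) γbar)
    {μ : Measure (Vel d)} (hμ : μ ∈ probMoment d r) (c : MeasPair d r →₀ ℂ) :
    (inner ℂ (M.linQ r μ c) (combine d r c)).re ≤
      -(∫ θ in Ioc 0 Real.pi, kappaDensity r θ ∂γbar) * ‖combine d r c‖ ^ 2 := by
  have := hμ.1
  obtain ⟨hi, he⟩ := integral_linAt hd hr₀ hr₁ hM hκ hμ c
  have h1 : (inner ℂ (M.linQ r μ c) (combine d r c)).re =
      (inner ℂ (combine d r c) (M.linQ r μ c)).re := by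
    rw [← inner_conj_symm, Complex.conj_re]
  have hi2 : Integrable (fun v => inner ℂ (combine d r c) (M.linAt r v c)) μ := hi.const_inner _
  have h2 := integral_re (𝕜 := ℂ) hi2
  simp only [RCLike.re_to_complex] at h2
  rw [h1, he, ← integral_inner hi, ← h2]
  calc ∫ v, (inner ℂ (combine d r c) (M.linAt r v c)).re ∂μ
      ≤ ∫ _, -(∫ θ in Ioc 0 Real.pi, kappaDensity r θ ∂γbar) * ‖combine d r c‖ ^ 2 ∂μ :=
        integral_mono hi2.re (integrable_const _) fun v =>
          linAt_re_le hd hr₀ hr₁ hM hκ v c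
    _ = _ := by simp

theorem norm_linQ_le (hd : 2 ≤ d) (hr₀ : 0 < r) (hr₁ : r < 1)
    (hM : M.IsMaxwellianWith γbar) (hκ : IntegrableOn (kappaDensity r) (Ioc 0 Real.pi) γbar)
    [IsFiniteMeasure γbar] {μ : Measure (Vel d)} (hμ : μ ∈ probMoment d r)
    (c : MeasPair d r →₀ ℂ) :
    ‖M.linQ r μ c‖ ≤ 3 * γbar.real univ * ‖combine d r c‖ := by
  have := hμ.1
  rw [(integral_linAt hd hr₀ hr₁ hM hκ hμ c).2]
  refine (norm_integral_le_of_norm_le (integrable_const _) (Filter.Eventually.of_forall fun v =>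
    norm_linAt_le hd hr₀ hr₁ hM hκ v c)).trans ?_
  simp

theorem Q_comm (hd : 2 ≤ d) (hr₀ : 0 < r) (hr₁ : r < 1)
    (hM : M.IsMaxwellianWith γbar) (hκ : IntegrableOn (kappaDensity r) (Ioc 0 Real.pi) γbar)
    {μ ν : Measure (Vel d)} [SFinite μ] [SFinite ν] :
    M.Q (d / 2 + r) μ ν = M.Q (d / 2 + r) ν μ := by
  refine smul_right_injective _ (two_ne_zero (α := ℝ)) ?_
  dsimp only
  rw [two_smul_Q, two_smul_Q, ← integral_prod_swap]
  simp_rw [meanIncrement_swap hd hr₀ hr₁ hM hκ]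

/-- The quadratic dependence of the collision kernel along a segment of measures. -/
theorem Q_segment (hd : 2 ≤ d) (hr₀ : 0 < r) (hr₁ : r < 1)
    (hM : M.IsMaxwellianWith γbar) (hκ : IntegrableOn (kappaDensity r) (Ioc 0 Real.pi) γbar)
    {μ ν : Measure (Vel d)} (hμ : μ ∈ probMoment d r) (hν : ν ∈ probMoment d r)
    {t : ℝ} (ht : t ∈ Icc (0 : ℝ) 1) :
    M.Q (d / 2 + r) (ENNReal.ofReal (1 - t) • μ + ENNReal.ofReal t • ν)
        (ENNReal.ofReal (1 - t) • μ + ENNReal.ofReal t • ν) =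
      ((1 - t) * (1 - t)) • M.Q (d / 2 + r) μ μ + (2 * ((1 - t) * t)) • M.Q (d / 2 + r) μ ν +
        (t * t) • M.Q (d / 2 + r) ν ν := by
  have := hμ.1
  have := hν.1
  have hi := fun {μ ν} (hμ : μ ∈ probMoment d r) (hν : ν ∈ probMoment d r) =>
    integrable_meanIncrement hd hr₀ hr₁ hM hκ hμ hν
  have ht1 : 0 ≤ 1 - t := by linarith [ht.2]
  have hs : ∀ (a b : ℝ) (μ ν : Measure (Vel d)) [SFinite μ] [SFinite ν],
      (ENNReal.ofReal a • μ).prod (ENNReal.ofReal b • ν) =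
        (ENNReal.ofReal a * ENNReal.ofReal b) • μ.prod ν := fun a b μ ν _ _ => by
    rw [Measure.prod_smul_left, Measure.prod_smul_right, smul_smul]
  have hsi : ∀ (a b : ℝ) (ρ : Measure (Vel d × Vel d)), Integrable (M.meanIncrement r) ρ →
      Integrable (M.meanIncrement r) ((ENNReal.ofReal a * ENNReal.ofReal b) • ρ) :=
    fun a b ρ h => h.smul_measure (by finiteness)
  have := Measure.smul_finite μ (c := ENNReal.ofReal (1 - t)) (by finiteness)
  have := Measure.smul_finite ν (c := ENNReal.ofReal t) (by finiteness)
  refine smul_right_injective _ (two_ne_zero (α := ℝ)) ?_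
  dsimp only
  rw [smul_add, smul_add, smul_comm (2 : ℝ), smul_comm (2 : ℝ) (2 * ((1 - t) * t)),
    smul_comm (2 : ℝ) (t * t), two_smul_Q, two_smul_Q, two_smul_Q, two_smul_Q,
    Measure.prod_add, Measure.add_prod, Measure.add_prod, hs, hs, hs, hs,
    integral_add_measure ((hsi _ _ _ (hi hμ hμ)).add_measure (hsi _ _ _ (hi hν hμ)))
      ((hsi _ _ _ (hi hμ hν)).add_measure (hsi _ _ _ (hi hν hν))),
    integral_add_measure (hsi _ _ _ (hi hμ hμ)) (hsi _ _ _ (hi hν hμ)),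
    integral_add_measure (hsi _ _ _ (hi hμ hν)) (hsi _ _ _ (hi hν hν)),
    integral_smul_measure, integral_smul_measure, integral_smul_measure, integral_smul_measure,
    ← two_smul_Q ν μ, ← Q_comm hd hr₀ hr₁ hM hκ, two_smul_Q]
  simp only [ENNReal.toReal_mul, ENNReal.toReal_ofReal ht.1, ENNReal.toReal_ofReal ht1]
  module

theorem hasDerivWithinAt_Q (hd : 2 ≤ d) (hr₀ : 0 < r) (hr₁ : r < 1)
    (hM : M.IsMaxwellianWith γbar) (hκ : IntegrableOn (kappaDensity r) (Ioc 0 Real.pi) γbar)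
    {μ ν : Measure (Vel d)} (hμ : μ ∈ probMoment d r) (hν : ν ∈ probMoment d r) :
    HasDerivWithinAt
      (fun t : ℝ => M.Q (d / 2 + r) (ENNReal.ofReal (1 - t) • μ + ENNReal.ofReal t • ν)
        (ENNReal.ofReal (1 - t) • μ + ENNReal.ofReal t • ν))
      ((2 : ℝ) • (M.Q (d / 2 + r) ν μ - M.Q (d / 2 + r) μ μ)) (Icc 0 1) 0 := by
  have := hμ.1
  have := hν.1
  have hid : HasDerivAt (fun t : ℝ => t) 1 0 := hasDerivAt_id 0
  have h1 : HasDerivAt (fun t : ℝ => 1 - t) (-1) 0 := hid.const_sub 1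
  have h2 := (((h1.mul h1).smul_const (M.Q (d / 2 + r) μ μ)).add
    (((h1.mul hid).const_mul 2).smul_const (M.Q (d / 2 + r) μ ν))).add
    ((hid.mul hid).smul_const (M.Q (d / 2 + r) ν ν))
  have h3 := h2.hasDerivWithinAt (s := Icc 0 1)
  refine (h3.congr_of_mem (fun t ht => Q_segment hd hr₀ hr₁ hM hκ hμ hν ht)
    ⟨le_rfl, zero_le_one⟩).congr_deriv ?_
  rw [Q_comm hd hr₀ hr₁ hM hκ (μ := ν) (ν := μ)]
  module

end CollisionModel

end Boltzmann

end

open Boltzmann in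
theorem theorem4p6 (d : ℕ) (hd : 2 ≤ d) (r : ℝ) (hr₀ : 0 < r) (hr₁ : r < 1)
    (M : Boltzmann.CollisionModel d) (γbar : Measure ℝ) (hM : M.IsMaxwellianWith γbar)
    (hκ : IntegrableOn (Boltzmann.kappaDensity r) (Ioc 0 Real.pi) γbar)
    (κ : ℝ) (hκ_def : κ = ∫ θ in Ioc 0 Real.pi, Boltzmann.kappaDensity r θ ∂γbar) :
    M.QWellDefined r ∧
    Dense (Boltzmann.zeroMass d r : Set (Boltzmann.Hdot d (d / 2 + r))) ∧
    ∀ μ ∈ Boltzmann.probMoment d r,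
      ∃ D : Boltzmann.zeroMass d r →ₗ[ℂ] Boltzmann.Hdot d (d / 2 + r),
        M.IsDerivAt r μ D ∧
        (∀ h : Boltzmann.zeroMass d r,
          (inner ℂ (D h) (h : Boltzmann.Hdot d (d / 2 + r))).re ≤ -κ * ‖h‖ ^ 2) ∧
        (IsFiniteMeasure γbar →
          ∃ B : Boltzmann.Hdot d (d / 2 + r) →L[ℂ] Boltzmann.Hdot d (d / 2 + r),
            (∀ h : Boltzmann.zeroMass d r, B h = D h) ∧
            ∀ h : Boltzmann.Hdot d (d / 2 + r), (inner ℂ (B h) h).re ≤ -κ * ‖h‖ ^ 2) := by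
  have hdense := dense_zeroMass (d := d) (by omega) hr₀ hr₁
  refine ⟨CollisionModel.qWellDefined hd hr₀ hr₁ hM hκ, hdense, fun μ hμ => ?_⟩
  have hre := CollisionModel.linQ_re_le hd hr₀ hr₁ hM hκ hμ
  rw [← hκ_def] at hre
  have hdense' : Dense (LinearMap.range (combine d r) : Set (Hdot d (d / 2 + r))) := by
    rwa [range_combine]
  have hker : ∀ c, combine d r c = 0 → M.linQ r μ c = 0 := fun c =>
    eq_zero_of_dissipative (combine d r) (M.linQ r μ) κ hdense' hre
  have hmem : ∀ c, combine d r c ∈ zeroMass d r := fun c => by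
    rw [← range_combine]
    exact LinearMap.mem_range_self _ c
  -- A linear section `R` of the formal combinations turns `2 Q(μ, ·)` into an operator on the span;
  -- by `hker` the choice of the section does not matter.
  obtain ⟨R, hR⟩ :=
    ((combine d r).codRestrict (zeroMass d r) hmem).exists_rightInverse_of_surjective (by
      rw [LinearMap.range_eq_top]
      rintro ⟨h, hh⟩
      rw [← range_combine] at hh
      obtain ⟨c, hc⟩ := hh
      exact ⟨c, Subtype.ext hc⟩)
  have hR' : ∀ h : zeroMass d r, combine d r (R h) = h := fun h =>
    congrArg Subtype.val (LinearMap.congr_fun hR h)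
  have hD : ∀ (h : zeroMass d r) (c), (h : Hdot d (d / 2 + r)) = combine d r c →
      (M.linQ r μ ∘ₗ R) h = M.linQ r μ c := by
    intro h c hc
    rw [LinearMap.comp_apply, ← sub_eq_zero, ← map_sub]
    refine hker _ ?_
    rw [map_sub, hR', hc, sub_self]
  have hpair : ∀ ν ∈ probMoment d r, ∀ ν' ∈ probMoment d r, ∀ h : zeroMass d r,
      (h : Hdot d (d / 2 + r)) = ofDiff (d / 2 + r) ν ν' → (M.linQ r μ ∘ₗ R) h =
        (2 : ℝ) • (M.Q (d / 2 + r) μ ν - M.Q (d / 2 + r) μ ν') := by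
    intro ν hν ν' hν' h hh
    rw [hD h (Finsupp.single ⟨(ν, ν'), hν, hν'⟩ 1), CollisionModel.linQ,
      Finsupp.linearCombination_single, one_smul]
    rw [hh, combine, Finsupp.linearCombination_single, one_smul]
  refine ⟨M.linQ r μ ∘ₗ R, ⟨fun ν hν h hh => ?_, hpair⟩, fun h => ?_, fun hfin => ?_⟩
  · rw [hpair ν hν μ hμ h hh]
    have := hμ.1
    have := hν.1
    rw [CollisionModel.Q_comm hd hr₀ hr₁ hM hκ (μ := μ) (ν := ν)]
    exact CollisionModel.hasDerivWithinAt_Q hd hr₀ hr₁ hM hκ hμ hν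
  · have h1 := hre (R h)
    rwa [hR'] at h1
  · have hdr : DenseRange (combine d r) := hdense'
    have hB : ∀ c, (M.linQ r μ).extendOfNorm (combine d r) (combine d r c) = M.linQ r μ c :=
      LinearMap.extendOfNorm_eq hdr
        ⟨_, CollisionModel.norm_linQ_le hd hr₀ hr₁ hM hκ hμ⟩
    refine ⟨(M.linQ r μ).extendOfNorm (combine d r), fun h => ?_, fun h => ?_⟩
    · conv_lhs => rw [← hR' h]
      exact hB (R h)
    · refine hdr.induction_on (p := fun h => (inner ℂ
        ((M.linQ r μ).extendOfNorm (combine d r) h) h).re ≤ -κ * ‖h‖ ^ 2) h ?_ fun c => ?_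
      · exact isClosed_le (by fun_prop) (by fun_prop)
      · rw [hB]
        exact hre c
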